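/- Let $n\ge 1$, and let $\mathbb R^{2n}$, with coordinates $(x,y)\in\mathbb R^n\times\mathbb R^n$, carry the symplectic form $\omega_0=\sum_j dx_j\wedge dy_j$, so that $\omega_0(u,v)=J_0u\cdot v$ with $J_0(x,y)=(-y,x)$. Let $\widetilde{\mathrm{Sp}}(2n)$ be the universal cover of the linear symplectic group $\mathrm{Sp}(2n)$, realized as the group of homotopy classes with fixed end-points of continuous paths $\gamma:[0,1]\to\mathrm{Sp}(2n)$ with $\gamma(0)=\mathrm{id}$, and let $\pi([\gamma])=\gamma(1)$ be the covering homomorphism. A $C^1$ curve $w:[0,1]\to\widetilde{\mathrm{Sp}}(2n)$ with projection $W=\pi\circ w$ is called timelike (resp. causal) if for every $t$ the bilinear form $(u,v)\mapsto\omega_0(u,W'(t)W(t)^{-1}v)$ is symmetric and positive definite (resp. symmetric, positive semi-definite and non-zero). Its length is $\mathrm{length}_G(w)=\int_0^1 \det\bigl(W'(t)W(t)^{-1}\bigr)^{\frac1{2n}}\,dt$. The Lorentz distance $\mathrm{dist}_G(p,q)\in[0,+\infty]$ is the supremum of $\mathrm{length}_G$ over all causal curves from $p$ to $q$, and $0$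 if there are none. Let $\kappa(z,z')=\langle -iJ_0z,z'\rangle$ be the Krein form on $\mathbb C^{2n}$, where $\langle\cdot,\cdot\rangle$ is the standard Hermitian product, linear in the first argument. An eigenvalue on the unit circle is Krein-positive if $\kappa$ is positive definite on its generalized eigenspace. Let $\mathrm{Sp}^+_{\mathrm{ell}}(2n)$ be the set of $W\in\mathrm{Sp}(2n)$ all of whose eigenvalues are on the unit circle and different from $\pm1$, those with positive imaginary part being Krein-positive. Let $\widetilde{\mathrm{Sp}}{}^+_{\mathrm{ell}}(2n)$ be the set of classes $[\gamma]\in\widetilde{\mathrm{Sp}}(2n)$ of paths with $\gamma(0)=\mathrm{id}$ and $\gamma(t)\in \mathrm{Sp}^+_{\mathrm{ell}}(2n)$ for all $t\in(0,1]$. There is exactly one function $\mu:\widetilde{\mathrm{Sp}}(2n)\to\mathbb R$, the homogeneous Maslov quasimorphism, which is a quasimorphism ($|\mu(vw)-\mu(v)-\mu(w)|\le C$ for all $v,w$ and some constant $C$), is homogeneous ($\mu(w^k)=k\mu(w)$ for all $k\in\mathbb Z$), and whose restriction to $\pi^{-1}(\mathrm U(n))$ is the lift of the complex determinant, that is, this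 restriction is continuous, vanishes at $\mathrm{id}$ and satisfies $e^{2\pi i\mu(w)}=\det_{\mathbb C}\pi(w)$. Here $\mathrm U(n)=\mathrm{Sp}(2n)\cap\mathrm O(2n)$ and $\mathbb R^{2n}$ is identified with $\mathbb C^n$ by $(x,y)\mapsto x+iy$. Let $w\in\widetilde{\mathrm{Sp}}(2n)$. Then: (i) If $w$ is in the closure of $\widetilde{\mathrm{Sp}}{}^+_{\mathrm{ell}}(2n)$, then there are $\theta_1,\dots,\theta_n\in[0,\pi]$ such that the eigenvalues of $\pi(w)$, counted with algebraic multiplicity, are $e^{\pm i\theta_1},\dots,e^{\pm i\theta_n}$, and $$\mathrm{dist}_G(\mathrm{id},w)\le\frac{2\pi}{n}\,\mu(w)=\frac1n\sum_{j=1}^n\theta_j.$$ (ii) If there is a timelike curve from $\mathrm{id}$ to $w$ and $w$ is not in the closure of $\widetilde{\mathrm{Sp}}{}^+_{\mathrm{ell}}(2n)$, then $\mathrm{dist}_G(\mathrm{id},w)=+\infty$. -/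

import Mathlib

open scoped Matrix unitInterval ENNReal

noncomputable section

namespace SympLorentz

/-! ### The linear symplectic group and its bi-invariant Lorentz-Finsler structure

Vectors of `ℝ²ⁿ` are functions on `Fin n ⊕ Fin n`, the first summand carrying the coordinates
`x₁, …, xₙ` and the second one the coordinates `y₁, …, yₙ`. The matrix `Matrix.J` is the standard
complex structure `J₀ (x, y) = (-y, x)`, and `ω₀(u, v) = (J₀ u) · v = ∑ⱼ dxⱼ ∧ dyⱼ (u, v)`. -/

/-- Real matrices of size `2n`. -/
abbrev Mat (n : ℕ) : Type := Matrix (Fin n ⊕ Fin n) (Fin n ⊕ Fin n) ℝ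

/-- The standard complex structure `J₀` of `ℝ²ⁿ`. -/
abbrev J₀ (n : ℕ) : Mat n := Matrix.J (Fin n) ℝ

/-- The linear symplectic group `Sp(2n)`, with the topology induced by the space of matrices. -/
abbrev Sp (n : ℕ) : Type := Matrix.symplecticGroup (Fin n) ℝ

/-- The open cone `sp⁺(2n)`: the matrices `X` such that `(u, v) ↦ ω₀(u, X v) = u · (J₀ᵀ X) v` is
symmetric and positive definite. -/
def spPlus (n : ℕ) : Set (Mat n) := {X | ((J₀ n)ᵀ * X).PosDef}

/-- The causal vectors of the Lie algebra, that is, the non-zero elements of the closure of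
`sp⁺(2n)`: `(u, v) ↦ ω₀(u, X v)` is symmetric and positive semi-definite, and `X ≠ 0`. -/
def spCausal (n : ℕ) : Set (Mat n) := {X | ((J₀ n)ᵀ * X).PosSemidef ∧ X ≠ 0}

/-- The Lorentz-Finsler metric `G(X) = (det X) ^ (1 / (2n))` (it vanishes on the boundary of
`sp⁺(2n)`). -/
def G (n : ℕ) (X : Mat n) : ℝ := X.det ^ (1 / (2 * (n : ℝ)))

/-! ### The universal cover -/

instance (n : ℕ) : IsTopologicalGroup (Sp n) where
  continuous_inv := by
    refine Continuous.subtype_mk ?_ _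
    fun_prop

/-- The group, under pointwise multiplication, of continuous paths `[0,1] → Sp(2n)` starting at
the identity. It carries the compact-open topology. -/
def PathGroup (n : ℕ) : Subgroup C(I, Sp n) where
  carrier := {γ | γ 0 = 1}
  mul_mem' := by
    intro a b ha hb
    simp only [Set.mem_ofPred_eq] at ha hb
    simp [ha, hb]
  one_mem' := by simp
  inv_mem' := by
    intro a ha
    simp only [Set.mem_ofPred_eq] at ha
    simp [ha]

/-- Homotopy with fixed end-points, as a congruence relation on the group of paths. -/
def pathCon (n : ℕ) : Con (PathGroup n) where
  r γ δ := (γ : C(I, Sp n)).HomotopicRel (δ : C(I, Sp n)) {0, 1}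
  iseqv :=
    ⟨fun _ => ContinuousMap.HomotopicRel.refl _, fun h => h.symm, fun h k => h.trans k⟩
  mul' := by
    rintro a b c d ⟨F⟩ ⟨H⟩
    refine ⟨⟨⟨⟨fun p => F p * H p, by fun_prop⟩, ?_, ?_⟩, ?_⟩⟩
    · intro x
      simp
    · intro x
      simp
    · intro t x hx
      have h1 := F.prop' t x hx
      have h2 := H.prop' t x hx
      exact congrArg₂ (· * ·) h1 h2

/-- The universal cover of `Sp(2n)`: homotopy classes with fixed end-points of continuous paths
`[0,1] → Sp(2n)` starting at the identity. -/
def SpTilde (n : ℕ) : Type := (pathCon n).Quotient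

instance (n : ℕ) : Group (SpTilde n) := inferInstanceAs (Group (pathCon n).Quotient)

/-- The quotient of the compact-open topology. Since `Sp(2n)` is a manifold, this is the topology
of the universal cover. -/
instance (n : ℕ) : TopologicalSpace (SpTilde n) :=
  inferInstanceAs (TopologicalSpace (Quotient (pathCon n).toSetoid))

/-- The homotopy class of a path starting at the identity. -/
def SpTilde.mk {n : ℕ} (γ : PathGroup n) : SpTilde n := Quotient.mk (pathCon n).toSetoid γ

/-- The covering homomorphism `π : [γ] ↦ γ(1)`. -/
def SpTilde.proj {n : ℕ} (w : SpTilde n) : Sp n :=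
  Quotient.lift (fun γ : PathGroup n => (γ : C(I, Sp n)) 1)
    (fun _ _ h => ContinuousMap.HomotopicRel.fst_eq_snd h (by simp)) w

/-! ### Timelike and causal curves, length and Lorentz distance -/

/-- The matrix entries of the projection to `Sp(2n)` of a curve in the universal cover. -/
def projCurve {n : ℕ} (w : ℝ → SpTilde n) (t : ℝ) : Mat n := ((w t).proj : Mat n)

/-- The derivative on `[0,1]` of the projection of a curve in the universal cover. -/
def projDeriv {n : ℕ} (w : ℝ → SpTilde n) (t : ℝ) : Mat n :=
  Matrix.of fun i j => derivWithin (fun s => projCurve w s i j) (Set.Icc 0 1) t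

/-- The velocity of a curve in the universal cover, translated to the identity: the element
`W'(t) W(t)⁻¹` of the Lie algebra, where `W` is the projection of the curve to `Sp(2n)`. -/
def velocity {n : ℕ} (w : ℝ → SpTilde n) (t : ℝ) : Mat n :=
  projDeriv w t * (((w t).proj)⁻¹ : Sp n)

/-- `w` restricts to a `C¹` curve `[0,1] → SpTilde n`. The smooth structure of the universal cover
is the one for which the covering map is a local diffeomorphism, so this means that `w` is
continuous and that its projection is of class `C¹`. -/
def IsC1Curve {n : ℕ} (w : ℝ → SpTilde n) : Prop :=
  ContinuousOn w (Set.Icc 0 1) ∧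
    ∀ i j, ContDiffOn ℝ 1 (fun t => projCurve w t i j) (Set.Icc 0 1)

/-- A timelike curve `[0,1] → SpTilde n` from `p` to `q`. -/
def IsTimelikeCurve {n : ℕ} (w : ℝ → SpTilde n) (p q : SpTilde n) : Prop :=
  IsC1Curve w ∧ w 0 = p ∧ w 1 = q ∧ ∀ t ∈ Set.Icc (0 : ℝ) 1, velocity w t ∈ spPlus n

/-- A causal curve `[0,1] → SpTilde n` from `p` to `q`. -/
def IsCausalCurve {n : ℕ} (w : ℝ → SpTilde n) (p q : SpTilde n) : Prop :=
  IsC1Curve w ∧ w 0 = p ∧ w 1 = q ∧ ∀ t ∈ Set.Icc (0 : ℝ) 1, velocity w t ∈ spCausal n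

/-- The Lorentz-Finsler length of a causal curve. -/
def lengthG {n : ℕ} (w : ℝ → SpTilde n) : ℝ := ∫ t in (0 : ℝ)..1, G n (velocity w t)

/-- The Lorentz distance: the supremum of the lengths of the causal curves from `p` to `q`. When
there is no such curve, the supremum is that of the empty set, which is `0` in `[0, ∞]`. -/
def distG {n : ℕ} (p q : SpTilde n) : ℝ≥0∞ :=
  ⨆ (w : ℝ → SpTilde n) (_ : IsCausalCurve w p q), ENNReal.ofReal (lengthG w)

/-! ### The positively elliptic region -/

/-- A real matrix, acting on `ℂ²ⁿ`. -/
def complexify {n : ℕ} (W : Mat n) : Matrix (Fin n ⊕ Fin n) (Fin n ⊕ Fin n) ℂ :=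
  W.map (fun x : ℝ => (x : ℂ))

/-- The Krein form `κ(z, z') = ⟨-i J₀ z, z'⟩` on `ℂ²ⁿ`, where `⟨·,·⟩` is the standard Hermitian
product, linear in its first argument. -/
def krein {n : ℕ} (z z' : Fin n ⊕ Fin n → ℂ) : ℂ :=
  ((-Complex.I) • (complexify (J₀ n) *ᵥ z)) ⬝ᵥ star z'

/-- The eigenvalue `μ` of `W` is Krein-positive: the Hermitian form `κ` is positive definite on the
generalized eigenspace. -/
def IsKreinPositive {n : ℕ} (W : Mat n) (μ : ℂ) : Prop :=
  ∀ z ∈ Module.End.maxGenEigenspace (Matrix.toLin' (complexify W)) μ, z ≠ 0 → 0 < (krein z z).re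

/-- The positively elliptic region of `Sp(2n)`: all the eigenvalues are on the unit circle and
different from `±1`, and those with positive imaginary part are Krein-positive. -/
def SpEll (n : ℕ) : Set (Sp n) :=
  {W | ∀ μ : ℂ, Module.End.HasEigenvalue (Matrix.toLin' (complexify (W : Mat n))) μ →
    ‖μ‖ = 1 ∧ μ ≠ 1 ∧ μ ≠ -1 ∧ (0 < μ.im → IsKreinPositive (W : Mat n) μ)}

/-- The positively elliptic region of the universal cover: homotopy classes of paths `γ` starting
at the identity such that `γ(t)` is in the positively elliptic region for every `t ∈ (0,1]`. -/
def SpTildeEll (n : ℕ) : Set (SpTilde n) :=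
  {w | ∃ γ : PathGroup n, (∀ t : I, 0 < t → (γ : C(I, Sp n)) t ∈ SpEll n) ∧ SpTilde.mk γ = w}

/-! ### The homogeneous Maslov quasimorphism -/

/-- The preimage in the universal cover of the unitary group `U(n) = Sp(2n) ∩ O(2n)`. -/
def UTilde (n : ℕ) : Set (SpTilde n) :=
  {w | (w.proj : Mat n) ∈ Matrix.orthogonalGroup (Fin n ⊕ Fin n) ℝ}

/-- The complex determinant. In the identification `(x, y) ↦ x + i y` of `ℝ²ⁿ` with `ℂⁿ`, a matrix
`(A, -B; B, A)` commuting with `J₀` is the complex matrix `A + i B`. -/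
def complexDet {n : ℕ} (W : Mat n) : ℂ :=
  (W.toBlocks₁₁.map (fun x : ℝ => (x : ℂ)) +
    Complex.I • W.toBlocks₂₁.map (fun x : ℝ => (x : ℂ))).det

/-- `f` is a homogeneous quasimorphism on the universal cover of `Sp(2n)` whose restriction to the
preimage of `U(n)` is the lift of the complex determinant `U(n) → {|z| = 1}` to the universal
covers, where the circle is covered by `s ↦ exp(2πis)`. -/
structure IsHomogeneousMaslov (n : ℕ) (f : SpTilde n → ℝ) : Prop where
  quasimorphism : ∃ C : ℝ, ∀ v w, |f (v * w) - f v - f w| ≤ C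
  homogeneous : ∀ w, ∀ k : ℤ, f (w ^ k) = k * f w
  continuousOn_unitary : ContinuousOn f (UTilde n)
  lift_one : f 1 = 0
  lift_det : ∀ w ∈ UTilde n,
    Complex.exp (2 * Real.pi * Complex.I * (f w : ℂ)) = complexDet (w.proj : Mat n)

/-- The homogeneous Maslov quasimorphism, i.e. the function characterized by
`IsHomogeneousMaslov`. -/
def maslov (n : ℕ) : SpTilde n → ℝ := Classical.epsilon (IsHomogeneousMaslov n)

end SympLorentz

end

noncomputable section

namespace SympLorentz

open Matrix Set Filter Topology
open scoped Matrix.Norms.L2Operator ComplexOrder MatrixOrder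

variable {n : ℕ}

/-! ### Topology of the universal cover -/

/-! The whole argument rests on a monotone quantity. The argument of the complex determinant lifts
to a continuous function `phase` on the universal cover, and its derivative in a direction `X` with
`form X ≥ 0` is the trace of a product of two positive matrices (`phaseDeriv_nonneg`). Since the
cone is invariant under the adjoint action, the condition "phase (x u y) ≤ phase (x v y) for all x,
y" defines a bi-invariant preorder `le` along which causal curves increase (`HasVel.le`). The phase
is additive under multiplication by unitary elements, and the positive factor of a polar
decomposition lies between the rotations of angle ±π, so the phase is a quasimorphism. Its
homogenization `hphase` is continuous, monotone, invariant under conjugation, equal to `phase` on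
unitary elements, and is 2π times the Maslov quasimorphism (`maslov_eq`).

The positively elliptic matrices are exactly those with ω₀(v, Wv) > 0 for every v ≠ 0
(`mem_SpEll_iff`), equivalently those whose Cayley form `cayForm` is positive definite. They
therefore form a convex cone in the Cayley chart, have a canonical lift `princ`, and this lift lies
between 1 and the rotation of angle π. Each of them is conjugate to a unitary matrix
(`exists_conj_commute_J`), from which the angles and the value of `hphase` are read off; compactness
of [0, π]ⁿ carries this to the closure.

Upper bound for the distance. The Cayley form increases strictly along a timelike curve from 1, so
the curve stays elliptic until an eigenvalue reaches -1. If this happens, the curve dominates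
arbitrarily long shears in one direction (`HasVel.crossing`), whereas no rotation of angle less than
π does so (`not_forall_shear_le_rot`). Hence a timelike curve ending below such a rotation never
leaves the elliptic region (`HasVel.elliptic_of_le_rot`). At an elliptic point `hphase` grows at
rate at least n G(X): after conjugation to a unitary point, the part of X anticommuting with J₀ is
absorbed by an infinitesimal conjugation, the remaining part contributes half the trace of `form X`,
and the arithmetic-geometric mean inequality concludes. A causal curve to the closure is first
multiplied by small rotations that make it timelike and push its end below a rotation of angle less
than π (`lengthG_le`).

Infinite distance. A timelike curve ending outside the closure crosses, even after a little rotation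
is taken away from it on both sides. A shear of arbitrary length l can then be split off at the end,
leaving a non-negative curve. Spending the reserved rotation on both sides of the shear gives causal
curves to the same end-point whose length tends to infinity with l (`exists_causal_curve_of_shear`).
-/

instance : IsTopologicalGroup C(I, Sp n) where
  continuous_inv := ContinuousMap.continuous_postcomp (⟨fun g => g⁻¹, continuous_inv⟩ : C(Sp n, Sp n))

theorem SpTilde.continuous_mk : Continuous (SpTilde.mk (n := n)) := continuous_quotient_mk'

theorem SpTilde.mk_surjective : Function.Surjective (SpTilde.mk (n := n)) := Quotient.mk_surjective

theorem SpTilde.mk_mul (γ δ : PathGroup n) : SpTilde.mk (γ * δ) = SpTilde.mk γ * SpTilde.mk δ := rfl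

theorem SpTilde.mk_one : SpTilde.mk (1 : PathGroup n) = 1 := rfl

theorem SpTilde.mk_inv (γ : PathGroup n) : SpTilde.mk γ⁻¹ = (SpTilde.mk γ)⁻¹ := rfl

/-- Homotopy is a congruence, so the saturation of an open set is a union of left translates of it
by null-homotopic loops. Openness makes products of the quotient map quotient maps again, hence the
group operations continuous. -/
theorem SpTilde.isOpenMap_mk : IsOpenMap (SpTilde.mk (n := n)) := by
  intro U hU
  have : SpTilde.mk ⁻¹' (SpTilde.mk '' U) =
      ⋃ k ∈ {k : PathGroup n | SpTilde.mk k = 1}, (fun γ => k * γ) ⁻¹' U := by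
    ext γ
    simp only [mem_preimage, mem_image, mem_iUnion, mem_ofPred_eq, exists_prop]
    constructor
    · rintro ⟨δ, hδ, h⟩
      refine ⟨δ * γ⁻¹, ?_, by simpa using hδ⟩
      rw [SpTilde.mk_mul, SpTilde.mk_inv, h, mul_inv_cancel]
    · rintro ⟨k, hk, h⟩
      exact ⟨k * γ, h, by rw [SpTilde.mk_mul, hk, one_mul]⟩
  have h2 : IsOpen (SpTilde.mk ⁻¹' (SpTilde.mk '' U)) := by
    rw [this]
    exact isOpen_biUnion fun k _ => hU.preimage (continuous_const_mul k)
  exact h2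

theorem SpTilde.isOpenQuotientMap_mk : IsOpenQuotientMap (SpTilde.mk (n := n)) :=
  ⟨SpTilde.mk_surjective, SpTilde.continuous_mk, SpTilde.isOpenMap_mk⟩

instance : IsTopologicalGroup (SpTilde n) where
  continuous_mul := by
    rw [← (SpTilde.isOpenQuotientMap_mk.prodMap SpTilde.isOpenQuotientMap_mk).continuous_comp_iff]
    exact SpTilde.continuous_mk.comp continuous_mul
  continuous_inv := by
    rw [← SpTilde.isOpenQuotientMap_mk.continuous_comp_iff]
    exact SpTilde.continuous_mk.comp continuous_inv

theorem SpTilde.proj_mk (γ : PathGroup n) : (SpTilde.mk γ).proj = (γ : C(I, Sp n)) 1 := rfl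

theorem SpTilde.proj_mul (v w : SpTilde n) : (v * w).proj = v.proj * w.proj := by
  obtain ⟨γ, rfl⟩ := SpTilde.mk_surjective v
  obtain ⟨δ, rfl⟩ := SpTilde.mk_surjective w
  rfl

/-- The covering homomorphism. -/
def SpTilde.projHom (n : ℕ) : SpTilde n →* Sp n :=
  MonoidHom.mk' SpTilde.proj SpTilde.proj_mul

@[simp] theorem SpTilde.proj_one : (1 : SpTilde n).proj = 1 := (SpTilde.projHom n).map_one

theorem SpTilde.proj_inv (w : SpTilde n) : (w⁻¹).proj = w.proj⁻¹ := (SpTilde.projHom n).map_inv w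

theorem SpTilde.continuous_proj : Continuous (SpTilde.proj (n := n)) := by
  refine continuous_quot_lift _ ?_
  fun_prop

/-- The class of a path given by a continuous function. -/
def pathClass (f : I → Sp n) (hf : Continuous f) (h0 : f 0 = 1) : SpTilde n :=
  SpTilde.mk ⟨⟨f, hf⟩, h0⟩

theorem exists_pathClass (w : SpTilde n) : ∃ f hf h0, w = pathClass (n := n) f hf h0 := by
  obtain ⟨⟨γ, h⟩, rfl⟩ := SpTilde.mk_surjective w
  exact ⟨γ, γ.continuous, h, rfl⟩

@[simp] theorem proj_pathClass (f : I → Sp n) (hf : Continuous f) (h0 : f 0 = 1) :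
    (pathClass f hf h0).proj = f 1 := rfl

theorem pathClass_mul (f g : I → Sp n) (hf : Continuous f) (h0 : f 0 = 1) (hg : Continuous g)
    (k0 : g 0 = 1) : pathClass f hf h0 * pathClass g hg k0 =
      pathClass (fun t => f t * g t) (hf.mul hg) (by simp [h0, k0]) := rfl

theorem pathClass_congr {f g : I → Sp n} (hf : Continuous f) (h0 : f 0 = 1) (hg : Continuous g)
    (k0 : g 0 = 1) (h : ∀ t, f t = g t) : pathClass f hf h0 = pathClass g hg k0 := by
  obtain rfl : f = g := funext h
  rfl

theorem pathClass_one : pathClass (fun _ => (1 : Sp n)) continuous_const rfl = 1 := rfl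

theorem continuous_pathClass {X : Type*} [TopologicalSpace X] (F : X → I → Sp n)
    (hF : Continuous (Function.uncurry F)) (h0 : ∀ x, F x 0 = 1) :
    Continuous fun x => pathClass (F x) (hF.comp (by fun_prop : Continuous fun t => (x, t)))
      (h0 x) := by
  refine SpTilde.continuous_mk.comp (Continuous.subtype_mk ?_ _)
  exact (ContinuousMap.curry ⟨Function.uncurry F, hF⟩).continuous

theorem pathClass_eq_of_homotopy (H : I → I → Sp n) (hH : Continuous (Function.uncurry H))
    (h0 : ∀ u, H u 0 = 1) (h1 : ∀ u, H u 1 = H 0 1) :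
    pathClass (H 0) (hH.comp (by fun_prop : Continuous fun t => ((0 : I), t))) (h0 0) =
      pathClass (H 1) (hH.comp (by fun_prop : Continuous fun t => ((1 : I), t))) (h0 1) := by
  refine Quotient.sound ⟨⟨⟨⟨fun p => H p.1 p.2, hH⟩, fun x => rfl, fun x => rfl⟩, ?_⟩⟩
  rintro t x (rfl | rfl)
  · exact (h0 t).trans (h0 0).symm
  · exact h1 t

/-! ### Scaling of symplectic matrices in the Cayley chart -/

theorem J_mul_J : J₀ n * J₀ n = -1 := J_squared _ _

theorem J_transpose' : (J₀ n)ᵀ = -J₀ n := J_transpose _ _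

theorem mem_sp {W : Mat n} : W ∈ symplecticGroup (Fin n) ℝ ↔ Wᵀ * J₀ n * W = J₀ n :=
  SymplecticGroup.mem_iff'

theorem Sp.transpose_mul (W : Sp n) : (W : Mat n)ᵀ * J₀ n * (W : Mat n) = J₀ n := mem_sp.1 W.2

theorem Sp.det_eq_one (W : Sp n) : (W : Mat n).det = 1 := SymplecticGroup.det_eq_one W.2

/-- The denominator of the Cayley scaling. -/
def sclDen (s : ℝ) (W : Mat n) : Mat n := (1 - s) • W + (1 + s) • (1 : Mat n)

/-- The numerator of the Cayley scaling. -/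
def sclNum (s : ℝ) (W : Mat n) : Mat n := (1 + s) • W + (1 - s) • (1 : Mat n)

/-- The multiplication by `s` in the Cayley chart `(1 + B) (1 - B)⁻¹ ↦ B`. -/
def scl (s : ℝ) (W : Mat n) : Mat n := sclNum s W * (sclDen s W)⁻¹

theorem sclNum_commute (s : ℝ) (W : Mat n) : Commute (sclNum s W) (sclDen s W) := by
  have h1 : Commute W W := Commute.refl W
  unfold sclNum sclDen
  refine Commute.add_left ?_ ?_
  · exact (((h1.smul_right _).add_right ((Commute.one_right W).smul_right _))).smul_left _
  · exact (Commute.one_left _).smul_left _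

theorem mem_sp_of_num_den {P Q : Mat n} (hQ : Q.det ≠ 0) (h : Pᵀ * J₀ n * P = Qᵀ * J₀ n * Q) :
    P * Q⁻¹ ∈ symplecticGroup (Fin n) ℝ := by
  have hu : IsUnit Q.det := hQ.isUnit
  rw [mem_sp, transpose_mul]
  have h2 : Q⁻¹ᵀ * Qᵀ = 1 := by rw [← transpose_mul, mul_nonsing_inv _ hu, transpose_one]
  calc Q⁻¹ᵀ * Pᵀ * J₀ n * (P * Q⁻¹) = Q⁻¹ᵀ * (Pᵀ * J₀ n * P) * Q⁻¹ := by
        simp only [Matrix.mul_assoc]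
    _ = (Q⁻¹ᵀ * Qᵀ) * J₀ n * (Q * Q⁻¹) := by rw [h]; simp only [Matrix.mul_assoc]
    _ = J₀ n := by rw [h2, mul_nonsing_inv _ hu, Matrix.one_mul, Matrix.mul_one]

/-- Numerator and denominator are exchanged by s ↦ -s, and the form they pull back from J₀ depends
only on s². -/
theorem scl_mem {s : ℝ} {W : Mat n} (hW : W ∈ symplecticGroup (Fin n) ℝ)
    (hd : (sclDen s W).det ≠ 0) : scl s W ∈ symplecticGroup (Fin n) ℝ := by
  refine mem_sp_of_num_den hd ?_
  rw [mem_sp] at hW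
  simp only [sclNum, sclDen, transpose_add, transpose_smul, transpose_one, Matrix.add_mul,
    Matrix.mul_add, Matrix.smul_mul, Matrix.mul_smul, Matrix.one_mul, Matrix.mul_one, hW]
  module

theorem scl_one (W : Mat n) : scl 1 W = W := by
  have h : sclDen 1 W = (2 : ℝ) • (1 : Mat n) := by simp [sclDen]; norm_num
  have h2 : sclNum 1 W = (2 : ℝ) • W := by simp [sclNum]; norm_num
  have h3 : ((2 : ℝ) • (1 : Mat n))⁻¹ = (2⁻¹ : ℝ) • (1 : Mat n) := by
    refine inv_eq_right_inv ?_
    simp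
  rw [scl, h, h2, h3]
  simp

theorem scl_zero {W : Mat n} (hd : (sclDen 0 W).det ≠ 0) : scl 0 W = 1 := by
  have : sclNum 0 W = sclDen 0 W := by simp [sclNum, sclDen]
  rw [scl, this, mul_nonsing_inv _ hd.isUnit]

theorem scl_id (s : ℝ) : scl s (1 : Mat n) = 1 := by
  have h : sclDen s (1 : Mat n) = (2 : ℝ) • (1 : Mat n) := by
    rw [sclDen]; module
  have h2 : sclNum s (1 : Mat n) = (2 : ℝ) • (1 : Mat n) := by
    rw [sclNum]; module
  rw [scl, h, h2, mul_nonsing_inv]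
  simp

/-- The star-shaped domain of the symplectic matrices without eigenvalues in `(-∞, -1]`. -/
def SclDom (n : ℕ) : Set (Sp n) :=
  {W | ∀ s ∈ Icc (0 : ℝ) 1, (sclDen s (W : Mat n)).det ≠ 0}

open Classical in
/-- The Cayley scaling, as a symplectic matrix. -/
def sclSp (s : ℝ) (W : Sp n) : Sp n :=
  if h : scl s (W : Mat n) ∈ symplecticGroup (Fin n) ℝ then ⟨_, h⟩ else 1

theorem coe_sclSp {s : ℝ} {W : Sp n} (hd : (sclDen s (W : Mat n)).det ≠ 0) :
    (sclSp s W : Mat n) = scl s (W : Mat n) := by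
  simp [sclSp, scl_mem W.2 hd]

@[fun_prop]
theorem continuous_sclDen : Continuous fun p : ℝ × Mat n => sclDen p.1 p.2 := by
  unfold sclDen; fun_prop

@[fun_prop]
theorem continuous_sclNum : Continuous fun p : ℝ × Mat n => sclNum p.1 p.2 := by
  unfold sclNum; fun_prop

theorem continuousAt_inv_mat {m R : Type*} [Fintype m] [DecidableEq m] [Field R] [TopologicalSpace R]
    [IsTopologicalRing R] [ContinuousInv₀ R] {A : Matrix m m R} (h : A.det ≠ 0) :
    ContinuousAt (fun M : Matrix m m R => M⁻¹) A := by
  simp only [Matrix.inv_def, Ring.inverse_eq_inv']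
  have h1 : Continuous fun M : Matrix m m R => M.det := continuous_id.matrix_det
  have h2 : Continuous fun M : Matrix m m R => M.adjugate := continuous_id.matrix_adjugate
  exact (h1.continuousAt.inv₀ h).smul h2.continuousAt

theorem continuous_sclSp {X : Type*} [TopologicalSpace X] {s : X → ℝ} {W : X → Sp n}
    (hs : Continuous s) (hW : Continuous W) (hd : ∀ x, (sclDen (s x) (W x : Mat n)).det ≠ 0) :
    Continuous fun x => sclSp (s x) (W x) := by
  refine Topology.IsInducing.subtypeVal.continuous_iff.2 ?_
  have : (Subtype.val ∘ fun x => sclSp (s x) (W x)) = fun x => scl (s x) (W x : Mat n) := by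
    ext1 x
    exact coe_sclSp (hd x)
  refine this ▸ ?_
  unfold scl
  have h1 : Continuous fun x => (s x, (W x : Mat n)) := by fun_prop
  refine (continuous_sclNum.comp h1).mul ?_
  rw [continuous_iff_continuousAt]
  intro x
  exact (continuousAt_inv_mat (hd x)).comp (f := fun x => sclDen (s x) (W x : Mat n))
    (continuous_sclDen.comp h1).continuousAt

theorem sclSp_one (W : Sp n) : sclSp 1 W = W := by
  apply Subtype.ext
  have h : sclDen 1 (W : Mat n) = (2 : ℝ) • (1 : Mat n) := by simp [sclDen]; norm_num
  rw [coe_sclSp (by rw [h]; simp), scl_one]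

theorem sclSp_zero {W : Sp n} (hW : W ∈ SclDom n) : sclSp 0 W = 1 := by
  apply Subtype.ext
  have := hW 0 (by simp)
  rw [coe_sclSp this, scl_zero this]
  rfl

theorem sclDen_id (s : ℝ) : sclDen s (1 : Mat n) = (2 : ℝ) • (1 : Mat n) := by
  rw [sclDen]; module

theorem sclSp_id (s : ℝ) : sclSp s (1 : Sp n) = 1 := by
  apply Subtype.ext
  rw [coe_sclSp]
  · exact scl_id s
  · change (sclDen s (1 : Mat n)).det ≠ 0
    rw [sclDen_id]; simp

theorem one_mem_sclDom : (1 : Sp n) ∈ SclDom n := by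
  intro s _
  change (sclDen s (1 : Mat n)).det ≠ 0
  rw [sclDen_id]; simp

/-- `sclDen` of a scaled matrix. -/
theorem sclDen_scl {s t : ℝ} {W : Mat n} (hd : (sclDen s W).det ≠ 0) :
    sclDen t (scl s W) * sclDen s W = (2 : ℝ) • sclDen (t * s) W := by
  have : scl s W * sclDen s W = sclNum s W := by
    rw [scl, Matrix.mul_assoc, nonsing_inv_mul _ hd.isUnit, Matrix.mul_one]
  rw [sclDen, Matrix.add_mul, Matrix.smul_mul, this]
  simp only [sclNum, sclDen, Matrix.smul_mul, Matrix.one_mul]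
  module

theorem sclSp_mem_sclDom {s : ℝ} (hs : s ∈ Icc (0 : ℝ) 1) {W : Sp n} (hW : W ∈ SclDom n) :
    sclSp s W ∈ SclDom n := by
  intro t ht h
  have hd := hW s hs
  rw [coe_sclSp hd] at h
  have h2 := congrArg Matrix.det (sclDen_scl (t := t) hd)
  rw [det_mul, h, zero_mul, det_smul] at h2
  have h3 := hW (t * s) ⟨by nlinarith [ht.1, hs.1], by nlinarith [ht.1, hs.1, ht.2, hs.2]⟩
  simp [h3] at h2

open Classical in
/-- The principal lift to the universal cover of a matrix in `SclDom`. -/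
def princ (W : Sp n) : SpTilde n :=
  if h : W ∈ SclDom n then
    pathClass (fun t => sclSp t W)
      (continuous_sclSp continuous_subtype_val continuous_const fun t => h t t.2)
      (by simpa using sclSp_zero h)
  else 1

theorem princ_eq {W : Sp n} (h : W ∈ SclDom n) : princ W =
    pathClass (fun t => sclSp t W)
      (continuous_sclSp continuous_subtype_val continuous_const fun t => h t t.2)
      (by simpa using sclSp_zero h) := by
  rw [princ, dif_pos h]

theorem proj_princ {W : Sp n} (h : W ∈ SclDom n) : (princ W).proj = W := by
  rw [princ_eq h]
  simpa using sclSp_one W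

theorem continuous_princ {X : Type*} [TopologicalSpace X] {W : X → Sp n} (hW : Continuous W)
    (h : ∀ x, W x ∈ SclDom n) : Continuous fun x => princ (W x) := by
  have : (fun x => princ (W x)) = _ := funext fun x => princ_eq (h x)
  rw [this]
  refine continuous_pathClass (fun x t => sclSp t (W x)) ?_ _
  exact continuous_sclSp (by fun_prop) (by fun_prop) fun p => h p.1 p.2 p.2.2

theorem continuousOn_princ : ContinuousOn (princ (n := n)) (SclDom n) := by
  rw [continuousOn_iff_continuous_domRestrict]
  exact continuous_princ continuous_subtype_val fun x => x.2

theorem princ_one : princ (1 : Sp n) = 1 := by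
  rw [princ_eq one_mem_sclDom, ← pathClass_one]
  exact pathClass_congr _ _ _ _ fun t => sclSp_id _

/-- A path inside `SclDom` represents the principal lift of its end-point. -/
theorem pathClass_eq_princ (f : I → Sp n) (hf : Continuous f) (h0 : f 0 = 1)
    (hd : ∀ t, f t ∈ SclDom n) : pathClass f hf h0 = princ (f 1) := by
  rw [princ_eq (hd 1)]
  -- Two successive homotopies: `a` slides the scaling parameter from 1 to t, turning f t into its
  -- scaling by t; then `b` slides the scaled point from f t to f 1. Both fix the end-points.
  let a : I → I → I := fun u t => ⟨(1 - u) + u * t, by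
    constructor
    · nlinarith [u.2.1, u.2.2, t.2.1, t.2.2]
    · nlinarith [u.2.1, u.2.2, t.2.1, t.2.2]⟩
  have ha : Continuous (Function.uncurry a) := by
    refine Continuous.subtype_mk ?_ _
    fun_prop
  let b : I → I → I := fun u t => ⟨(1 - u) * t + u, by
    constructor
    · nlinarith [u.2.1, u.2.2, t.2.1, t.2.2]
    · nlinarith [u.2.1, u.2.2, t.2.1, t.2.2]⟩
  have hb : Continuous (Function.uncurry b) := by
    refine Continuous.subtype_mk ?_ _
    fun_prop
  have e1 := pathClass_eq_of_homotopy (fun u t => sclSp (a u t) (f t))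
    (continuous_sclSp (by exact continuous_subtype_val.comp ha) (by fun_prop)
      fun p => hd _ _ (a p.1 p.2).2)
    (fun u => by simp only [h0]; exact sclSp_id _)
    (fun u => by simp [a])
  have e2 := pathClass_eq_of_homotopy (fun u t => sclSp t (f (b u t)))
    (continuous_sclSp (by fun_prop) (by exact hf.comp hb)
      fun p => hd _ _ p.2.2)
    (fun u => by simpa using sclSp_zero (hd _))
    (fun u => by simp [b])
  refine Eq.trans ?_ (e1.trans (Eq.trans ?_ (e2.trans ?_)))
  · refine pathClass_congr _ _ _ _ fun t => ?_
    simp [a, sclSp_one]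
  · refine pathClass_congr _ _ _ _ fun t => ?_
    simp [a, b]
  · refine pathClass_congr _ _ _ _ fun t => ?_
    simp [b]

/-! ### Unique lifting -/

theorem sclDom_mem_nhds : SclDom n ∈ 𝓝 (1 : Sp n) := by
  have h : ∀ᶠ (W : Sp n) in 𝓝 (1 : Sp n), ∀ s ∈ Icc (0 : ℝ) 1, (sclDen s (W : Mat n)).det ≠ 0 := by
    refine isCompact_Icc.eventually_forall_of_forall_eventually fun s _ => ?_
    have hc : Continuous fun p : Sp n × ℝ => (sclDen p.2 (p.1 : Mat n)).det := by
      have h1 : Continuous fun p : Sp n × ℝ => (p.2, (p.1 : Mat n)) := by fun_prop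
      exact (continuous_sclDen.comp h1).matrix_det
    refine hc.continuousAt.eventually_ne ?_
    change (sclDen s (1 : Mat n)).det ≠ 0
    rw [sclDen_id]; simp
  exact h

/-- The kernel of the projection is discrete: a path close to the constant one stays in `SclDom`, so
its class is the principal lift of its end-point, and openness of `SpTilde.mk` makes these classes a
neighbourhood of 1. -/
theorem eventually_eq_one_of_proj : ∀ᶠ w in 𝓝 (1 : SpTilde n), w.proj = 1 → w = 1 := by
  have h1 : ∀ᶠ (γ : PathGroup n) in 𝓝 (1 : PathGroup n), ∀ t : I, (γ : C(I, Sp n)) t ∈ interior (SclDom n) := by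
    have h2 : ∀ᶠ (γ : PathGroup n) in 𝓝 (1 : PathGroup n), ∀ t ∈ (univ : Set I),
        (γ : C(I, Sp n)) t ∈ interior (SclDom n) := by
      refine isCompact_univ.eventually_forall_of_forall_eventually fun t _ => ?_
      have hc : Continuous fun p : PathGroup n × I => (p.1 : C(I, Sp n)) p.2 := by fun_prop
      refine hc.continuousAt.eventually_mem (isOpen_interior.mem_nhds ?_)
      exact mem_interior_iff_mem_nhds.2 sclDom_mem_nhds
    filter_upwards [h2] with γ h t using h t trivial
  rw [← SpTilde.mk_one]
  refine Filter.mem_of_superset (SpTilde.isOpenMap_mk.image_mem_nhds h1) ?_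
  rintro _ ⟨γ, hγ, rfl⟩ hp
  have := pathClass_eq_princ (γ : C(I, Sp n)) (γ : C(I, Sp n)).continuous γ.2
    fun t => interior_subset (hγ t)
  change pathClass _ _ γ.2 = 1
  rw [this]
  rw [SpTilde.proj_mk] at hp
  rw [hp, princ_one]

/-- The quotient c d⁻¹ takes values in a discrete kernel, so it is locally constant. Identities in
the universal cover are proved below through this lemma: deform to a trivial case and compare
projections along the way. -/
theorem eqOn_of_proj_eq {X : Type*} [TopologicalSpace X] {s : Set X} (hs : IsPreconnected s)
    {c d : X → SpTilde n} (hc : ContinuousOn c s) (hd : ContinuousOn d s)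
    (h : ∀ x ∈ s, (c x).proj = (d x).proj) {x₀ : X} (hx₀ : x₀ ∈ s) (h0 : c x₀ = d x₀) :
    ∀ x ∈ s, c x = d x := by
  have hS := isPreconnected_iff_preconnectedSpace.1 hs
  let e : s → SpTilde n := fun x => c x * (d x)⁻¹
  have he : Continuous e := by
    have h1 := continuousOn_iff_continuous_domRestrict.1 hc
    have h2 := continuousOn_iff_continuous_domRestrict.1 hd
    exact h1.mul h2.inv
  have hp : ∀ x, (e x).proj = 1 := fun x => by
    simp [e, SpTilde.proj_mul, SpTilde.proj_inv, h x x.2]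
  have hl : IsLocallyConstant e := by
    refine (IsLocallyConstant.iff_eventually_eq e).2 fun x => ?_
    have h3 : Tendsto (fun y => e y * (e x)⁻¹) (𝓝 x) (𝓝 1) := by
      have : Continuous fun y => e y * (e x)⁻¹ := by fun_prop
      simpa using this.tendsto x
    filter_upwards [h3.eventually eventually_eq_one_of_proj] with y hy
    exact mul_inv_eq_one.1 (hy (by simp [SpTilde.proj_mul, SpTilde.proj_inv, hp]))
  intro x hx
  have h4 : e ⟨x, hx⟩ = e ⟨x₀, hx₀⟩ := hl.apply_eq_of_preconnectedSpace _ _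
  have h5 : e ⟨x₀, hx₀⟩ = 1 := by simp [e, h0]
  exact mul_inv_eq_one.1 (h4.trans h5)

/-- A curve in the universal cover whose projection stays in `SclDom` is the principal lift of its
projection, if it is so at one point. -/
theorem eq_princ_of_continuousOn {X : Type*} [TopologicalSpace X] {s : Set X}
    (hs : IsPreconnected s) {c : X → SpTilde n} (hc : ContinuousOn c s)
    (h : ∀ x ∈ s, (c x).proj ∈ SclDom n) {x₀ : X} (hx₀ : x₀ ∈ s)
    (h0 : c x₀ = princ (c x₀).proj) : ∀ x ∈ s, c x = princ (c x).proj := by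
  refine eqOn_of_proj_eq hs hc ?_ (fun x hx => (proj_princ (h x hx)).symm) hx₀ h0
  exact continuousOn_princ.comp (SpTilde.continuous_proj.comp_continuousOn hc) h

/-- The lift to the universal cover of a curve in the symplectic group. -/
def liftCurve (g : ℝ → Sp n) (hg : Continuous g) (h0 : g 0 = 1) (t : ℝ) : SpTilde n :=
  pathClass (fun s => g (t * s)) (by fun_prop) (by simp [h0])

theorem continuous_liftCurve (g : ℝ → Sp n) (hg : Continuous g) (h0 : g 0 = 1) :
    Continuous (liftCurve g hg h0) :=
  continuous_pathClass (fun (t : ℝ) (s : I) => g (t * s)) (by fun_prop) _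

@[simp] theorem proj_liftCurve (g : ℝ → Sp n) (hg : Continuous g) (h0 : g 0 = 1) (t : ℝ) :
    (liftCurve g hg h0 t).proj = g t := by
  simp [liftCurve]

@[simp] theorem liftCurve_zero (g : ℝ → Sp n) (hg : Continuous g) (h0 : g 0 = 1) :
    liftCurve g hg h0 0 = 1 := by
  rw [liftCurve, ← pathClass_one]
  exact pathClass_congr _ _ _ _ fun t => by simp [h0]

/-- Every element is joined to the identity by a curve. -/
theorem exists_curve (w : SpTilde n) : ∃ c : ℝ → SpTilde n, Continuous c ∧ c 0 = 1 ∧ c 1 = w := by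
  obtain ⟨f, hf, h0, rfl⟩ := exists_pathClass w
  refine ⟨liftCurve (fun t => f (projIcc 0 1 zero_le_one t)) (by fun_prop) ?_,
    continuous_liftCurve _ _ _, liftCurve_zero _ _ _, ?_⟩
  · simpa using h0
  · refine pathClass_congr _ _ _ _ fun t => ?_
    simp

instance : PreconnectedSpace (SpTilde n) := by
  refine ⟨isPreconnected_of_forall 1 fun w _ => ?_⟩
  obtain ⟨c, hc, h0, h1⟩ := exists_curve w
  exact ⟨range c, subset_univ _, ⟨0, h0⟩, ⟨1, h1⟩, isPreconnected_range hc⟩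

theorem commute_of_proj_commute {z : SpTilde n} (hz : ∀ g : Sp n, z.proj * g = g * z.proj)
    (w : SpTilde n) : z * w = w * z := by
  have := eqOn_of_proj_eq (c := fun w => z * w) (d := fun w => w * z) isPreconnected_univ
    (by fun_prop) (by fun_prop) (fun x _ => by simp [SpTilde.proj_mul, hz]) (mem_univ 1) (by simp)
  exact this w trivial

/-! ### The complex matrix of a real matrix -/

/-- The complex matrix whose columns are the images of the first `n` basis vectors. -/
def toC (M : Mat n) : Matrix (Fin n) (Fin n) ℂ :=
  M.toBlocks₁₁.map (fun x : ℝ => (x : ℂ)) + Complex.I • M.toBlocks₂₁.map (fun x : ℝ => (x : ℂ))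

theorem complexDet_eq (M : Mat n) : complexDet M = (toC M).det := rfl

theorem toC_apply (M : Mat n) (i j : Fin n) :
    toC M i j = (M (Sum.inl i) (Sum.inl j) : ℂ) + Complex.I * (M (Sum.inr i) (Sum.inl j) : ℂ) := rfl

theorem toC_add (M N : Mat n) : toC (M + N) = toC M + toC N := by
  ext i j; simp [toC_apply]; ring

theorem toC_smul (r : ℝ) (M : Mat n) : toC (r • M) = (r : ℂ) • toC M := by
  ext i j; simp [toC_apply]; ring

theorem toC_one : toC (1 : Mat n) = 1 := by
  ext i j
  by_cases h : i = j <;> simp [toC_apply, Matrix.one_apply, h]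

/-- The blocks of a matrix commuting with `J₀`. -/
theorem commute_J_apply {M : Mat n} (h : M * J₀ n = J₀ n * M) (i j : Fin n) :
    M (Sum.inl i) (Sum.inr j) = -M (Sum.inr i) (Sum.inl j) ∧
      M (Sum.inr i) (Sum.inr j) = M (Sum.inl i) (Sum.inl j) := by
  have h1 := congrFun (congrFun h (Sum.inl i)) (Sum.inl j)
  have h2 := congrFun (congrFun h (Sum.inr i)) (Sum.inl j)
  simp [Matrix.mul_apply, Matrix.J, Matrix.one_apply, Fintype.sum_sum_type, Matrix.neg_apply]
    at h1 h2
  exact ⟨h1, h2⟩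

/-- `toC` only sees the first n columns, so multiplicativity needs the left factor to be complex
linear; the right factor is arbitrary. -/
theorem toC_mul {M : Mat n} (h : M * J₀ n = J₀ n * M) (N : Mat n) : toC (M * N) = toC M * toC N := by
  ext i j
  simp only [toC_apply, Matrix.mul_apply, Fintype.sum_sum_type, (commute_J_apply h _ _).1,
    (commute_J_apply h _ _).2]
  push_cast
  rw [← Finset.sum_add_distrib, ← Finset.sum_add_distrib,
    Finset.mul_sum, ← Finset.sum_add_distrib]
  refine Finset.sum_congr rfl fun k _ => ?_
  have := Complex.I_mul_I
  linear_combination (-(M (Sum.inr i) (Sum.inl k) : ℂ) * (N (Sum.inr k) (Sum.inl j) : ℂ)) * this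

/-- The real part of the Hermitian product is the Euclidean product and its imaginary part is, up to
sign, the symplectic form. For `Y = W` symplectic the latter vanishes on the first n columns, which
span a Lagrangian plane; with `Y = X W` it is the source of `phaseDeriv`. -/
theorem toC_conjTranspose_mul (W Y : Mat n) : (toC W)ᴴ * toC Y =
    (Wᵀ * Y).toBlocks₁₁.map (fun x : ℝ => (x : ℂ)) +
      Complex.I • (Wᵀ * (J₀ n)ᵀ * Y).toBlocks₁₁.map (fun x : ℝ => (x : ℂ)) := by
  ext i j
  rw [Matrix.mul_assoc]
  have hJ : ∀ k : Fin n, ((J₀ n)ᵀ * Y) (Sum.inl k) (Sum.inl j) = Y (Sum.inr k) (Sum.inl j) ∧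
      ((J₀ n)ᵀ * Y) (Sum.inr k) (Sum.inl j) = -Y (Sum.inl k) (Sum.inl j) := by
    intro k
    constructor <;>
    simp [Matrix.mul_apply, Matrix.J, Fintype.sum_sum_type, Matrix.one_apply, Matrix.neg_apply]
  simp only [Matrix.add_apply, Matrix.smul_apply, Matrix.map_apply, toBlocks₁₁, of_apply,
    Matrix.mul_apply (M := Wᵀ), Fintype.sum_sum_type, hJ, Matrix.transpose_apply]
  simp only [Matrix.mul_apply, Matrix.conjTranspose_apply, toC_apply]
  push_cast
  rw [smul_eq_mul, mul_add, Finset.mul_sum, Finset.mul_sum, ← Finset.sum_add_distrib,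
    ← Finset.sum_add_distrib, ← Finset.sum_add_distrib]
  refine Finset.sum_congr rfl fun k _ => ?_
  have := Complex.I_mul_I
  simp only [RCLike.star_def, map_add, map_mul, Complex.conj_I, Complex.conj_ofReal]
  linear_combination (-(W (Sum.inr k) (Sum.inl i) : ℂ) * (Y (Sum.inr k) (Sum.inl j) : ℂ)) * this

/-- The Gram matrix of the image of the standard Lagrangian subspace. -/
def gram (W : Mat n) : Matrix (Fin n) (Fin n) ℝ := (Wᵀ * W).toBlocks₁₁

theorem posDef_transpose_mul_self {m : Type*} [Fintype m] [DecidableEq m] {W : Matrix m m ℝ}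
    (h : W.det ≠ 0) : (Wᵀ * W).PosDef := by
  have := Matrix.PosDef.conjTranspose_mul_self W
    (Matrix.mulVec_injective_iff_isUnit.2 ((Matrix.isUnit_iff_isUnit_det _).2 h.isUnit))
  simpa using this

theorem gram_posDef (W : Sp n) : (gram (W : Mat n)).PosDef := by
  have : ((W : Mat n)ᵀ * (W : Mat n)).PosDef :=
    posDef_transpose_mul_self (by rw [W.det_eq_one]; exact one_ne_zero)
  exact this.submatrix Sum.inl_injective

theorem toC_gram (W : Sp n) : (toC (W : Mat n))ᴴ * toC (W : Mat n) =
    (gram (W : Mat n)).map (fun x : ℝ => (x : ℂ)) := by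
  have h : (W : Mat n)ᵀ * (J₀ n)ᵀ * (W : Mat n) = (J₀ n)ᵀ := by
    rw [J_transpose', Matrix.mul_neg, Matrix.neg_mul, W.transpose_mul]
  rw [toC_conjTranspose_mul, h]
  have : (J₀ n)ᵀ.toBlocks₁₁ = 0 := by
    ext i j; simp [toBlocks₁₁, Matrix.J]
  rw [this]
  simp [gram]

/-- The squared modulus of the complex determinant is the determinant of the Gram matrix, which is
positive definite. -/
theorem complexDet_ne_zero (W : Sp n) : complexDet (W : Mat n) ≠ 0 := by
  intro h
  have h1 := congrArg Matrix.det (toC_gram W)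
  rw [det_mul, ← complexDet_eq, h, mul_zero] at h1
  have h2 : ((gram (W : Mat n)).map (fun x : ℝ => (x : ℂ))).det = ((gram (W : Mat n)).det : ℂ) :=
    (RingHom.map_det Complex.ofRealHom _).symm
  rw [h2] at h1
  exact (gram_posDef W).det_pos.ne' (by exact_mod_cast h1.symm)

theorem continuous_toC : Continuous (toC (n := n)) := by
  refine continuous_matrix fun i j => ?_
  simp only [toC_apply]
  fun_prop

theorem continuous_complexDet : Continuous (complexDet (n := n)) :=
  (continuous_toC).matrix_det

/-! ### The phase -/

/-- The phase of the complex determinant. -/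
def cdCircle : C(Sp n, Circle) where
  toFun W := ⟨complexDet (W : Mat n) / (‖complexDet (W : Mat n)‖ : ℂ), by
    rw [Submonoid.unitSphere, ← SetLike.mem_coe]
    simp [complexDet_ne_zero W]⟩
  continuous_toFun := by
    refine Continuous.subtype_mk ?_ _
    have h : Continuous fun W : Sp n => complexDet (W : Mat n) :=
      continuous_complexDet.comp continuous_subtype_val
    exact h.div (by fun_prop) fun W => by simpa using complexDet_ne_zero W

theorem cdCircle_one : cdCircle (1 : Sp n) = 1 := by
  apply Subtype.ext
  change complexDet (1 : Mat n) / (‖complexDet (1 : Mat n)‖ : ℂ) = 1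
  rw [complexDet_eq, toC_one]
  simp

theorem cdCircle_eq_iff {W : Sp n} {θ : ℝ} : Circle.exp θ = cdCircle W ↔
    complexDet (W : Mat n) = ‖complexDet (W : Mat n)‖ * Complex.exp (θ * Complex.I) := by
  have h : (‖complexDet (W : Mat n)‖ : ℂ) ≠ 0 := by simpa using complexDet_ne_zero W
  rw [Circle.ext_iff, Circle.coe_exp]
  change _ = complexDet (W : Mat n) / (‖complexDet (W : Mat n)‖ : ℂ) ↔ _
  rw [eq_div_iff h, mul_comm, eq_comm]

/-- The change of argument of the complex determinant along a path. -/
def pathPhase (γ : PathGroup n) : ℝ :=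
  Circle.isCoveringMap_exp.liftPath (cdCircle.comp (γ : C(I, Sp n))) 0
    (by simp [show (γ : C(I, Sp n)) 0 = 1 from γ.2, cdCircle_one]) 1

theorem pathPhase_eq (γ : PathGroup n) (θ : I → ℝ) (hθ : Continuous θ) (h0 : θ 0 = 0)
    (h : ∀ t, Circle.exp (θ t) = cdCircle ((γ : C(I, Sp n)) t)) : pathPhase γ = θ 1 := by
  have := (Circle.isCoveringMap_exp.eq_liftPath_iff (γ := cdCircle.comp (γ : C(I, Sp n))) (e := 0)
    (by simp [show (γ : C(I, Sp n)) 0 = 1 from γ.2, cdCircle_one]) (Γ := θ)).2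
    ⟨hθ, funext h, h0⟩
  rw [pathPhase, ← this]

theorem exists_lift_pathPhase (γ : PathGroup n) : ∃ θ : I → ℝ, Continuous θ ∧ θ 0 = 0 ∧
    (∀ t, Circle.exp (θ t) = cdCircle ((γ : C(I, Sp n)) t)) ∧ pathPhase γ = θ 1 := by
  have h0 : cdCircle.comp (γ : C(I, Sp n)) 0 = Circle.exp 0 := by
    simp [show (γ : C(I, Sp n)) 0 = 1 from γ.2, cdCircle_one]
  refine ⟨_, (Circle.isCoveringMap_exp.liftPath (cdCircle.comp (γ : C(I, Sp n))) 0 h0).continuous,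
    Circle.isCoveringMap_exp.liftPath_zero _ _ _, fun t => ?_, rfl⟩
  exact congrFun (Circle.isCoveringMap_exp.liftPath_lifts _ _ h0) t

/-- The phase of the complex determinant on the universal cover. -/
def phase (w : SpTilde n) : ℝ :=
  Quotient.lift (s := (pathCon n).toSetoid) pathPhase (fun _ _ h =>
    Circle.isCoveringMap_exp.liftPath_apply_one_eq_of_homotopicRel
      (ContinuousMap.HomotopicRel.comp_continuousMap h cdCircle) 0 _ _) w

theorem phase_mk (γ : PathGroup n) : phase (SpTilde.mk γ) = pathPhase γ := rfl

theorem phase_one : phase (1 : SpTilde n) = 0 := by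
  rw [← SpTilde.mk_one, phase_mk]
  refine pathPhase_eq _ (fun _ => 0) continuous_const rfl fun t => ?_
  simpa using cdCircle_one.symm

theorem exp_phase (w : SpTilde n) : Circle.exp (phase w) = cdCircle w.proj := by
  obtain ⟨γ, rfl⟩ := SpTilde.mk_surjective w
  obtain ⟨θ, -, -, h, h1⟩ := exists_lift_pathPhase γ
  rw [phase_mk, h1, h 1]
  rfl

theorem complexDet_proj (w : SpTilde n) : complexDet (w.proj : Mat n) =
    ‖complexDet (w.proj : Mat n)‖ * Complex.exp (phase w * Complex.I) :=
  cdCircle_eq_iff.1 (exp_phase w)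

/-- For paths uniformly close to γ₀ the ratio of the complex determinants stays in the slit plane,
so adding its principal argument to a lift along γ₀ gives a lift along the nearby path. -/
theorem continuous_phase : Continuous (phase (n := n)) := by
  rw [← SpTilde.isOpenQuotientMap_mk.continuous_comp_iff]
  change Continuous (pathPhase (n := n))
  rw [continuous_iff_continuousAt]
  intro γ₀
  obtain ⟨θ, hθ, h0, hθe, h1⟩ := exists_lift_pathPhase γ₀
  let q : PathGroup n → I → ℂ := fun γ t =>
    complexDet ((γ : C(I, Sp n)) t : Mat n) / complexDet ((γ₀ : C(I, Sp n)) t : Mat n)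
  have hq : Continuous (Function.uncurry q) := by
    refine Continuous.div ?_ ?_ fun p => complexDet_ne_zero _
    · exact continuous_complexDet.comp (by fun_prop)
    · exact continuous_complexDet.comp (by fun_prop)
  have hq0 : ∀ t, q γ₀ t = 1 := fun t => div_self (complexDet_ne_zero _)
  have hev : ∀ᶠ (γ : PathGroup n) in 𝓝 γ₀, ∀ t ∈ (univ : Set I), q γ t ∈ Complex.slitPlane := by
    refine isCompact_univ.eventually_forall_of_forall_eventually fun t _ => ?_
    refine hq.continuousAt.eventually_mem (Complex.isOpen_slitPlane.mem_nhds ?_)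
    simp [Function.uncurry, hq0]
  have heq : pathPhase =ᶠ[𝓝 γ₀] fun γ => θ 1 + (q γ 1).arg := by
    filter_upwards [hev] with γ hγ
    have hc : Continuous fun t => θ t + (q γ t).arg := by
      refine hθ.add ?_
      rw [continuous_iff_continuousAt]
      intro t
      exact (Complex.continuousAt_arg (hγ t trivial)).comp
        (hq.comp (by fun_prop : Continuous fun t => (γ, t))).continuousAt
    refine pathPhase_eq γ _ hc ?_ fun t => ?_
    · have e1 : (γ : C(I, Sp n)) 0 = 1 := γ.2
      have e2 : (γ₀ : C(I, Sp n)) 0 = 1 := γ₀.2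
      have : q γ 0 = 1 := by
        simp only [q, e1, e2]
        exact div_self (complexDet_ne_zero 1)
      simp [h0, this]
    · rw [cdCircle_eq_iff]
      have h2 := cdCircle_eq_iff.1 (hθe t)
      have h3 : complexDet ((γ : C(I, Sp n)) t : Mat n) =
          q γ t * complexDet ((γ₀ : C(I, Sp n)) t : Mat n) :=
        (div_mul_cancel₀ _ (complexDet_ne_zero _)).symm
      have h4 := Complex.norm_mul_exp_arg_mul_I (q γ t)
      rw [h3, norm_mul]
      nth_rewrite 1 [h2]
      nth_rewrite 1 [← h4]
      push_cast
      rw [add_mul, Complex.exp_add]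
      ring
  refine ContinuousAt.congr ?_ heq.symm
  refine continuousAt_const.add ?_
  refine ContinuousAt.comp (g := Complex.arg) (f := fun γ => q γ 1) ?_ ?_
  · rw [hq0]; exact Complex.continuousAt_arg (by simp)
  · exact (hq.comp (by fun_prop : Continuous fun γ => (γ, (1 : I)))).continuousAt

/-- Functions that agree up to the kernel of `Circle.exp`. -/
theorem sub_eq_of_exp_eq {X : Type*} [TopologicalSpace X] {s : Set X} (hs : IsPreconnected s)
    {f g : X → ℝ} (hf : ContinuousOn f s) (hg : ContinuousOn g s)
    (h : ∀ x ∈ s, Circle.exp (f x) = Circle.exp (g x)) {x y : X} (hx : x ∈ s) (hy : y ∈ s) :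
    f x - g x = f y - g y := by
  have hS := isPreconnected_iff_preconnectedSpace.1 hs
  have hc : ContinuousOn (fun x => (f x - g x) / (2 * Real.pi)) s :=
    (hf.sub hg).div_const _
  have hz : ∀ x ∈ s, ∃ k : ℤ, (f x - g x) / (2 * Real.pi) = k := by
    intro x hx
    obtain ⟨m, hm⟩ := Circle.exp_eq_exp.1 (h x hx)
    refine ⟨m, ?_⟩
    rw [hm]
    field_simp
    ring
  -- The difference divided by 2π is continuous and integer valued, and two integers at distance
  -- less than 1 are equal.
  have hl : IsLocallyConstant fun x : s => (f x - g x) / (2 * Real.pi) := by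
    refine (IsLocallyConstant.iff_eventually_eq _).2 fun x => ?_
    have hcx := (continuousOn_iff_continuous_domRestrict.1 hc).tendsto x
    filter_upwards [hcx.eventually (Metric.ball_mem_nhds _ one_pos)] with y hy
    obtain ⟨k, hk⟩ := hz x x.2
    obtain ⟨m, hm⟩ := hz y y.2
    rw [hk, hm]
    have hy' : dist ((f y - g y) / (2 * Real.pi)) ((f x - g x) / (2 * Real.pi)) < 1 := hy
    rw [hk, hm, Real.dist_eq] at hy'
    have h3 : |m - k| < 1 := by exact_mod_cast hy'
    rw [Int.abs_lt_one_iff, sub_eq_zero] at h3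
    rw [h3]
  have h4 : (f x - g x) / (2 * Real.pi) = (f y - g y) / (2 * Real.pi) :=
    hl.apply_eq_of_preconnectedSpace ⟨x, hx⟩ ⟨y, hy⟩
  have h5 : (2 * Real.pi) ≠ 0 := by positivity
  field_simp at h4
  exact h4

/-- Computation of the phase along a curve from an explicit argument. -/
theorem phase_sub_phase {X : Type*} [TopologicalSpace X] {s : Set X} (hs : IsPreconnected s)
    {c : X → SpTilde n} (hc : ContinuousOn c s) {θ r : X → ℝ} (hθ : ContinuousOn θ s)
    (hr : ∀ x ∈ s, 0 < r x)
    (h : ∀ x ∈ s, complexDet ((c x).proj : Mat n) = r x * Complex.exp (θ x * Complex.I))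
    {x y : X} (hx : x ∈ s) (hy : y ∈ s) : phase (c y) - phase (c x) = θ y - θ x := by
  have := sub_eq_of_exp_eq hs (continuous_phase.comp_continuousOn hc) hθ (fun x hx => ?_) hx hy
  · simp only [Function.comp] at this
    linarith
  · simp only [Function.comp]
    rw [exp_phase, eq_comm, cdCircle_eq_iff]
    have h1 : ‖complexDet ((c x).proj : Mat n)‖ = r x := by
      rw [h x hx, norm_mul, Complex.norm_exp_ofReal_mul_I, mul_one, Complex.norm_real,
        Real.norm_eq_abs, abs_of_pos (hr x hx)]
    rw [h1, h x hx]

/-! ### Velocities -/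

/-- Jacobi's formula, obtained from the multilinearity of the determinant in the rows. -/
theorem hasDerivWithinAt_det {m : Type*} [Fintype m] [DecidableEq m] {Z : ℝ → Matrix m m ℂ}
    {Z' : Matrix m m ℂ} {s : Set ℝ} {t : ℝ}
    (h : ∀ i j, HasDerivWithinAt (fun x => Z x i j) (Z' i j) s t) :
    HasDerivWithinAt (fun x => (Z x).det) (trace ((Z t).adjugate * Z')) s t := by
  let D : ContinuousMultilinearMap ℝ (fun _ : m => m → ℂ) ℂ :=
    { toMultilinearMap :=
        (Matrix.detRowAlternating (n := m) (R := ℂ)).toMultilinearMap.restrictScalars ℝ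
      cont := by
        change Continuous fun M : Matrix m m ℂ => M.det
        exact continuous_id.matrix_det }
  have hZ : HasDerivWithinAt (fun x => (fun i => Z x i : m → m → ℂ)) (fun i => Z' i) s t :=
    hasDerivWithinAt_pi.2 fun i => hasDerivWithinAt_pi.2 fun j => h i j
  have h1 := (D.hasFDerivAt (fun i => Z t i)).comp_hasDerivWithinAt t hZ
  have h2 : D.linearDeriv (fun i => Z t i) (fun i => Z' i) = trace ((Z t).adjugate * Z') := by
    rw [ContinuousMultilinearMap.linearDeriv_apply, trace_mul_comm, trace]
    refine Finset.sum_congr rfl fun i _ => ?_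
    have h3 : D (Function.update (fun i => Z t i) i (Z' i)) = ((Z t).updateRow i (Z' i)).det := rfl
    rw [h3, ← cramer_transpose_apply, cramer_eq_adjugate_mulVec, ← adjugate_transpose]
    simp [Matrix.mulVec, dotProduct, Matrix.diag, Matrix.mul_apply, mul_comm]
  rw [h2] at h1
  exact h1

theorem trace_mul_nonneg {m : Type*} [Fintype m] [DecidableEq m] {A B : Matrix m m ℝ}
    (hA : A.PosSemidef) (hB : B.PosSemidef) : 0 ≤ (A * B).trace := by
  obtain ⟨C, rfl⟩ : ∃ C : Matrix m m ℝ, A = star C * C :=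
    CStarAlgebra.nonneg_iff_eq_star_mul_self.1 hA.nonneg
  rw [Matrix.mul_assoc, trace_mul_comm]
  exact (hB.mul_mul_conjTranspose_same C).trace_nonneg

/-- The curve `c` is continuous and its projection has the right-translated velocity `X`. -/
def HasVel (c : ℝ → SpTilde n) (s : Set ℝ) (X : ℝ → Mat n) : Prop :=
  ContinuousOn c s ∧ ∀ t ∈ s, HasDerivWithinAt (projCurve c) (X t * projCurve c t) s t

/-- The symmetric form of an element of the Lie algebra. -/
def form (X : Mat n) : Mat n := (J₀ n)ᵀ * X

theorem form_add (X Y : Mat n) : form (X + Y) = form X + form Y := Matrix.mul_add _ _ _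
theorem form_neg (X : Mat n) : form (-X) = -form X := Matrix.mul_neg _ _
theorem form_smul (r : ℝ) (X : Mat n) : form (r • X) = r • form X := Matrix.mul_smul _ _ _
theorem form_zero : form (0 : Mat n) = 0 := Matrix.mul_zero _
theorem form_J : form (J₀ n) = 1 := by
  rw [form, J_transpose', Matrix.neg_mul, J_mul_J, neg_neg]

theorem continuous_form : Continuous (form (n := n)) := by
  unfold form; fun_prop

theorem Sp.mul_inv_coe (W : Sp n) : (W : Mat n) * ((W⁻¹ : Sp n) : Mat n) = 1 :=
  congrArg Subtype.val (mul_inv_cancel W)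

theorem Sp.inv_mul_coe (W : Sp n) : ((W⁻¹ : Sp n) : Mat n) * (W : Mat n) = 1 :=
  congrArg Subtype.val (inv_mul_cancel W)

theorem Sp.coe_mul (V W : Sp n) : ((V * W : Sp n) : Mat n) = (V : Mat n) * (W : Mat n) := rfl

theorem Sp.J_transpose_mul (W : Sp n) :
    (J₀ n)ᵀ * (W : Mat n) = ((W⁻¹ : Sp n) : Mat n)ᵀ * (J₀ n)ᵀ := by
  have h : (W : Mat n)ᵀ * (J₀ n)ᵀ * (W : Mat n) = (J₀ n)ᵀ := by
    rw [J_transpose', Matrix.mul_neg, Matrix.neg_mul, W.transpose_mul]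
  have h2 : ((W⁻¹ : Sp n) : Mat n)ᵀ * (W : Mat n)ᵀ = 1 := by
    rw [← Matrix.transpose_mul, W.mul_inv_coe, transpose_one]
  calc (J₀ n)ᵀ * (W : Mat n) = (((W⁻¹ : Sp n) : Mat n)ᵀ * (W : Mat n)ᵀ) * (J₀ n)ᵀ * (W : Mat n) := by
        rw [h2, Matrix.one_mul]
    _ = ((W⁻¹ : Sp n) : Mat n)ᵀ * ((W : Mat n)ᵀ * (J₀ n)ᵀ * (W : Mat n)) := by
        simp only [Matrix.mul_assoc]
    _ = _ := by rw [h]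

/-- The adjoint action. -/
def Ad (W : Sp n) (X : Mat n) : Mat n := (W : Mat n) * X * ((W⁻¹ : Sp n) : Mat n)

theorem form_Ad (W : Sp n) (X : Mat n) :
    form (Ad W X) = ((W⁻¹ : Sp n) : Mat n)ᵀ * form X * ((W⁻¹ : Sp n) : Mat n) := by
  rw [form, Ad, ← Matrix.mul_assoc, ← Matrix.mul_assoc, W.J_transpose_mul, form]
  simp only [Matrix.mul_assoc]

theorem posSemidef_form_Ad (W : Sp n) {X : Mat n} (h : (form X).PosSemidef) :
    (form (Ad W X)).PosSemidef := by
  rw [form_Ad]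
  simpa using h.conjTranspose_mul_mul_same ((W⁻¹ : Sp n) : Mat n)

theorem posDef_form_Ad (W : Sp n) {X : Mat n} (h : (form X).PosDef) : (form (Ad W X)).PosDef := by
  rw [form_Ad]
  have := h.conjTranspose_mul_mul_same (B := ((W⁻¹ : Sp n) : Mat n))
    (Matrix.mulVec_injective_iff_isUnit.2 ((Matrix.isUnit_iff_isUnit_det _).2
      (by rw [Sp.det_eq_one]; exact isUnit_one)))
  simpa using this

theorem det_Ad (W : Sp n) (X : Mat n) : (Ad W X).det = X.det := by
  simp [Ad, det_mul, Sp.det_eq_one]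

theorem Ad_one (X : Mat n) : Ad 1 X = X := by
  change (1 : Mat n) * X * ((1⁻¹ : Sp n) : Mat n) = X
  rw [inv_one]
  change (1 : Mat n) * X * (1 : Mat n) = X
  simp

theorem Ad_mul (V W : Sp n) (X : Mat n) : Ad (V * W) X = Ad V (Ad W X) := by
  simp only [Ad, _root_.mul_inv_rev, Sp.coe_mul, Matrix.mul_assoc]

theorem continuous_Ad : Continuous fun p : Sp n × Mat n => Ad p.1 p.2 := by
  unfold Ad; fun_prop

theorem projCurve_mul (c d : ℝ → SpTilde n) :
    projCurve (fun t => c t * d t) = fun t => projCurve c t * projCurve d t := by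
  funext t
  simp [projCurve, SpTilde.proj_mul]

theorem HasVel.mul {c d : ℝ → SpTilde n} {s : Set ℝ} {X Y : ℝ → Mat n} (hc : HasVel c s X)
    (hd : HasVel d s Y) :
    HasVel (fun t => c t * d t) s fun t => X t + Ad (c t).proj (Y t) := by
  refine ⟨hc.1.mul hd.1, fun t ht => ?_⟩
  have := (hc.2 t ht).mul (hd.2 t ht)
  rw [projCurve_mul]
  refine this.congr_deriv ?_
  have h := (c t).proj.inv_mul_coe
  change _ = (X t + (c t).proj * Y t * (((c t).proj⁻¹ : Sp n) : Mat n)) *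
    ((c t).proj * (d t).proj : Mat n)
  rw [Matrix.add_mul]
  congr 1
  · simp only [projCurve, Matrix.mul_assoc]
  · calc ((c t).proj : Mat n) * (Y t * (d t).proj) =
          (c t).proj * Y t * (1 : Mat n) * (d t).proj := by
          simp only [Matrix.mul_assoc, Matrix.mul_one]
      _ = _ := by rw [← h]; simp only [Matrix.mul_assoc]

theorem hasVel_const (w : SpTilde n) (s : Set ℝ) : HasVel (fun _ => w) s fun _ => 0 :=
  ⟨continuousOn_const, fun t _ => by
    rw [Matrix.zero_mul]; exact hasDerivWithinAt_const _ _ _⟩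

theorem HasVel.const_mul {c : ℝ → SpTilde n} {s : Set ℝ} {X : ℝ → Mat n} (hc : HasVel c s X)
    (w : SpTilde n) : HasVel (fun t => w * c t) s fun t => Ad w.proj (X t) := by
  have := (hasVel_const w s).mul hc
  simpa using this

theorem HasVel.mul_const {c : ℝ → SpTilde n} {s : Set ℝ} {X : ℝ → Mat n} (hc : HasVel c s X)
    (w : SpTilde n) : HasVel (fun t => c t * w) s X := by
  have := hc.mul (hasVel_const w s)
  simpa [Ad] using this

theorem HasVel.mono {c : ℝ → SpTilde n} {s s' : Set ℝ} {X : ℝ → Mat n} (hc : HasVel c s X)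
    (h : s' ⊆ s) : HasVel c s' X :=
  ⟨hc.1.mono h, fun t ht => (hc.2 t (h ht)).mono h⟩

theorem HasVel.congr {c : ℝ → SpTilde n} {s : Set ℝ} {X Y : ℝ → Mat n} (hc : HasVel c s X)
    (h : ∀ t ∈ s, X t = Y t) : HasVel c s Y :=
  ⟨hc.1, fun t ht => by rw [← h t ht]; exact hc.2 t ht⟩

theorem HasVel.comp {c : ℝ → SpTilde n} {s s' : Set ℝ} {X : ℝ → Mat n} (hc : HasVel c s X)
    {g g' : ℝ → ℝ} (hg : ∀ t ∈ s', HasDerivWithinAt g (g' t) s' t) (hm : MapsTo g s' s) :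
    HasVel (fun t => c (g t)) s' fun t => g' t • X (g t) := by
  refine ⟨hc.1.comp (fun t ht => (hg t ht).continuousWithinAt) hm, fun t ht => ?_⟩
  have := (hc.2 (g t) (hm ht)).scomp t (hg t ht) hm
  refine this.congr_deriv ?_
  rw [Matrix.smul_mul]
  rfl

theorem coe_inv_eq (W : Sp n) : ((W⁻¹ : Sp n) : Mat n) = (-J₀ n) * (W : Mat n)ᵀ * J₀ n :=
  SymplecticGroup.coe_inv W

theorem HasVel.inv {c : ℝ → SpTilde n} {s : Set ℝ} {X : ℝ → Mat n} (hc : HasVel c s X) :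
    HasVel (fun t => (c t)⁻¹) s fun t => -Ad (c t).proj⁻¹ (X t) := by
  refine ⟨hc.1.inv, fun t ht => ?_⟩
  have h1 := hc.2 t ht
  have hu : IsUnit (projCurve c t) := (Matrix.isUnit_iff_isUnit_det _).2
    (by simp [projCurve, Sp.det_eq_one])
  have h0 : projCurve (fun t => (c t)⁻¹) = fun t => Ring.inverse (projCurve c t) := by
    funext t
    rw [← Matrix.nonsing_inv_eq_ringInverse]
    simp only [projCurve, SpTilde.proj_inv]
    exact SymplecticGroup.coe_inv' _
  have h2 := (hasFDerivAt_ringInverse (𝕜 := ℝ) hu.unit).comp_hasDerivWithinAt t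
    (by simpa using h1)
  rw [h0]
  refine h2.congr_deriv ?_
  have h3 : ((hu.unit⁻¹ : (Mat n)ˣ) : Mat n) = (((c t).proj⁻¹ : Sp n) : Mat n) := by
    rw [Units.inv_eq_of_mul_eq_one_right]
    exact (c t).proj.mul_inv_coe
  have h4 : Ring.inverse (projCurve c t) = (((c t).proj⁻¹ : Sp n) : Mat n) := by
    rw [← h3, ← Ring.inverse_unit]; rfl
  beta_reduce
  rw [h4, h3]
  change -((((c t).proj⁻¹ : Sp n) : Mat n) * (X t * (c t).proj) * (((c t).proj⁻¹ : Sp n) : Mat n)) =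
    -((((c t).proj⁻¹ : Sp n) : Mat n) * X t * (((c t).proj⁻¹⁻¹ : Sp n) : Mat n)) *
      (((c t).proj⁻¹ : Sp n) : Mat n)
  rw [inv_inv, Matrix.neg_mul]
  simp only [Matrix.mul_assoc]

/-! ### The derivative of the phase -/

theorem hasDerivWithinAt_toC_apply {Z : ℝ → Mat n} {Z' : Mat n} {s : Set ℝ} {t : ℝ}
    (h : HasDerivWithinAt Z Z' s t) (i j : Fin n) :
    HasDerivWithinAt (fun x => toC (Z x) i j) (toC Z' i j) s t := by
  have e : ∀ a b, HasDerivWithinAt (fun x => Z x a b) (Z' a b) s t := fun a b =>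
    hasDerivWithinAt_pi.1 (hasDerivWithinAt_pi.1 h a) b
  simp only [toC_apply]
  exact ((e _ _).ofReal_comp).add (((e _ _).ofReal_comp).const_mul _)

/-- The derivative of the phase in the direction `X`. -/
def phaseDeriv (W : Sp n) (X : Mat n) : ℝ :=
  ((gram (W : Mat n))⁻¹ * ((W : Mat n)ᵀ * form X * (W : Mat n)).toBlocks₁₁).trace

/-- The inverse Gram matrix and a diagonal block of the pulled back form are both positive
semi-definite, and the trace of their product is non-negative. All monotonicity in the file comes
from here. -/
theorem phaseDeriv_nonneg (W : Sp n) {X : Mat n} (h : (form X).PosSemidef) :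
    0 ≤ phaseDeriv W X := by
  refine trace_mul_nonneg (gram_posDef W).inv.posSemidef ?_
  have := h.conjTranspose_mul_mul_same (W : Mat n)
  exact PosSemidef.submatrix (by simpa using this) Sum.inl

/-- The inverse of `toC W` is gram⁻¹ (toC W)ᴴ with a real Gram matrix, so taking imaginary parts
keeps exactly the symplectic term of `toC_conjTranspose_mul`. -/
theorem im_trace_inv_toC (W : Sp n) (X : Mat n) :
    (trace ((toC (W : Mat n))⁻¹ * toC (X * (W : Mat n)))).im = phaseDeriv W X := by
  let φ : Matrix (Fin n) (Fin n) ℝ →+* Matrix (Fin n) (Fin n) ℂ := Complex.ofRealHom.mapMatrix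
  have hφ : ∀ M, φ M = M.map (fun x : ℝ => (x : ℂ)) := fun _ => rfl
  have hg : IsUnit (gram (W : Mat n)).det := (gram_posDef W).det_pos.ne'.isUnit
  have h1 : (toC (W : Mat n))⁻¹ = φ (gram (W : Mat n))⁻¹ * (toC (W : Mat n))ᴴ := by
    refine inv_eq_left_inv ?_
    rw [Matrix.mul_assoc, toC_gram, ← hφ, ← map_mul, nonsing_inv_mul _ hg, map_one]
  have h2 : (W : Mat n)ᵀ * (J₀ n)ᵀ * (X * (W : Mat n)) =
      (W : Mat n)ᵀ * form X * (W : Mat n) := by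
    simp only [form, Matrix.mul_assoc]
  rw [h1, Matrix.mul_assoc, toC_conjTranspose_mul, h2, ← hφ, ← hφ, Matrix.mul_add, Matrix.mul_smul,
    ← map_mul, ← map_mul, trace_add, trace_smul]
  have h3 : ∀ M, trace (φ M) = ((trace M : ℝ) : ℂ) := fun M =>
    (AddMonoidHom.map_trace Complex.ofRealHom.toAddMonoidHom M).symm
  rw [h3, h3]
  simp [phaseDeriv]

/-- Near t the phase is its value at t plus the imaginary part of the logarithm of a ratio of
determinants: the two sides differ by a multiple of 2π which is smaller than π by continuity. -/
theorem HasVel.hasDerivWithinAt_phase {c : ℝ → SpTilde n} {s : Set ℝ} {X : ℝ → Mat n} (hc : HasVel c s X) {t : ℝ}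
    (ht : t ∈ s) :
    HasDerivWithinAt (fun x => phase (c x)) (phaseDeriv (c t).proj (X t)) s t := by
  have hne : complexDet (projCurve c t) ≠ 0 := complexDet_ne_zero _
  have hdet := hasDerivWithinAt_det (hasDerivWithinAt_toC_apply (hc.2 t ht))
  have hq : HasDerivWithinAt (fun x => complexDet (projCurve c x) / complexDet (projCurve c t))
      (trace ((toC (projCurve c t))⁻¹ * toC (X t * projCurve c t))) s t := by
    refine (hdet.div_const _).congr_deriv ?_
    rw [Matrix.inv_def, Ring.inverse_eq_inv', Matrix.smul_mul, trace_smul, smul_eq_mul,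
      complexDet_eq]
    ring
  have h1 : complexDet (projCurve c t) / complexDet (projCurve c t) = 1 := div_self hne
  have hlog := hq.clog_real (by rw [h1]; simp)
  rw [h1, div_one] at hlog
  have him := Complex.imCLM.hasFDerivAt.comp_hasDerivWithinAt t hlog
  have hval : Complex.imCLM (trace ((toC (projCurve c t))⁻¹ * toC (X t * projCurve c t))) =
      phaseDeriv (c t).proj (X t) := im_trace_inv_toC _ _
  rw [hval] at him
  have him2 := him.const_add (phase (c t))
  refine him2.congr_of_eventuallyEq ?_ (by simp [h1])
  have hcont := (continuous_phase.continuousAt.comp_continuousWithinAt (hc.1 t ht)).tendsto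
  have hlim : Tendsto (fun x => (Complex.log (complexDet (projCurve c x) /
      complexDet (projCurve c t))).im) (𝓝[s] t) (𝓝 0) := by
    have := him.continuousWithinAt.tendsto
    simpa [h1, Function.comp_def] using this
  have hd := (hcont.sub hlim).eventually (Metric.ball_mem_nhds _ Real.pi_pos)
  filter_upwards [hd] with x hx
  have hx' : |(phase (c x) - (Complex.log (complexDet (projCurve c x) /
      complexDet (projCurve c t))).im) - (phase (c t) - 0)| < Real.pi := by
    rw [← Real.dist_eq]; exact hx
  have hne' : complexDet (projCurve c x) ≠ 0 := complexDet_ne_zero _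
  have he : Circle.exp (phase (c x)) = Circle.exp (phase (c t) +
      (Complex.log (complexDet (projCurve c x) / complexDet (projCurve c t))).im) := by
    rw [exp_phase, eq_comm, cdCircle_eq_iff]
    have e1 := Complex.exp_log (div_ne_zero hne' hne)
    have e2 := complexDet_proj (c t)
    set L := Complex.log (complexDet (projCurve c x) / complexDet (projCurve c t)) with hL
    have e3 : complexDet ((c x).proj : Mat n) = Complex.exp L * complexDet ((c t).proj : Mat n) := by
      rw [e1]; exact (div_mul_cancel₀ _ hne).symm
    have e4 : (‖Complex.exp L‖ : ℂ) * Complex.exp (L.im * Complex.I) = Complex.exp L := by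
      rw [Complex.norm_exp, Complex.ofReal_exp, ← Complex.exp_add, Complex.re_add_im]
    rw [e3, norm_mul]
    nth_rewrite 1 [e2]
    nth_rewrite 1 [← e4]
    push_cast
    rw [add_mul, Complex.exp_add]
    ring
  obtain ⟨m, hm⟩ := Circle.exp_eq_exp.1 he
  have hm2 : |(m : ℝ) * (2 * Real.pi)| < Real.pi := by
    rw [hm] at hx'
    convert hx' using 2
    ring
  have hm0 : m = 0 := by
    by_contra h
    have : (1 : ℝ) ≤ |(m : ℝ)| := by exact_mod_cast Int.one_le_abs h
    rw [abs_mul, abs_of_pos (by positivity : (0 : ℝ) < 2 * Real.pi)] at hm2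
    nlinarith [Real.pi_pos]
  rw [hm, hm0]
  simp

/-! ### The order defined by the phase -/

/-- The bi-invariant preorder defined by the phase. -/
def le (u v : SpTilde n) : Prop := ∀ x y, phase (x * u * y) ≤ phase (x * v * y)

theorem le_refl' (u : SpTilde n) : le u u := fun _ _ => le_refl _

theorem le.trans {u v w : SpTilde n} (h : le u v) (h' : le v w) : le u w :=
  fun x y => (h x y).trans (h' x y)

theorem le.mul_left {u v : SpTilde n} (h : le u v) (w : SpTilde n) : le (w * u) (w * v) :=
  fun x y => by simpa [mul_assoc] using h (x * w) y

theorem le.mul_right {u v : SpTilde n} (h : le u v) (w : SpTilde n) : le (u * w) (v * w) :=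
  fun x y => by simpa [mul_assoc] using h x (w * y)

theorem le.mul {u v u' v' : SpTilde n} (h : le u v) (h' : le u' v') : le (u * u') (v * v') :=
  (h.mul_right _).trans (h'.mul_left _)

theorem le.pow {u v : SpTilde n} (h : le u v) (k : ℕ) : le (u ^ k) (v ^ k) := by
  induction k with
  | zero => simpa using le_refl' _
  | succ k ih => simpa [pow_succ] using ih.mul h

theorem le.phase {u v : SpTilde n} (h : le u v) : phase u ≤ phase v := by
  simpa using h 1 1

theorem isClosed_le (v : SpTilde n) : IsClosed {u : SpTilde n | le u v} := by
  have : {u : SpTilde n | le u v} = ⋂ x, ⋂ y, {u | phase (x * u * y) ≤ phase (x * v * y)} := by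
    ext u; simp [le]
  rw [this]
  refine isClosed_iInter fun x => isClosed_iInter fun y => ?_
  exact _root_.isClosed_le (f := fun u => phase (x * u * y))
    (continuous_phase.comp (by fun_prop)) continuous_const

/-- Left translation acts on velocities by `Ad`, which preserves the cone, and right translation
does nothing; so the phase is monotone along every two-sided translate of the curve. -/
theorem HasVel.le {c : ℝ → SpTilde n} {a b : ℝ} {X : ℝ → Mat n} (hab : a ≤ b)
    (hc : HasVel c (Icc a b) X) (hX : ∀ t ∈ Icc a b, (form (X t)).PosSemidef) :
    le (c a) (c b) := by
  intro x y
  have h := (hc.const_mul x).mul_const y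
  have hm : MonotoneOn (fun t => phase (x * c t * y)) (Icc a b) := by
    refine monotoneOn_of_hasDerivWithinAt_nonneg (convex_Icc a b) ?_
      (f' := fun t => phaseDeriv (x * c t * y).proj (Ad x.proj (X t))) ?_ ?_
    · exact continuous_phase.comp_continuousOn h.1
    · exact fun t ht => (h.hasDerivWithinAt_phase (interior_subset ht)).mono interior_subset
    · exact fun t ht => phaseDeriv_nonneg _ (posSemidef_form_Ad _ (hX t (interior_subset ht)))
  exact hm (left_mem_Icc.2 hab) (right_mem_Icc.2 hab) hab

/-! ### Circles in the symplectic group -/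

theorem hasVel_liftCurve {g : ℝ → Sp n} (hg : Continuous g) (h0 : g 0 = 1) {s : Set ℝ}
    {X : ℝ → Mat n}
    (h : ∀ t ∈ s, HasDerivWithinAt (fun t => (g t : Mat n)) (X t * (g t : Mat n)) s t) :
    HasVel (liftCurve g hg h0) s X := by
  refine ⟨(continuous_liftCurve g hg h0).continuousOn, fun t ht => ?_⟩
  have h2 : projCurve (liftCurve g hg h0) = fun t => (g t : Mat n) := by
    funext t; simp [projCurve]
  rw [h2]
  exact h t ht

/-- The matrix `cos t + sin t Y`. -/
def circ (Y : Mat n) (t : ℝ) : Mat n := Real.cos t • (1 : Mat n) + Real.sin t • Y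

theorem circ_mem {Y : Sp n} (hY : (Y : Mat n) * (Y : Mat n) = -1) (t : ℝ) :
    circ (Y : Mat n) t ∈ symplecticGroup (Fin n) ℝ := by
  have h1 := Y.transpose_mul
  have h2 : (Y : Mat n)ᵀ * J₀ n = -(J₀ n * (Y : Mat n)) := by
    have := congrArg (· * (Y : Mat n)) h1
    simp only [Matrix.mul_assoc, hY, Matrix.mul_neg, Matrix.mul_one] at this
    rw [← this, neg_neg]
  have h3 : (Real.cos t * Real.cos t + Real.sin t * Real.sin t : ℝ) = 1 := by
    nlinarith [Real.cos_sq_add_sin_sq t]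
  rw [mem_sp]
  simp only [circ, transpose_add, transpose_smul, transpose_one, Matrix.add_mul, Matrix.mul_add,
    Matrix.smul_mul, Matrix.mul_smul, Matrix.one_mul, Matrix.mul_one, h2, Matrix.neg_mul,
    Matrix.mul_assoc, hY, Matrix.mul_neg, neg_neg]
  calc _ = (Real.cos t * Real.cos t + Real.sin t * Real.sin t : ℝ) • J₀ n := by module
    _ = _ := by rw [h3, one_smul]

open Classical in
/-- The matrix `cos t + sin t Y`, as a symplectic matrix. -/
def circSp (Y : Sp n) (t : ℝ) : Sp n :=
  if h : circ (Y : Mat n) t ∈ symplecticGroup (Fin n) ℝ then ⟨_, h⟩ else 1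

theorem coe_circSp {Y : Sp n} (hY : (Y : Mat n) * (Y : Mat n) = -1) (t : ℝ) :
    (circSp Y t : Mat n) = circ (Y : Mat n) t := by
  simp [circSp, circ_mem hY]

theorem continuous_circSp {X : Type*} [TopologicalSpace X] {t : X → ℝ} {Y : X → Sp n}
    (ht : Continuous t) (hY : Continuous Y) (h : ∀ x, (Y x : Mat n) * (Y x : Mat n) = -1) :
    Continuous fun x => circSp (Y x) (t x) := by
  refine Topology.IsInducing.subtypeVal.continuous_iff.2 ?_
  have : (Subtype.val ∘ fun x => circSp (Y x) (t x)) = fun x => circ (Y x : Mat n) (t x) := by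
    ext1 x
    exact coe_circSp (h x) _
  refine this ▸ ?_
  unfold circ
  fun_prop

theorem circSp_zero {Y : Sp n} (hY : (Y : Mat n) * (Y : Mat n) = -1) : circSp Y 0 = 1 := by
  apply Subtype.ext
  rw [coe_circSp hY]
  simp [circ]

theorem circSp_pi_div_two {Y : Sp n} (hY : (Y : Mat n) * (Y : Mat n) = -1) :
    circSp Y (Real.pi / 2) = Y := by
  apply Subtype.ext
  rw [coe_circSp hY]
  simp [circ]

/-- The lift of the circle through `Y`. -/
def circLift (Y : Sp n) (hY : (Y : Mat n) * (Y : Mat n) = -1) : ℝ → SpTilde n :=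
  liftCurve (circSp Y) (continuous_circSp continuous_id continuous_const fun _ => hY)
    (circSp_zero hY)

theorem hasVel_circLift (Y : Sp n) (hY : (Y : Mat n) * (Y : Mat n) = -1) (s : Set ℝ) :
    HasVel (circLift Y hY) s fun _ => Y := by
  refine hasVel_liftCurve _ _ fun t _ => ?_
  have h : (fun t => (circSp Y t : Mat n)) = circ (Y : Mat n) := funext fun t => coe_circSp hY t
  rw [h, coe_circSp hY]
  unfold circ
  refine (((Real.hasDerivAt_cos t).smul_const (1 : Mat n)).add
    ((Real.hasDerivAt_sin t).smul_const (Y : Mat n))).hasDerivWithinAt.congr_deriv ?_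
  rw [Matrix.mul_add, Matrix.mul_smul, Matrix.mul_smul, hY, Matrix.mul_one]
  module

/-- The complex structure as a symplectic matrix. -/
def Jsp (n : ℕ) : Sp n := ⟨J₀ n, SymplecticGroup.J_mem _ _⟩

theorem coe_Jsp : (Jsp n : Mat n) = J₀ n := rfl

theorem Jsp_sq : (Jsp n : Mat n) * (Jsp n : Mat n) = -1 := J_mul_J

/-- The lift of the rotations. -/
def rot : ℝ → SpTilde n := circLift (Jsp n) Jsp_sq

theorem hasVel_rot (s : Set ℝ) : HasVel (rot (n := n)) s fun _ => J₀ n :=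
  hasVel_circLift _ _ _

theorem continuous_rot : Continuous (rot (n := n)) := by
  unfold rot circLift
  exact continuous_liftCurve _ _ _

theorem rot_zero : rot 0 = (1 : SpTilde n) := by
  unfold rot circLift
  exact liftCurve_zero _ _ _

theorem coe_proj_rot (t : ℝ) : ((rot t : SpTilde n).proj : Mat n) =
    Real.cos t • (1 : Mat n) + Real.sin t • J₀ n := by
  rw [rot, circLift, proj_liftCurve, coe_circSp Jsp_sq]
  rfl

theorem rot_add (a b : ℝ) : rot (a + b) = (rot a * rot b : SpTilde n) := by
  have := eqOn_of_proj_eq (c := fun a => (rot (a + b) : SpTilde n)) (d := fun a => rot a * rot b)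
    isPreconnected_univ (continuous_rot.comp (by fun_prop)).continuousOn
    (continuous_rot.mul continuous_const).continuousOn (fun x _ => ?_) (mem_univ 0)
    (by simp [rot_zero])
  · exact this a trivial
  · apply Subtype.ext
    rw [SpTilde.proj_mul, Sp.coe_mul, coe_proj_rot, coe_proj_rot, coe_proj_rot, Real.cos_add,
      Real.sin_add]
    simp only [Matrix.add_mul, Matrix.mul_add, Matrix.smul_mul, Matrix.mul_smul, Matrix.one_mul,
      Matrix.mul_one, J_mul_J]
    module

theorem rot_neg (a : ℝ) : rot (-a) = (rot a : SpTilde n)⁻¹ := by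
  rw [eq_inv_iff_mul_eq_one, ← rot_add]
  simp [rot_zero]

theorem proj_rot_pi_div_two : (rot (Real.pi / 2) : SpTilde n).proj = Jsp n := by
  rw [rot, circLift, proj_liftCurve, circSp_pi_div_two Jsp_sq]

theorem coe_proj_rot_pi : ((rot Real.pi : SpTilde n).proj : Mat n) = -1 := by
  rw [coe_proj_rot]
  simp

theorem rot_pi_comm (w : SpTilde n) : rot Real.pi * w = w * rot Real.pi := by
  refine commute_of_proj_commute (fun g => ?_) w
  apply Subtype.ext
  rw [Sp.coe_mul, Sp.coe_mul, coe_proj_rot_pi]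
  simp

theorem toC_J : toC (J₀ n) = Complex.I • (1 : Matrix (Fin n) (Fin n) ℂ) := by
  ext i j
  by_cases h : i = j <;> simp [toC_apply, Matrix.J, h]

theorem phase_rot (t : ℝ) : phase (rot t : SpTilde n) = n * t := by
  have := phase_sub_phase (c := fun t => (rot t : SpTilde n)) (θ := fun t => n * t)
    (r := fun _ => 1) isPreconnected_univ continuous_rot.continuousOn (by fun_prop)
    (fun _ _ => one_pos) (fun t _ => ?_) (mem_univ 0) (mem_univ t)
  · simpa [rot_zero, phase_one] using this
  · rw [coe_proj_rot, complexDet_eq, toC_add, toC_smul, toC_smul, toC_one, toC_J, smul_smul,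
      ← add_smul, det_smul, det_one, mul_one, Complex.ofReal_one, one_mul]
    have h : ((Real.cos t : ℂ) + (Real.sin t : ℂ) * Complex.I) = Complex.exp (t * Complex.I) := by
      rw [Complex.exp_mul_I, Complex.ofReal_cos, Complex.ofReal_sin]
    rw [h, ← Complex.exp_nat_mul]
    simp [mul_assoc]

theorem le_rot {a b : ℝ} (hab : a ≤ b) : le (rot a : SpTilde n) (rot b) := by
  refine (hasVel_rot (Icc a b)).le hab fun t _ => ?_
  rw [form_J]
  exact Matrix.PosSemidef.one

/-! ### Unitary elements -/

theorem UTilde.commute_J {u : SpTilde n} (hu : u ∈ UTilde n) :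
    (u.proj : Mat n) * J₀ n = J₀ n * (u.proj : Mat n) := by
  have h1 : (u.proj : Mat n) * (u.proj : Mat n)ᵀ = 1 := (mem_orthogonalGroup_iff _ _).1 hu
  calc (u.proj : Mat n) * J₀ n = (u.proj : Mat n) * ((u.proj : Mat n)ᵀ * J₀ n * (u.proj : Mat n)) := by
        rw [u.proj.transpose_mul]
    _ = ((u.proj : Mat n) * (u.proj : Mat n)ᵀ) * J₀ n * (u.proj : Mat n) := by
        simp only [Matrix.mul_assoc]
    _ = _ := by rw [h1, Matrix.one_mul]

theorem cdCircle_mul {U W : Sp n} (hU : (U : Mat n) * J₀ n = J₀ n * (U : Mat n)) :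
    cdCircle (U * W) = cdCircle U * cdCircle W := by
  apply Subtype.ext
  change complexDet (U * W : Mat n) / (‖complexDet (U * W : Mat n)‖ : ℂ) =
    (complexDet (U : Mat n) / (‖complexDet (U : Mat n)‖ : ℂ)) *
      (complexDet (W : Mat n) / (‖complexDet (W : Mat n)‖ : ℂ))
  have : complexDet (U * W : Mat n) = complexDet (U : Mat n) * complexDet (W : Mat n) := by
    simp only [complexDet_eq, toC_mul hU, det_mul]
  rw [this, norm_mul, div_mul_div_comm, Complex.ofReal_mul]

theorem phase_unitary_mul {u : SpTilde n} (hu : u ∈ UTilde n) (w : SpTilde n) :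
    phase (u * w) = phase u + phase w := by
  have := sub_eq_of_exp_eq (f := fun w => phase (u * w)) (g := fun w => phase u + phase w)
    isPreconnected_univ (continuous_phase.comp (by fun_prop)).continuousOn
    (continuous_const.add continuous_phase).continuousOn (fun x _ => ?_) (mem_univ w) (mem_univ 1)
  · simp only [mul_one, phase_one, add_zero, sub_self] at this
    linarith
  · rw [exp_phase, Circle.exp_add, exp_phase, exp_phase, SpTilde.proj_mul,
      cdCircle_mul (UTilde.commute_J hu)]

theorem one_mem_UTilde : (1 : SpTilde n) ∈ UTilde n := by
  change ((1 : SpTilde n).proj : Mat n) ∈ orthogonalGroup (Fin n ⊕ Fin n) ℝ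
  rw [SpTilde.proj_one]
  exact one_mem _

theorem UTilde_mul {u v : SpTilde n} (hu : u ∈ UTilde n) (hv : v ∈ UTilde n) :
    u * v ∈ UTilde n := by
  change ((u * v).proj : Mat n) ∈ orthogonalGroup (Fin n ⊕ Fin n) ℝ
  rw [SpTilde.proj_mul]
  exact mul_mem hu hv

theorem phase_unitary_pow {u : SpTilde n} (hu : u ∈ UTilde n) (k : ℕ) :
    phase (u ^ k) = k * phase u := by
  induction k with
  | zero => simp [phase_one]
  | succ k ih => rw [pow_succ', phase_unitary_mul hu, ih]; push_cast; ring

theorem complexDet_unitary {u : SpTilde n} (hu : u ∈ UTilde n) :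
    complexDet (u.proj : Mat n) = Complex.exp (phase u * Complex.I) := by
  have h := complexDet_proj u
  have h1 : (toC (u.proj : Mat n))ᴴ * toC (u.proj : Mat n) = 1 := by
    have h3 : (u.proj : Mat n)ᵀ * (u.proj : Mat n) = 1 := (mem_orthogonalGroup_iff' _ _).1 hu
    rw [toC_gram, gram, h3]
    ext i j
    by_cases hij : i = j <;> simp [toBlocks₁₁, Matrix.one_apply, hij]
  have h2 := congrArg Matrix.det h1
  rw [det_mul, det_conjTranspose, det_one, ← complexDet_eq] at h2
  have h4 : ‖complexDet (u.proj : Mat n)‖ = 1 := by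
    have := congrArg norm h2
    rw [norm_mul, norm_star, norm_one] at this
    nlinarith [norm_nonneg (complexDet (u.proj : Mat n))]
  rw [h, h4]
  simp

/-! ### Positive symmetric elements and the polar decomposition -/

theorem mem_sclDom_of_posDef {P : Sp n} (hP : (P : Mat n).PosDef) : P ∈ SclDom n := by
  intro s hs
  refine Matrix.PosDef.det_pos ?_ |>.ne'
  refine Matrix.PosDef.posSemidef_add ?_ ?_
  · exact hP.posSemidef.smul (by linarith [hs.2])
  · exact Matrix.PosDef.one.smul (by linarith [hs.1])

theorem sclSp_symm {s : ℝ} {P : Sp n} (hP : (P : Mat n)ᵀ = P)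
    (hd : (sclDen s (P : Mat n)).det ≠ 0) : (sclSp s P : Mat n)ᵀ = sclSp s P := by
  rw [coe_sclSp hd, scl, Matrix.transpose_mul, transpose_nonsing_inv]
  have h1 : (sclDen s (P : Mat n))ᵀ = sclDen s (P : Mat n) := by simp [sclDen, hP]
  have h2 : (sclNum s (P : Mat n))ᵀ = sclNum s (P : Mat n) := by simp [sclNum, hP]
  rw [h1, h2]
  have hu := hd.isUnit
  have hc := (sclNum_commute s (P : Mat n)).eq
  calc (sclDen s (P : Mat n))⁻¹ * sclNum s (P : Mat n) =
        (sclDen s (P : Mat n))⁻¹ * (sclNum s (P : Mat n) * sclDen s (P : Mat n)) *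
          (sclDen s (P : Mat n))⁻¹ := by
        rw [Matrix.mul_assoc, Matrix.mul_assoc, mul_nonsing_inv _ hu, Matrix.mul_one]
    _ = _ := by
        rw [hc, ← Matrix.mul_assoc, nonsing_inv_mul _ hu, Matrix.one_mul]

theorem symm_mul_J {P : Sp n} (hP : (P : Mat n)ᵀ = P) : P * Jsp n * P = Jsp n := by
  apply Subtype.ext
  have := P.transpose_mul
  rw [hP] at this
  exact this

theorem symm_mul_J_sq {P : Sp n} (hP : (P : Mat n)ᵀ = P) :
    ((P * Jsp n : Sp n) : Mat n) * ((P * Jsp n : Sp n) : Mat n) = -1 := by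
  rw [← Sp.coe_mul, ← mul_assoc, symm_mul_J hP]
  exact Jsp_sq

/-- A symmetric symplectic matrix satisfies P J₀ P = J₀, so J₀ conjugates it to its inverse; the
Cayley scalings stay symmetric and carry this relation to the lifts. -/
theorem conj_J_princ {P : Sp n} (hP : (P : Mat n).PosDef) :
    rot (Real.pi / 2) * princ P * (rot (Real.pi / 2))⁻¹ = (princ P)⁻¹ := by
  have hsymm : (P : Mat n)ᵀ = P := by simpa using hP.isHermitian.eq
  have hD := mem_sclDom_of_posDef hP
  let c : I → SpTilde n := fun s => princ (sclSp s P)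
  have hm : ∀ s : I, sclSp (s : ℝ) P ∈ SclDom n := fun s => sclSp_mem_sclDom s.2 hD
  have hc : Continuous c := continuous_princ
    (continuous_sclSp continuous_subtype_val continuous_const fun s => hD s s.2) hm
  have := eqOn_of_proj_eq (c := fun s => rot (Real.pi / 2) * c s * (rot (Real.pi / 2))⁻¹)
    (d := fun s => (c s)⁻¹) isPreconnected_univ (by fun_prop) (by fun_prop) (fun s _ => ?_)
    (mem_univ 0) ?_ 1 trivial
  · simpa [c, sclSp_one] using this
  · simp only [SpTilde.proj_mul, SpTilde.proj_inv, proj_rot_pi_div_two, c, proj_princ (hm s)]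
    have h := symm_mul_J (sclSp_symm hsymm (hD s s.2))
    have h4 : Jsp n * sclSp (s : ℝ) P = (sclSp (s : ℝ) P)⁻¹ * Jsp n := by
      rw [eq_inv_mul_iff_mul_eq, ← mul_assoc]
      exact h
    rw [h4, mul_inv_cancel_right]
  · simp [c, sclSp_zero hD, princ_one]

/-- The matrix P J₀ squares to -1 and lies in the positive cone, so the circle through it increases
from 1; `e` is its quarter turn. Both sides of the equation project to -P, and they are compared by
scaling P down to 1. -/
theorem rot_pi_mul_princ {P : Sp n} (hP : (P : Mat n).PosDef) :
    ∃ e : SpTilde n, le 1 e ∧ rot Real.pi * princ P = e * rot (Real.pi / 2) := by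
  have hsymm : (P : Mat n)ᵀ = P := by simpa using hP.isHermitian.eq
  have hD := mem_sclDom_of_posDef hP
  have hm : ∀ s : I, sclSp (s : ℝ) P ∈ SclDom n := fun s => sclSp_mem_sclDom s.2 hD
  have hcs : Continuous fun s : I => sclSp (s : ℝ) P :=
    continuous_sclSp continuous_subtype_val continuous_const fun s => hD s s.2
  have hsq : ∀ s : I, ((sclSp (s : ℝ) P * Jsp n : Sp n) : Mat n) *
      ((sclSp (s : ℝ) P * Jsp n : Sp n) : Mat n) = -1 :=
    fun s => symm_mul_J_sq (sclSp_symm hsymm (hD s s.2))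
  let e : I → SpTilde n := fun s => circLift (sclSp (s : ℝ) P * Jsp n) (hsq s) (Real.pi / 2)
  have he : Continuous e :=
    continuous_pathClass (fun (s : I) (t : I) => circSp (sclSp (s : ℝ) P * Jsp n) (Real.pi / 2 * t))
      (continuous_circSp (by fun_prop) ((hcs.comp continuous_fst).mul continuous_const)
        fun p => hsq p.1) _
  have hpe : ∀ s, (e s).proj = sclSp (s : ℝ) P * Jsp n := fun s => by
    simp [e, circLift, circSp_pi_div_two (hsq s)]
  refine ⟨e 1, ?_, ?_⟩
  · have h1 := (hasVel_circLift (sclSp (1 : I) P * Jsp n) (hsq 1) (Icc 0 (Real.pi / 2))).le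
      (by positivity) (fun t _ => ?_)
    · have e0 : circLift (sclSp (1 : I) P * Jsp n) (hsq 1) 0 = 1 := by
        unfold circLift
        exact liftCurve_zero _ _ _
      rwa [e0] at h1
    · have h2 : ((sclSp (1 : I) P * Jsp n : Sp n) : Mat n) = (P : Mat n) * J₀ n := by
        simp [sclSp_one, coe_Jsp]
      have := hP.posSemidef.conjTranspose_mul_mul_same (J₀ n)
      rw [h2, form, ← Matrix.mul_assoc]
      simpa using this
  · have := eqOn_of_proj_eq (c := fun s : I => rot Real.pi * princ (sclSp (s : ℝ) P))
      (d := fun s => e s * rot (Real.pi / 2)) isPreconnected_univ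
      (continuous_const.mul (continuous_princ hcs hm)).continuousOn (by fun_prop) (fun s _ => ?_)
      (mem_univ 0) ?_ 1 trivial
    · simpa [sclSp_one] using this
    · apply Subtype.ext
      simp only [SpTilde.proj_mul, hpe, proj_princ (hm s), proj_rot_pi_div_two, Sp.coe_mul,
        coe_proj_rot_pi, coe_Jsp, Matrix.mul_assoc, J_mul_J]
      simp
    · have h0 : sclSp ((0 : I) : ℝ) P = 1 := by simpa using sclSp_zero hD
      have h3 : e 0 = rot (Real.pi / 2) := by
        refine pathClass_congr _ _ _ _ fun t => ?_
        rw [h0, one_mul]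
      rw [h3, h0, princ_one, mul_one, ← rot_add, add_halves]

theorem one_le_rot_pi_mul_princ {P : Sp n} (hP : (P : Mat n).PosDef) :
    le 1 (rot Real.pi * princ P) := by
  obtain ⟨e, h1, h2⟩ := rot_pi_mul_princ hP
  rw [h2]
  have h3 : le (1 : SpTilde n) (rot (Real.pi / 2)) := by
    have := le_rot (n := n) (a := 0) (b := Real.pi / 2) (by positivity)
    rwa [rot_zero] at this
  simpa using h1.mul h3

/-- Conjugation by the quarter turn inverts `princ P` and exchanges the lower and the upper bound.
-/
theorem princ_le_rot_pi {P : Sp n} (hP : (P : Mat n).PosDef) : le (princ P) (rot Real.pi) := by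
  have h := (one_le_rot_pi_mul_princ hP).mul_right (princ P)⁻¹
  rw [one_mul, mul_inv_cancel_right] at h
  have h2 := (h.mul_left (rot (Real.pi / 2))⁻¹).mul_right (rot (Real.pi / 2))
  rw [← conj_J_princ hP, mul_assoc _ (rot Real.pi), rot_pi_comm] at h2
  simpa [mul_assoc] using h2

theorem rot_neg_pi_le_princ {P : Sp n} (hP : (P : Mat n).PosDef) :
    le (rot (-Real.pi)) (princ P) := by
  have h := (one_le_rot_pi_mul_princ hP).mul_left (rot Real.pi)⁻¹
  rw [mul_one, inv_mul_cancel_left] at h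
  rwa [rot_neg]

theorem exists_sqrt {g : Sp n} (hg : (g : Mat n).PosDef) :
    ∃ p : Sp n, (p : Mat n) = CFC.sqrt (g : Mat n) ∧ (p : Mat n).PosDef ∧ p * p = g := by
  set q := CFC.sqrt (g : Mat n) with hq
  have hq2 : q * q = (g : Mat n) := CFC.sqrt_mul_sqrt_self _ hg.posSemidef.nonneg
  have hqs : q.PosSemidef := Matrix.nonneg_iff_posSemidef.1 (CFC.sqrt_nonneg _)
  have hqdet : q.det ≠ 0 := by
    intro h
    have := congrArg Matrix.det hq2
    rw [det_mul, h, Sp.det_eq_one] at this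
    simp at this
  have hqd : q.PosDef := hqs.posDef_iff_det_ne_zero.2 hqdet
  have hsymm : (g : Mat n)ᵀ = g := by simpa using hg.isHermitian.eq
  have hgJ : (g : Mat n) * J₀ n * g = J₀ n := by
    have := g.transpose_mul
    rwa [hsymm] at this
  have hu : IsUnit q.det := hqdet.isUnit
  have hJJ : (J₀ n)ᵀ * J₀ n = 1 := by rw [J_transpose', Matrix.neg_mul, J_mul_J, neg_neg]
  have hJJ' : J₀ n * (J₀ n)ᵀ = 1 := by rw [J_transpose', Matrix.mul_neg, J_mul_J, neg_neg]
  -- For symplectic g this is another non-negative square root of g. Uniqueness of the root gives q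
  -- = r, which says that q is symplectic.
  let r : Mat n := (J₀ n)ᵀ * q⁻¹ * J₀ n
  have hr0 : 0 ≤ r := by
    have := hqd.inv.posSemidef.conjTranspose_mul_mul_same (J₀ n)
    rw [conjTranspose_eq_transpose_of_trivial] at this
    exact this.nonneg
  have hgi : (q⁻¹ * q⁻¹) * (g : Mat n) = 1 := by
    rw [← hq2, Matrix.mul_assoc, ← Matrix.mul_assoc q⁻¹ q q, nonsing_inv_mul _ hu, Matrix.one_mul,
      nonsing_inv_mul _ hu]
  have hr2 : r * r = (g : Mat n) := by
    calc r * r = (J₀ n)ᵀ * q⁻¹ * (J₀ n * (J₀ n)ᵀ) * q⁻¹ * J₀ n := by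
          simp only [r, Matrix.mul_assoc]
      _ = (J₀ n)ᵀ * (q⁻¹ * q⁻¹) * J₀ n := by
          rw [hJJ', Matrix.mul_one]; simp only [Matrix.mul_assoc]
      _ = (J₀ n)ᵀ * (q⁻¹ * q⁻¹) * ((g : Mat n) * J₀ n * g) := by rw [hgJ]
      _ = (J₀ n)ᵀ * ((q⁻¹ * q⁻¹) * g) * J₀ n * g := by simp only [Matrix.mul_assoc]
      _ = g := by rw [hgi, Matrix.mul_one, hJJ, Matrix.one_mul]
  have hrq : q = r := CFC.sqrt_unique hr2 hr0
  have hmem : q ∈ symplecticGroup (Fin n) ℝ := by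
    rw [mem_sp]
    have hqs' : qᵀ = q := by simpa using hqd.isHermitian.eq
    rw [hqs']
    calc q * J₀ n * q = q * J₀ n * r := by rw [← hrq]
      _ = q * (J₀ n * (J₀ n)ᵀ) * q⁻¹ * J₀ n := by simp only [r, Matrix.mul_assoc]
      _ = J₀ n := by rw [hJJ', Matrix.mul_one, mul_nonsing_inv _ hu, Matrix.one_mul]
  exact ⟨⟨q, hmem⟩, rfl, hqd, Subtype.ext hq2⟩

/-- The transpose, as a symplectic matrix. -/
def Sp.tr (W : Sp n) : Sp n := ⟨(W : Mat n)ᵀ, SymplecticGroup.transpose_mem W.2⟩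

theorem Sp.tr_mul_self_posDef (W : Sp n) : ((W.tr * W : Sp n) : Mat n).PosDef :=
  posDef_transpose_mul_self (by rw [W.det_eq_one]; exact one_ne_zero)

theorem mul_inv_sqrt_orthogonal {W p : Sp n} (hp : (p : Mat n).PosDef) (h : p * p = W.tr * W) :
    ((W * p⁻¹ : Sp n) : Mat n) ∈ orthogonalGroup (Fin n ⊕ Fin n) ℝ := by
  rw [mem_orthogonalGroup_iff']
  have hsymm : (p : Mat n)ᵀ = p := by simpa using hp.isHermitian.eq
  have hi : ((p⁻¹ : Sp n) : Mat n)ᵀ = ((p⁻¹ : Sp n) : Mat n) := by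
    rw [SymplecticGroup.coe_inv', transpose_nonsing_inv, hsymm]
  have h2 : (p : Mat n) * p = (W : Mat n)ᵀ * W := congrArg Subtype.val h
  rw [Sp.coe_mul]
  change ((W : Mat n) * ((p⁻¹ : Sp n) : Mat n))ᵀ * _ = 1
  rw [Matrix.transpose_mul, hi, Matrix.mul_assoc, ← Matrix.mul_assoc (W : Mat n)ᵀ, ← h2,
    Matrix.mul_assoc, p.mul_inv_coe, Matrix.mul_one, p.inv_mul_coe]

theorem exists_polar (w : SpTilde n) : ∃ u ∈ UTilde n, ∃ P : Sp n, (P : Mat n).PosDef ∧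
    w = u * princ P := by
  obtain ⟨p, -, hp, h⟩ := exists_sqrt w.proj.tr_mul_self_posDef
  refine ⟨w * (princ p)⁻¹, ?_, p, hp, by simp⟩
  change ((w * (princ p)⁻¹).proj : Mat n) ∈ orthogonalGroup (Fin n ⊕ Fin n) ℝ
  rw [SpTilde.proj_mul, SpTilde.proj_inv, proj_princ (mem_sclDom_of_posDef hp)]
  exact mul_inv_sqrt_orthogonal hp h

/-! ### The phase is a quasimorphism -/

theorem rot_mem_UTilde (t : ℝ) : (rot t : SpTilde n) ∈ UTilde n := by
  change ((rot t : SpTilde n).proj : Mat n) ∈ orthogonalGroup (Fin n ⊕ Fin n) ℝ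
  rw [mem_orthogonalGroup_iff', coe_proj_rot]
  change (_ : Mat n)ᵀ * _ = 1
  simp only [transpose_add, transpose_smul, transpose_one, J_transpose', Matrix.add_mul,
    Matrix.mul_add, Matrix.smul_mul, Matrix.mul_smul, Matrix.one_mul, Matrix.mul_one,
    Matrix.neg_mul, J_mul_J]
  have h3 : (Real.cos t * Real.cos t + Real.sin t * Real.sin t : ℝ) = 1 := by
    nlinarith [Real.cos_sq_add_sin_sq t]
  calc _ = (Real.cos t * Real.cos t + Real.sin t * Real.sin t : ℝ) • (1 : Mat n) := by module
    _ = _ := by rw [h3, one_smul]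

/-- The unitary factor of v contributes exactly. Its positive factor lies between the rotations of
angle ±π, each of which shifts the phase by nπ; this is used once for v w and once for v. -/
theorem phase_quasi (v w : SpTilde n) :
    |phase (v * w) - phase v - phase w| ≤ 2 * (n * Real.pi) := by
  obtain ⟨u, hu, P, hP, rfl⟩ := exists_polar v
  have h1 := ((princ_le_rot_pi hP).mul_right w).phase
  have h2 := ((rot_neg_pi_le_princ hP).mul_right w).phase
  have h3 := (princ_le_rot_pi hP).phase
  have h4 := (rot_neg_pi_le_princ hP).phase
  rw [phase_unitary_mul (rot_mem_UTilde _), phase_rot] at h1 h2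
  rw [phase_rot] at h3 h4
  rw [mul_assoc, phase_unitary_mul hu, phase_unitary_mul hu, abs_le]
  constructor <;> linarith

/-! ### The homogenized phase -/

/-- The homogenization of the phase. -/
def hphase (w : SpTilde n) : ℝ := limUnder atTop fun k : ℕ => phase (w ^ 2 ^ k) / 2 ^ k

/-- Along powers of two, consecutive normalized phases differ by half the defect over 2ᵏ. The
geometric rate gives existence of the limit and uniformity in w, hence continuity of `hphase`. -/
theorem dist_phase_pow_two (w : SpTilde n) (k : ℕ) :
    dist (phase (w ^ 2 ^ k) / 2 ^ k) (phase (w ^ 2 ^ (k + 1)) / 2 ^ (k + 1)) ≤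
      2 * (n * Real.pi) / 2 / 2 ^ k := by
  have h := phase_quasi (w ^ 2 ^ k) (w ^ 2 ^ k)
  rw [← pow_add, ← two_mul, ← pow_succ'] at h
  have h2 : phase (w ^ 2 ^ k) / 2 ^ k - phase (w ^ 2 ^ (k + 1)) / 2 ^ (k + 1) =
      -(phase (w ^ 2 ^ (k + 1)) - phase (w ^ 2 ^ k) - phase (w ^ 2 ^ k)) / 2 / 2 ^ k := by
    field_simp; ring
  rw [Real.dist_eq, h2, abs_div, abs_div, abs_neg, abs_of_pos (by positivity : (0 : ℝ) < 2 ^ k),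
    abs_of_pos (by positivity : (0 : ℝ) < 2)]
  gcongr

theorem tendsto_hphase (w : SpTilde n) :
    Tendsto (fun k : ℕ => phase (w ^ 2 ^ k) / 2 ^ k) atTop (𝓝 (hphase w)) :=
  (cauchySeq_of_le_geometric_two (dist_phase_pow_two w)).tendsto_limUnder

theorem dist_phase_hphase (w : SpTilde n) (k : ℕ) :
    |phase (w ^ 2 ^ k) / 2 ^ k - hphase w| ≤ 2 * (n * Real.pi) / 2 ^ k :=
  dist_le_of_le_geometric_two_of_tendsto (dist_phase_pow_two w) (tendsto_hphase w) k

theorem abs_phase_sub_hphase (w : SpTilde n) : |phase w - hphase w| ≤ 2 * (n * Real.pi) := by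
  simpa using dist_phase_hphase w 0

theorem tendsto_div_two_pow (C : ℝ) : Tendsto (fun k : ℕ => C / 2 ^ k) atTop (𝓝 0) := by
  have := (tendsto_pow_atTop_nhds_zero_of_lt_one (r := (1 / 2 : ℝ)) (by norm_num)
    (by norm_num)).const_mul C
  simpa [div_eq_mul_inv] using this

theorem hphase_le_of_le {v w : SpTilde n} (C : ℝ)
    (h : ∀ k : ℕ, phase (v ^ k) ≤ phase (w ^ k) + C) : hphase v ≤ hphase w := by
  have h2 := (tendsto_hphase w).add (tendsto_div_two_pow C)
  rw [add_zero] at h2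
  refine le_of_tendsto_of_tendsto' (tendsto_hphase v) h2 fun k => ?_
  rw [← add_div]
  gcongr
  exact h _

theorem le.hphase {v w : SpTilde n} (h : le v w) : hphase v ≤ hphase w :=
  hphase_le_of_le 0 fun k => by simpa using (h.pow k).phase

theorem hphase_unitary {u : SpTilde n} (hu : u ∈ UTilde n) : hphase u = phase u := by
  refine tendsto_nhds_unique (tendsto_hphase u) ?_
  refine tendsto_const_nhds.congr fun k => ?_
  rw [phase_unitary_pow hu]
  push_cast
  field_simp

theorem hphase_one : hphase (1 : SpTilde n) = 0 := by
  rw [hphase_unitary one_mem_UTilde, phase_one]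

theorem continuous_hphase : Continuous (hphase (n := n)) := by
  refine TendstoUniformly.continuous (F := fun (k : ℕ) (w : SpTilde n) => phase (w ^ 2 ^ k) / 2 ^ k)
    (p := atTop) ?_ ?_
  · rw [Metric.tendstoUniformly_iff]
    intro ε hε
    filter_upwards [(tendsto_div_two_pow (2 * (n * Real.pi))).eventually_lt_const hε] with k hk w
    rw [dist_comm]
    exact (dist_phase_hphase w k).trans_lt hk
  · refine Frequently.of_forall fun k => ?_
    exact (continuous_phase.comp (continuous_pow _)).div_const _

/-- For commuting elements the power of the product splits, and the bounded defect disappears after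
division by 2ᵏ. -/
theorem hphase_mul_of_commute {v w : SpTilde n} (h : Commute v w) :
    hphase (v * w) = hphase v + hphase w := by
  refine tendsto_nhds_unique (tendsto_hphase _) ?_
  have h1 := (tendsto_hphase v).add (tendsto_hphase w)
  have h2 : Tendsto (fun k : ℕ => phase ((v * w) ^ 2 ^ k) / 2 ^ k -
      (phase (v ^ 2 ^ k) / 2 ^ k + phase (w ^ 2 ^ k) / 2 ^ k)) atTop (𝓝 0) := by
    refine squeeze_zero_norm (fun k => ?_) (tendsto_div_two_pow (2 * (n * Real.pi)))
    rw [h.mul_pow, ← add_div, ← sub_div, norm_div, Real.norm_eq_abs, Real.norm_eq_abs,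
      abs_of_pos (by positivity : (0 : ℝ) < 2 ^ k), ← sub_sub]
    gcongr
    exact phase_quasi _ _
  simpa using h2.add h1

theorem hphase_pow (w : SpTilde n) (k : ℕ) : hphase (w ^ k) = k * hphase w := by
  induction k with
  | zero => simp [hphase_one]
  | succ k ih => rw [pow_succ, hphase_mul_of_commute (Commute.pow_self w k), ih]; push_cast; ring

theorem hphase_inv (w : SpTilde n) : hphase w⁻¹ = -hphase w := by
  have := hphase_mul_of_commute (Commute.refl w).inv_right
  rw [mul_inv_cancel, hphase_one] at this
  linarith

theorem hphase_zpow (w : SpTilde n) (k : ℤ) : hphase (w ^ k) = k * hphase w := by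
  obtain ⟨m, rfl | rfl⟩ := k.eq_nat_or_neg
  · rw [zpow_natCast, hphase_pow]; simp
  · rw [_root_.zpow_neg, zpow_natCast, hphase_inv, hphase_pow]; simp

/-- One defect of `phase` plus three replacements of `phase` by `hphase`, each costing 2nπ. -/
theorem hphase_quasi (v w : SpTilde n) :
    |hphase (v * w) - hphase v - hphase w| ≤ 8 * (n * Real.pi) := by
  have h0 := abs_le.1 (phase_quasi v w)
  have h1 := abs_le.1 (abs_phase_sub_hphase v)
  have h2 := abs_le.1 (abs_phase_sub_hphase w)
  have h3 := abs_le.1 (abs_phase_sub_hphase (v * w))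
  rw [abs_le]
  constructor <;> linarith [h0.1, h0.2, h1.1, h1.2, h2.1, h2.2, h3.1, h3.2]

/-- A homogeneous quasimorphism is determined by its values up to a bounded error. -/
theorem eq_of_homogeneous {H : Type*} [Group H] {f g : H → ℝ}
    (hf : ∀ w, ∀ k : ℕ, f (w ^ k) = k * f w) (hg : ∀ w, ∀ k : ℕ, g (w ^ k) = k * g w) {v w : H}
    {C : ℝ} (h : ∀ k : ℕ, |f (v ^ k) - g (w ^ k)| ≤ C) : f v = g w := by
  by_contra hne
  have hpos : 0 < |f v - g w| := abs_pos.2 (sub_ne_zero.2 hne)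
  obtain ⟨k, hk⟩ := exists_nat_gt (C / |f v - g w|)
  have h1 := h k
  rw [hf, hg, ← mul_sub, abs_mul, Nat.abs_cast] at h1
  rw [div_lt_iff₀ hpos] at hk
  linarith

/-- Conjugation commutes with powers and changes a quasimorphism by an amount bounded independently
of the power; homogeneity turns a bounded difference into zero. -/
theorem conj_eq_of_quasimorphism {H : Type*} [Group H] {f : H → ℝ} {C : ℝ}
    (hf : ∀ w, ∀ k : ℕ, f (w ^ k) = k * f w) (hq : ∀ v w, |f (v * w) - f v - f w| ≤ C) (g w : H) :
    f (g * w * g⁻¹) = f w := by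
  refine eq_of_homogeneous hf hf (C := 2 * C + |f g| + |f g⁻¹|) fun k => ?_
  rw [conj_pow]
  have h1 := hq (g * w ^ k) g⁻¹
  have h2 := hq g (w ^ k)
  have e : f (g * w ^ k * g⁻¹) - f (w ^ k) = (f (g * w ^ k * g⁻¹) - f (g * w ^ k) - f g⁻¹) +
      (f (g * w ^ k) - f g - f (w ^ k)) + f g + f g⁻¹ := by ring
  rw [e]
  refine (abs_add_le _ _).trans (add_le_add ((abs_add_le _ _).trans (add_le_add
    ((abs_add_le _ _).trans ?_) le_rfl)) le_rfl)
  linarith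

theorem hphase_conj (g w : SpTilde n) : hphase (g * w * g⁻¹) = hphase w :=
  conj_eq_of_quasimorphism hphase_pow hphase_quasi g w

/-! ### The homogeneous Maslov quasimorphism -/

theorem isHomogeneousMaslov_hphase :
    IsHomogeneousMaslov n fun w => hphase w / (2 * Real.pi) where
  quasimorphism := by
    refine ⟨8 * (n * Real.pi) / (2 * Real.pi), fun v w => ?_⟩
    have := hphase_quasi v w
    rw [← sub_div, ← sub_div, abs_div, abs_of_pos (by positivity : 0 < 2 * Real.pi)]
    gcongr
  homogeneous w k := by rw [hphase_zpow, mul_div_assoc]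
  continuousOn_unitary := (continuous_hphase.div_const _).continuousOn
  lift_one := by simp [hphase_one]
  lift_det w hw := by
    rw [complexDet_unitary hw, hphase_unitary hw]
    congr 1
    push_cast
    field_simp

/-- The absolute value in the polar decomposition. -/
def Sp.abs (W : Sp n) : Sp n := Classical.choose (exists_sqrt W.tr_mul_self_posDef)

theorem Sp.abs_spec (W : Sp n) : (W.abs : Mat n) = CFC.sqrt ((W.tr * W : Sp n) : Mat n) ∧
    (W.abs : Mat n).PosDef ∧ W.abs * W.abs = W.tr * W :=
  Classical.choose_spec (exists_sqrt W.tr_mul_self_posDef)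

theorem Sp.continuous_abs : Continuous (Sp.abs (n := n)) := by
  refine Topology.IsInducing.subtypeVal.continuous_iff.2 ?_
  have : (Subtype.val ∘ Sp.abs (n := n)) = fun W : Sp n => CFC.sqrt ((W : Mat n)ᵀ * (W : Mat n)) := by
    ext1 W
    exact W.abs_spec.1
  refine this ▸ ?_
  refine CFC.continuousOn_sqrt.comp_continuous (by fun_prop) fun W => ?_
  exact (W.tr_mul_self_posDef).posSemidef.nonneg

theorem Sp.abs_of_orthogonal {W : Sp n} (h : (W : Mat n)ᵀ * (W : Mat n) = 1) : W.abs = 1 := by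
  apply Subtype.ext
  rw [W.abs_spec.1]
  change CFC.sqrt ((W : Mat n)ᵀ * (W : Mat n)) = 1
  rw [h]
  exact CFC.sqrt_unique (by simp) (Matrix.PosSemidef.one).nonneg

/-- Every element of the preimage of the unitary group is the end of a curve in this preimage. -/
theorem exists_curve_UTilde {w : SpTilde n} (hw : w ∈ UTilde n) :
    ∃ c : ℝ → SpTilde n, Continuous c ∧ c 0 = 1 ∧ c 1 = w ∧ ∀ t, c t ∈ UTilde n := by
  obtain ⟨f, hf, h0, rfl⟩ := exists_pathClass w
  have ho : ∀ W : Sp n, (W : Mat n)ᵀ * (W : Mat n) = 1 → W.abs = 1 := fun W h =>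
    Sp.abs_of_orthogonal h
  have h1 : (f 1).abs = 1 := by
    refine ho _ ?_
    have := (mem_orthogonalGroup_iff' _ _).1 hw
    simpa using this
  have h2 : (f 0).abs = 1 := by
    refine ho _ ?_
    rw [h0]
    simp
  have hfa : Continuous fun t => (f t).abs := Sp.continuous_abs.comp hf
  have hg : Continuous fun t => f t * (f t).abs⁻¹ := hf.mul hfa.inv
  have hg0 : f 0 * (f 0).abs⁻¹ = 1 := by rw [h0, h0.symm, h2]; simp [h0]
  -- Dividing out the absolute value changes the path by a loop of positive definite matrices. That
  -- loop lies in `SclDom`, so its class is `princ 1 = 1`.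
  have e : pathClass f hf h0 = pathClass (fun t => f t * (f t).abs⁻¹) hg hg0 := by
    have h3 := pathClass_eq_princ (fun t => (f t).abs) hfa h2
      fun t => mem_sclDom_of_posDef (f t).abs_spec.2.1
    rw [h1, princ_one] at h3
    rw [← mul_one (pathClass (fun t => f t * (f t).abs⁻¹) hg hg0), ← h3, pathClass_mul]
    exact pathClass_congr _ _ _ _ fun t => by simp
  refine ⟨liftCurve (fun t => f (projIcc 0 1 zero_le_one t) *
    (f (projIcc 0 1 zero_le_one t)).abs⁻¹) (hg.comp continuous_projIcc) (by simpa using hg0),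
    continuous_liftCurve _ _ _, liftCurve_zero _ _ _, ?_, fun t => ?_⟩
  · rw [e]
    refine pathClass_congr _ _ _ _ fun t => ?_
    simp
  · change ((_ : SpTilde n).proj : Mat n) ∈ orthogonalGroup (Fin n ⊕ Fin n) ℝ
    rw [proj_liftCurve]
    exact mul_inv_sqrt_orthogonal (Sp.abs_spec _).2.1 (Sp.abs_spec _).2.2

/-- The determinant condition fixes f on unitary elements, since each is joined to 1 inside
`UTilde`. The positive factor of a polar decomposition is conjugate to its inverse, so f vanishes on
it. Thus f is within a bounded distance of the normalized `hphase`, and homogeneity gives equality.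
-/
theorem IsHomogeneousMaslov.eq {f : SpTilde n → ℝ} (hf : IsHomogeneousMaslov n f) :
    f = fun w => hphase w / (2 * Real.pi) := by
  obtain ⟨C, hC⟩ := hf.quasimorphism
  have hpow : ∀ w, ∀ k : ℕ, f (w ^ k) = k * f w := fun w k => by
    simpa using hf.homogeneous w k
  have hinv : ∀ w, f w⁻¹ = -f w := fun w => by
    simpa using hf.homogeneous w (-1)
  have hU : ∀ u ∈ UTilde n, 2 * Real.pi * f u = hphase u := by
    intro u hu
    obtain ⟨c, hc, hc0, hc1, hcU⟩ := exists_curve_UTilde hu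
    have h1 : Continuous fun t => f (c t) :=
      hf.continuousOn_unitary.comp_continuous hc hcU
    have := sub_eq_of_exp_eq (f := fun t => 2 * Real.pi * f (c t)) (g := fun t => hphase (c t))
      isPreconnected_univ (continuous_const.mul h1).continuousOn
      (continuous_hphase.comp hc).continuousOn (fun t _ => ?_) (mem_univ (0 : ℝ)) (mem_univ 1)
    · simp only [hc0, hc1, hf.lift_one, hphase_one] at this
      linarith
    · apply Subtype.ext
      rw [Circle.coe_exp, Circle.coe_exp, hphase_unitary (hcU t), ← complexDet_unitary (hcU t),
        ← hf.lift_det _ (hcU t)]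
      congr 1
      push_cast
      ring
  have hP : ∀ P : Sp n, (P : Mat n).PosDef → f (princ P) = 0 := by
    intro P hP
    have h1 := conj_eq_of_quasimorphism hpow hC (rot (Real.pi / 2)) (princ P)
    rw [conj_J_princ hP, hinv] at h1
    linarith
  have hPh : ∀ P : Sp n, (P : Mat n).PosDef → hphase (princ P) = 0 := by
    intro P hP
    have h1 := hphase_conj (rot (Real.pi / 2)) (princ P)
    rw [conj_J_princ hP, hphase_inv] at h1
    linarith
  obtain ⟨D, hD⟩ := (isHomogeneousMaslov_hphase (n := n)).quasimorphism
  have key : ∀ w, |f w - hphase w / (2 * Real.pi)| ≤ C + D := by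
    intro w
    obtain ⟨u, hu, P, hPd, rfl⟩ := exists_polar w
    have h1 := hC u (princ P)
    have h2 := hD u (princ P)
    rw [hP P hPd] at h1
    rw [hPh P hPd, ← hU u hu, mul_div_cancel_left₀ _ (by positivity), zero_div] at h2
    rw [abs_le] at h1 h2 ⊢
    constructor <;> linarith [h1.1, h1.2, h2.1, h2.2]
  funext w
  refine eq_of_homogeneous (g := fun w => hphase w / (2 * Real.pi)) hpow (fun w k => ?_)
    fun k => key (w ^ k)
  rw [hphase_pow, mul_div_assoc]

theorem maslov_spec : IsHomogeneousMaslov n (maslov n) :=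
  Classical.epsilon_spec (p := IsHomogeneousMaslov n) ⟨_, isHomogeneousMaslov_hphase⟩

theorem maslov_eq : maslov n = fun w => hphase w / (2 * Real.pi) := maslov_spec.eq

/-! ### The positively elliptic region as the region where `ω₀(v, W v) > 0` -/

/-- The matrix of the quadratic form `v ↦ 2 ω₀(v, W v)`. -/
def omegaForm (W : Mat n) : Mat n := (J₀ n)ᵀ * W + Wᵀ * J₀ n

theorem posDef_iff_real {m : Type*} [Fintype m] {A : Matrix m m ℝ} :
    A.PosDef ↔ Aᵀ = A ∧ ∀ x : m → ℝ, x ≠ 0 → 0 < x ⬝ᵥ (A *ᵥ x) := by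
  rw [posDef_iff_dotProduct_mulVec, IsHermitian, conjTranspose_eq_transpose_of_trivial]
  simp

theorem posSemidef_iff_real {m : Type*} [Fintype m] {A : Matrix m m ℝ} :
    A.PosSemidef ↔ Aᵀ = A ∧ ∀ x : m → ℝ, 0 ≤ x ⬝ᵥ (A *ᵥ x) := by
  rw [posSemidef_iff_dotProduct_mulVec, IsHermitian, conjTranspose_eq_transpose_of_trivial]
  simp

theorem omegaForm_transpose (W : Mat n) : (omegaForm W)ᵀ = omegaForm W := by
  simp [omegaForm, add_comm]

theorem dotProduct_transpose_mulVec {m k : Type*} [Fintype m] [Fintype k] (A : Matrix k m ℝ)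
    (x : m → ℝ) (y : k → ℝ) : x ⬝ᵥ (Aᵀ *ᵥ y) = (A *ᵥ x) ⬝ᵥ y := by
  rw [dotProduct_mulVec, vecMul_transpose]

theorem omegaForm_apply (W : Mat n) (x : Fin n ⊕ Fin n → ℝ) :
    x ⬝ᵥ (omegaForm W *ᵥ x) = 2 * (x ⬝ᵥ ((J₀ n)ᵀ *ᵥ (W *ᵥ x))) := by
  rw [omegaForm, add_mulVec, dotProduct_add, ← mulVec_mulVec, ← mulVec_mulVec,
    dotProduct_transpose_mulVec W, dotProduct_comm (W *ᵥ x), dotProduct_transpose_mulVec]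
  ring

theorem continuous_omegaForm : Continuous (omegaForm (n := n)) := by
  unfold omegaForm; fun_prop

theorem J_mul_omegaForm (W : Sp n) :
    J₀ n * omegaForm (W : Mat n) = (W : Mat n) - ((W⁻¹ : Sp n) : Mat n) := by
  rw [omegaForm, coe_inv_eq, Matrix.mul_add, J_transpose', ← Matrix.mul_assoc, ← Matrix.mul_assoc,
    Matrix.mul_neg, J_mul_J]
  simp

theorem transpose_mul_omegaForm_mul (W : Sp n) :
    (W : Mat n)ᵀ * omegaForm (W : Mat n) * (W : Mat n) = omegaForm (W : Mat n) := by
  have h1 : (W : Mat n)ᵀ * J₀ n * W = J₀ n := W.transpose_mul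
  have h2 : (W : Mat n)ᵀ * (J₀ n)ᵀ * W = (J₀ n)ᵀ := by
    rw [J_transpose', Matrix.mul_neg, Matrix.neg_mul, h1]
  calc (W : Mat n)ᵀ * omegaForm (W : Mat n) * (W : Mat n) =
      ((W : Mat n)ᵀ * (J₀ n)ᵀ * W) * W + (W : Mat n)ᵀ * ((W : Mat n)ᵀ * J₀ n * W) := by
        simp only [omegaForm, Matrix.mul_add, Matrix.add_mul, Matrix.mul_assoc]
    _ = _ := by rw [h1, h2]; rfl

/-! ### Complexification and invariant Hermitian forms -/

theorem complexify_mul (A B : Mat n) : complexify (A * B) = complexify A * complexify B :=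
  Matrix.map_mul (f := Complex.ofRealHom)

theorem complexify_add (A B : Mat n) : complexify (A + B) = complexify A + complexify B := by
  ext i j; simp [complexify]

theorem complexify_one : complexify (1 : Mat n) = 1 :=
  Matrix.map_one _ Complex.ofReal_zero Complex.ofReal_one

theorem complexify_transpose (A : Mat n) : complexify Aᵀ = (complexify A)ᴴ := by
  ext i j; simp [complexify]

theorem complexify_neg (A : Mat n) : complexify (-A) = -complexify A := by
  ext i j; simp [complexify]

theorem det_complexify (A : Mat n) : (complexify A).det = (A.det : ℂ) :=
  (RingHom.map_det Complex.ofRealHom A).symm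

theorem complexify_mulVec_star (A : Mat n) (z : Fin n ⊕ Fin n → ℂ) :
    complexify A *ᵥ star z = star (complexify A *ᵥ z) := by
  ext i
  simp [complexify, mulVec, dotProduct, mul_comm]

theorem complexify_posDef {A : Mat n} (hA : A.PosDef) : (complexify A).PosDef := by
  have h1 : CFC.sqrt A * CFC.sqrt A = A := CFC.sqrt_mul_sqrt_self _ hA.posSemidef.nonneg
  have h2 : (CFC.sqrt A)ᵀ = CFC.sqrt A := by
    have := (Matrix.nonneg_iff_posSemidef.1 (CFC.sqrt_nonneg A)).isHermitian.eq
    simpa using this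
  have h3 : complexify A = (complexify (CFC.sqrt A))ᴴ * complexify (CFC.sqrt A) := by
    rw [← complexify_transpose, h2, ← complexify_mul, h1]
  have h4 : (complexify A).PosSemidef := h3 ▸ posSemidef_conjTranspose_mul_self _
  refine h4.posDef_iff_det_ne_zero.2 ?_
  rw [det_complexify]
  exact_mod_cast hA.det_pos.ne'

theorem star_dotProduct_conjTranspose_mulVec {m : Type*} [Fintype m] (M : Matrix m m ℂ)
    (y v : m → ℂ) : star y ⬝ᵥ (Mᴴ *ᵥ v) = star (M *ᵥ y) ⬝ᵥ v := by
  rw [star_mulVec, dotProduct_mulVec]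

theorem form_mulVec_mulVec {m : Type*} [Fintype m] {M H : Matrix m m ℂ} (hM : Mᴴ * H * M = H)
    (x y : m → ℂ) : star (M *ᵥ y) ⬝ᵥ (H *ᵥ (M *ᵥ x)) = star y ⬝ᵥ (H *ᵥ x) := by
  rw [← star_dotProduct_conjTranspose_mulVec, mulVec_mulVec, mulVec_mulVec, hM]

/-- If a matrix preserves a sesquilinear form which is definite on a generalized eigenspace for an
eigenvalue of modulus one, then this generalized eigenspace is an eigenspace. -/
theorem mulVec_eq_of_mem_maxGenEigenspace {m : Type*} [Fintype m] [DecidableEq m]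
    {M H : Matrix m m ℂ} {μ : ℂ} (hM : Mᴴ * H * M = H) (hμ : ‖μ‖ = 1)
    (hdef : ∀ y ∈ Module.End.maxGenEigenspace (toLin' M) μ, y ≠ 0 → star y ⬝ᵥ (H *ᵥ y) ≠ 0)
    {z : m → ℂ} (hz : z ∈ Module.End.maxGenEigenspace (toLin' M) μ) : M *ᵥ z = μ • z := by
  obtain ⟨k, hk⟩ := (Module.End.mem_maxGenEigenspace _ _ _).1 hz
  induction k generalizing z with
  | zero =>
    have : z = 0 := by simpa using hk
    simp [this]
  | succ k ih =>
    set y := M *ᵥ z - μ • z with hy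
    have h1 : ((toLin' M - μ • 1) ^ k) y = 0 := by
      rw [pow_succ, Module.End.mul_apply] at hk
      simpa [hy] using hk
    have hym : y ∈ Module.End.maxGenEigenspace (toLin' M) μ :=
      (Module.End.mem_maxGenEigenspace _ _ _).2 ⟨k, h1⟩
    have h2 := ih hym h1
    have h3 : M *ᵥ z = μ • z + y := by rw [hy]; abel
    have h4 := form_mulVec_mulVec hM z y
    rw [h2, h3, mulVec_add, mulVec_smul, star_smul, smul_dotProduct, dotProduct_add,
      dotProduct_smul] at h4
    have h5 : star μ * μ = 1 := by
      rw [Complex.star_def, ← Complex.normSq_eq_conj_mul_self, Complex.normSq_eq_norm_sq, hμ]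
      simp
    have h6 : star μ * (star y ⬝ᵥ (H *ᵥ y)) = 0 := by
      simp only [smul_eq_mul, mul_add, ← mul_assoc, h5, one_mul] at h4
      linear_combination h4
    have h7 : star μ ≠ 0 := by
      intro h; rw [h, zero_mul] at h5; exact zero_ne_one h5
    -- By induction y is an eigenvector. Invariance of the form on the pair (z, y), together with
    -- |μ| = 1, makes y isotropic, so definiteness forces y = 0: there are no Jordan blocks.
    by_contra hne
    refine hdef y hym (fun h => hne ?_) ((mul_eq_zero.1 h6).resolve_left h7)
    rw [h3, h, add_zero]

theorem hasEigenvalue_of_mem_maxGenEigenspace {V : Type*} [AddCommGroup V] [Module ℂ V]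
    {f : Module.End ℂ V} {μ : ℂ} {z : V} (hz : z ∈ f.maxGenEigenspace μ) (h0 : z ≠ 0) :
    f.HasEigenvalue μ := by
  have h : f.HasUnifEigenvalue μ ⊤ := fun hb => by
    have hz' : z ∈ f.genEigenspace μ ⊤ := hz
    rw [hb] at hz'
    exact h0 (by simpa using hz')
  exact h.lt zero_lt_one

theorem star_mem_maxGenEigenspace {W : Mat n} {μ : ℂ} {z : Fin n ⊕ Fin n → ℂ}
    (hz : z ∈ Module.End.maxGenEigenspace (toLin' (complexify W)) μ) :
    star z ∈ Module.End.maxGenEigenspace (toLin' (complexify W)) (star μ) := by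
  obtain ⟨k, hk⟩ := (Module.End.mem_maxGenEigenspace _ _ _).1 hz
  refine (Module.End.mem_maxGenEigenspace _ _ _).2 ⟨k, ?_⟩
  have : ∀ (k : ℕ) (z : Fin n ⊕ Fin n → ℂ), ((toLin' (complexify W) - star μ • 1) ^ k) (star z) =
      star (((toLin' (complexify W) - μ • 1) ^ k) z) := by
    intro k
    induction k with
    | zero => simp
    | succ k ih =>
      intro z
      rw [pow_succ, pow_succ, Module.End.mul_apply, Module.End.mul_apply, ← ih]
      congr 1
      simp [complexify_mulVec_star]
  rw [this, hk, star_zero]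

theorem krein_eq (z : Fin n ⊕ Fin n → ℂ) :
    krein z z = Complex.I * (star z ⬝ᵥ (complexify (J₀ n)ᵀ *ᵥ z)) := by
  rw [krein, J_transpose', complexify_neg, neg_mulVec, smul_dotProduct, dotProduct_comm,
    dotProduct_neg, smul_eq_mul]
  ring

theorem krein_star (z : Fin n ⊕ Fin n → ℂ) : krein (star z) (star z) = -star (krein z z) := by
  rw [krein, krein, complexify_mulVec_star, star_star, smul_dotProduct, smul_dotProduct,
    star_dotProduct, dotProduct_comm (star z)]
  simp

theorem omegaForm_eigenvectors {W : Mat n} {μ ν : ℂ} {x y : Fin n ⊕ Fin n → ℂ}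
    (hx : complexify W *ᵥ x = μ • x) (hy : complexify W *ᵥ y = ν • y) :
    star y ⬝ᵥ (complexify (omegaForm W) *ᵥ x) =
      (μ - star ν) * (star y ⬝ᵥ (complexify (J₀ n)ᵀ *ᵥ x)) := by
  rw [omegaForm, complexify_add, complexify_mul, complexify_mul, complexify_transpose W, add_mulVec,
    dotProduct_add, ← mulVec_mulVec, ← mulVec_mulVec, star_dotProduct_conjTranspose_mulVec, hx, hy,
    J_transpose', complexify_neg, mulVec_smul, dotProduct_smul, star_smul, smul_dotProduct,
    neg_mulVec, dotProduct_neg, smul_eq_mul, smul_eq_mul]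
  ring

/-- The link between the two descriptions of ellipticity: on an eigenvector the form is the Krein
form multiplied by twice the imaginary part of the eigenvalue. -/
theorem omegaForm_eigenvector {W : Mat n} {μ : ℂ} {x : Fin n ⊕ Fin n → ℂ}
    (hx : complexify W *ᵥ x = μ • x) :
    star x ⬝ᵥ (complexify (omegaForm W) *ᵥ x) = (2 * μ.im : ℝ) * krein x x := by
  rw [omegaForm_eigenvectors hx hx, krein_eq, Complex.star_def, Complex.sub_conj]
  push_cast
  ring

theorem preserves_omegaForm (W : Sp n) : (complexify (W : Mat n))ᴴ *
    complexify (omegaForm (W : Mat n)) * complexify (W : Mat n) =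
      complexify (omegaForm (W : Mat n)) := by
  rw [← complexify_transpose, ← complexify_mul, ← complexify_mul, transpose_mul_omegaForm_mul]

theorem preserves_J (W : Sp n) : (complexify (W : Mat n))ᴴ *
    complexify (J₀ n)ᵀ * complexify (W : Mat n) = complexify (J₀ n)ᵀ := by
  rw [← complexify_transpose, ← complexify_mul, ← complexify_mul, J_transpose', Matrix.mul_neg,
    Matrix.neg_mul, W.transpose_mul]

/-- Krein positivity is only assumed in the upper half plane. Complex conjugation exchanges the
eigenspaces of μ and its conjugate and reverses the sign of the Krein form, so the product with Im μ
is positive in both cases. -/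
theorem mulVec_eq_of_mem_SpEll {W : Sp n} (hW : W ∈ SpEll n) {μ : ℂ} {z : Fin n ⊕ Fin n → ℂ}
    (hz : z ∈ Module.End.maxGenEigenspace (toLin' (complexify (W : Mat n))) μ) (h0 : z ≠ 0) :
    complexify (W : Mat n) *ᵥ z = μ • z ∧ ‖μ‖ = 1 ∧ 0 < μ.im * (krein z z).re := by
  obtain ⟨h1, h2, h3, h4⟩ := hW μ (hasEigenvalue_of_mem_maxGenEigenspace hz h0)
  have him : μ.im ≠ 0 := by
    intro h
    have h5 : μ.re * μ.re = 1 := by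
      have := Complex.normSq_eq_norm_sq μ
      rw [Complex.normSq_apply, h, h1] at this
      linarith
    rcases mul_self_eq_one_iff.1 h5 with h6 | h6
    · exact h2 (Complex.ext h6 h)
    · exact h3 (Complex.ext (by simpa using h6) (by simpa using h))
  have hpos : ∀ y ∈ Module.End.maxGenEigenspace (toLin' (complexify (W : Mat n))) μ, y ≠ 0 →
      0 < μ.im * (krein y y).re := by
    intro y hy hy0
    rcases him.lt_or_gt with h | h
    · have hy' := star_mem_maxGenEigenspace hy
      have hy0' : star y ≠ 0 := by simpa using hy0
      obtain ⟨-, -, -, h5⟩ := hW _ (hasEigenvalue_of_mem_maxGenEigenspace hy' hy0')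
      have h6 := h5 (by simpa using h) _ hy' hy0'
      rw [krein_star] at h6
      have h7 : (krein y y).re < 0 := by simpa using h6
      exact mul_pos_of_neg_of_neg h h7
    · exact mul_pos h (h4 h y hy hy0)
  refine ⟨mulVec_eq_of_mem_maxGenEigenspace (preserves_J W) h1 (fun y hy hy0 h => ?_) hz, h1,
    hpos z hz h0⟩
  have := hpos y hy hy0
  rw [krein_eq, h] at this
  simp at this

/-- The vector is decomposed into generalized eigenvectors, which are genuine eigenvectors. Since W
preserves the form, eigenvectors for different unit eigenvalues are orthogonal, and the diagonal
terms are positive by Krein positivity. -/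
theorem omegaForm_posDef_of_mem_SpEll {W : Sp n} (hW : W ∈ SpEll n) :
    (omegaForm (W : Mat n)).PosDef := by
  refine posDef_iff_real.2 ⟨omegaForm_transpose _, fun x hx => ?_⟩
  let f : Module.End ℂ (Fin n ⊕ Fin n → ℂ) := toLin' (complexify (W : Mat n))
  let z : Fin n ⊕ Fin n → ℂ := fun i => (x i : ℂ)
  have hz : z ∈ ⨆ μ, f.maxGenEigenspace μ := by
    rw [Module.End.iSup_maxGenEigenspace_eq_top]; trivial
  obtain ⟨g, hg, hgz⟩ := (Submodule.mem_iSup_iff_exists_finsupp _ _).1 hz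
  have hz0 : z ≠ 0 := by
    intro h
    apply hx
    ext i
    simpa [z] using congrFun h i
  have key : star z ⬝ᵥ (complexify (omegaForm (W : Mat n)) *ᵥ z) =
      ((x ⬝ᵥ (omegaForm (W : Mat n) *ᵥ x) : ℝ) : ℂ) := by
    simp [z, dotProduct, mulVec, complexify]
  have hoff : ∀ μ ∈ g.support, ∀ ν ∈ g.support, μ ≠ ν →
      star (g ν) ⬝ᵥ (complexify (omegaForm (W : Mat n)) *ᵥ g μ) = 0 := by
    intro μ hμ ν hν hne
    obtain ⟨h1, h2, -⟩ := mulVec_eq_of_mem_SpEll hW (hg μ) (Finsupp.mem_support_iff.1 hμ)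
    obtain ⟨h3, h4, -⟩ := mulVec_eq_of_mem_SpEll hW (hg ν) (Finsupp.mem_support_iff.1 hν)
    have h5 := form_mulVec_mulVec (preserves_omegaForm W) (g μ) (g ν)
    rw [h1, h3, mulVec_smul, dotProduct_smul, star_smul, smul_dotProduct, smul_eq_mul, smul_eq_mul,
      ← mul_assoc] at h5
    have h6 : μ * star ν ≠ 1 := by
      intro h
      apply hne
      have h7 : star ν * ν = 1 := by
        rw [Complex.star_def, ← Complex.normSq_eq_conj_mul_self, Complex.normSq_eq_norm_sq, h4]
        simp
      calc μ = μ * (star ν * ν) := by rw [h7, mul_one]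
        _ = ν := by rw [← mul_assoc, h, one_mul]
    have h8 : (μ * star ν - 1) * (star (g ν) ⬝ᵥ (complexify (omegaForm (W : Mat n)) *ᵥ g μ)) = 0 := by
      linear_combination h5
    exact (mul_eq_zero.1 h8).resolve_left (sub_ne_zero.2 h6)
  have hsum : star z ⬝ᵥ (complexify (omegaForm (W : Mat n)) *ᵥ z) =
      ∑ μ ∈ g.support, star (g μ) ⬝ᵥ (complexify (omegaForm (W : Mat n)) *ᵥ g μ) := by
    rw [← hgz, Finsupp.sum, star_sum, mulVec_sum, sum_dotProduct]
    refine Finset.sum_congr rfl fun ν hν => ?_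
    rw [dotProduct_sum, Finset.sum_eq_single ν]
    · intro μ hμ hne
      exact hoff μ hμ ν hν hne
    · intro h; exact absurd hν h
  have hne : g.support.Nonempty := by
    rw [Finset.nonempty_iff_ne_empty]
    intro h
    rw [Finsupp.support_eq_empty.1 h] at hgz
    exact hz0 (by simpa using hgz.symm)
  have hre := congrArg Complex.re (key.symm.trans hsum)
  rw [Complex.ofReal_re, Complex.re_sum] at hre
  rw [hre]
  refine Finset.sum_pos (fun μ hμ => ?_) hne
  obtain ⟨h1, -, h2⟩ := mulVec_eq_of_mem_SpEll hW (hg μ) (Finsupp.mem_support_iff.1 hμ)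
  rw [omegaForm_eigenvector h1, Complex.re_ofReal_mul]
  linarith

/-- W is an isometry of the positive definite form ω₀(v, Wv), so its eigenvalues have modulus one
and are semisimple. On an eigenvector the form is 2 (Im μ) κ, which excludes ±1 and fixes the sign
of κ. -/
theorem mem_SpEll_of_posDef {W : Sp n} (hW : (omegaForm (W : Mat n)).PosDef) : W ∈ SpEll n := by
  intro μ hμ
  have hQ := complexify_posDef hW
  obtain ⟨z, hz⟩ := hμ.exists_hasEigenvector
  have hz1 : complexify (W : Mat n) *ᵥ z = μ • z := by simpa using hz.apply_eq_smul
  have hpos := hQ.dotProduct_mulVec_pos hz.2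
  have h1 : ‖μ‖ = 1 := by
    have h2 := form_mulVec_mulVec (preserves_omegaForm W) z z
    rw [hz1, mulVec_smul, dotProduct_smul, star_smul, smul_dotProduct, smul_eq_mul, smul_eq_mul,
      ← mul_assoc] at h2
    have h3 := mul_right_cancel₀ hpos.ne' (h2.trans (one_mul _).symm)
    rw [Complex.star_def, Complex.mul_conj, Complex.normSq_eq_norm_sq] at h3
    have h4 : ‖μ‖ ^ 2 = 1 := by exact_mod_cast h3
    nlinarith [norm_nonneg μ]
  have hk : ∀ y : Fin n ⊕ Fin n → ℂ, y ≠ 0 → complexify (W : Mat n) *ᵥ y = μ • y →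
      0 < 2 * μ.im * (krein y y).re := by
    intro y hy hy1
    have := (Complex.pos_iff.1 (hQ.dotProduct_mulVec_pos hy)).1
    rwa [omegaForm_eigenvector hy1, Complex.re_ofReal_mul] at this
  have him : μ.im ≠ 0 := by
    intro h
    have := hk z hz.2 hz1
    rw [h] at this
    simp at this
  refine ⟨h1, fun h => him (by simp [h]), fun h => him (by simp [h]), fun hp y hy hy0 => ?_⟩
  have hy1 := mulVec_eq_of_mem_maxGenEigenspace (preserves_omegaForm W) h1
    (fun y _ hy0 => (hQ.dotProduct_mulVec_pos hy0).ne') hy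
  have := hk y hy0 hy1
  exact pos_of_mul_pos_right this (by positivity)

theorem mem_SpEll_iff {W : Sp n} : W ∈ SpEll n ↔ (omegaForm (W : Mat n)).PosDef :=
  ⟨omegaForm_posDef_of_mem_SpEll, mem_SpEll_of_posDef⟩

/-! ### The positively elliptic region of the universal cover -/

theorem dotProduct_J_self (x : Fin n ⊕ Fin n → ℝ) : x ⬝ᵥ ((J₀ n)ᵀ *ᵥ x) = 0 := by
  have h := dotProduct_transpose_mulVec (J₀ n) x x
  rw [dotProduct_comm] at h
  have h2 : x ⬝ᵥ (J₀ n *ᵥ x) = -(x ⬝ᵥ ((J₀ n)ᵀ *ᵥ x)) := by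
    rw [J_transpose', neg_mulVec, dotProduct_neg, neg_neg]
  rw [dotProduct_comm, dotProduct_comm (J₀ n *ᵥ x), h2] at h
  linarith

/-- A vector killed by the denominator would be an eigenvector with negative real eigenvalue, hence
would satisfy ω₀(v, Wv) = 0. At s = 1 the denominator is a multiple of the identity. -/
theorem SpEll_subset_sclDom : SpEll n ⊆ SclDom n := by
  intro W hW s hs hdet
  have hQ := mem_SpEll_iff.1 hW
  obtain ⟨v, hv, h⟩ := exists_mulVec_eq_zero_iff.2 hdet
  have h1 : (1 - s) • ((W : Mat n) *ᵥ v) + (1 + s) • v = 0 := by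
    simpa [sclDen, add_mulVec, smul_mulVec] using h
  have h2 := congrArg (fun x => v ⬝ᵥ ((J₀ n)ᵀ *ᵥ x)) h1
  simp only [mulVec_add, mulVec_smul, dotProduct_add, dotProduct_smul, dotProduct_J_self,
    smul_eq_mul, mul_zero, add_zero, mulVec_zero, dotProduct_zero] at h2
  have h3 := (posDef_iff_real.1 hQ).2 v hv
  rw [omegaForm_apply] at h3
  rcases mul_eq_zero.1 h2 with h4 | h4
  · have : s = 1 := by linarith
    subst this
    rw [sub_self, zero_smul, zero_add] at h1
    exact hv ((smul_eq_zero.1 h1).resolve_left (by norm_num))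
  · linarith

theorem sclDen_transpose_mul_omegaForm (s : ℝ) (W : Sp n) :
    (sclDen s (W : Mat n))ᵀ * (J₀ n)ᵀ * sclNum s (W : Mat n) +
      (sclNum s (W : Mat n))ᵀ * J₀ n * sclDen s (W : Mat n) =
        (4 * s) • omegaForm (W : Mat n) := by
  have h1 : (W : Mat n)ᵀ * (J₀ n * W) = J₀ n := by rw [← Matrix.mul_assoc]; exact W.transpose_mul
  simp only [sclDen, sclNum, omegaForm, transpose_add, transpose_smul, transpose_one,
    Matrix.add_mul, Matrix.mul_add, Matrix.smul_mul, Matrix.mul_smul, Matrix.one_mul,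
    Matrix.mul_one, J_transpose', Matrix.mul_neg, Matrix.neg_mul, Matrix.mul_assoc, h1]
  module

/-- Congruence by the denominator turns the form of the scaled matrix into 4s times the form of W.
-/
theorem sclSp_mem_SpEll {s : ℝ} (hs : 0 < s) {W : Sp n} (hW : W ∈ SpEll n)
    (hd : (sclDen s (W : Mat n)).det ≠ 0) : sclSp s W ∈ SpEll n := by
  rw [mem_SpEll_iff] at hW ⊢
  have hu : IsUnit (sclDen s (W : Mat n)) := (Matrix.isUnit_iff_isUnit_det _).2 hd.isUnit
  rw [← Matrix.IsUnit.posDef_star_left_conjugate_iff hu]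
  have h1 : (sclSp s W : Mat n) * sclDen s (W : Mat n) = sclNum s (W : Mat n) := by
    rw [coe_sclSp hd, scl, Matrix.mul_assoc, nonsing_inv_mul _ hd.isUnit, Matrix.mul_one]
  have h2 : star (sclDen s (W : Mat n)) * omegaForm (sclSp s W : Mat n) * sclDen s (W : Mat n) =
      (4 * s) • omegaForm (W : Mat n) := by
    rw [← sclDen_transpose_mul_omegaForm, ← h1, star_eq_conjTranspose,
      conjTranspose_eq_transpose_of_trivial, omegaForm]
    simp only [Matrix.mul_add, Matrix.add_mul, Matrix.transpose_mul, Matrix.mul_assoc]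
  rw [h2]
  exact hW.smul (by positivity)

theorem princ_mem_SpTildeEll {W : Sp n} (hW : W ∈ SpEll n) : princ W ∈ SpTildeEll n := by
  have hd := SpEll_subset_sclDom hW
  refine ⟨⟨⟨fun t => sclSp t W, continuous_sclSp continuous_subtype_val continuous_const
    fun t => hd t t.2⟩, ?_⟩, fun t ht => ?_, ?_⟩
  · change sclSp ((0 : I) : ℝ) W = 1
    simpa using sclSp_zero hd
  · exact sclSp_mem_SpEll (by exact_mod_cast ht) hW (hd t t.2)
  · rw [princ_eq hd]
    rfl

/-- An admissible path stays in `SclDom`, including at its starting point 1, so its class only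
depends on its end-point. -/
theorem mem_SpTildeEll_iff {w : SpTilde n} : w ∈ SpTildeEll n ↔ ∃ W ∈ SpEll n, princ W = w := by
  constructor
  · rintro ⟨γ, h, rfl⟩
    refine ⟨(γ : C(I, Sp n)) 1, h 1 one_pos, ?_⟩
    refine (pathClass_eq_princ (γ : C(I, Sp n)) (γ : C(I, Sp n)).continuous γ.2 fun t => ?_).symm
    rcases eq_or_lt_of_le t.2.1 with h0 | h0
    · have : t = 0 := Subtype.ext h0.symm
      rw [this, γ.2]
      exact one_mem_sclDom
    · exact SpEll_subset_sclDom (h t h0)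
  · rintro ⟨W, hW, rfl⟩
    exact princ_mem_SpTildeEll hW

theorem proj_princ_of_mem_SpEll {W : Sp n} (hW : W ∈ SpEll n) : (princ W).proj = W :=
  proj_princ (SpEll_subset_sclDom hW)

/-! ### The curve of Cayley scalings -/

theorem hasDerivWithinAt_inv_mat {D : ℝ → Mat n} {D' : Mat n} {s : Set ℝ} {t : ℝ}
    (h : HasDerivWithinAt D D' s t) (hd : (D t).det ≠ 0) :
    HasDerivWithinAt (fun x => (D x)⁻¹) (-((D t)⁻¹ * D' * (D t)⁻¹)) s t := by
  have hu : IsUnit (D t) := (Matrix.isUnit_iff_isUnit_det _).2 hd.isUnit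
  obtain ⟨u, hu⟩ := hu
  have h1 := hasFDerivAt_ringInverse (𝕜 := ℝ) u
  rw [hu] at h1
  have h2 := h1.comp_hasDerivWithinAt t h
  have h3 : ((u⁻¹ : (Mat n)ˣ) : Mat n) = (D t)⁻¹ := by
    rw [← hu, Matrix.coe_units_inv]
  simp only [Matrix.nonsing_inv_eq_ringInverse] at h3 ⊢
  refine HasDerivWithinAt.congr_deriv h2 ?_
  simp [h3]

theorem HasVel.of_hasDerivWithinAt {c : ℝ → SpTilde n} {s : Set ℝ} {Z : ℝ → Mat n}
    (hc : ContinuousOn c s) (h : ∀ t ∈ s, HasDerivWithinAt (projCurve c) (Z t) s t) :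
    HasVel c s fun t => Z t * (((c t).proj⁻¹ : Sp n) : Mat n) := by
  refine ⟨hc, fun t ht => ?_⟩
  have := h t ht
  rw [Matrix.mul_assoc, projCurve, Sp.inv_mul_coe, Matrix.mul_one]
  exact this

/-- The curve of Cayley scalings of a positively elliptic element is timelike. -/
theorem hasVel_princ_sclSp {W : Sp n} (hW : W ∈ SpEll n) :
    ∃ X : ℝ → Mat n, ContinuousOn X (Icc 0 1) ∧
      HasVel (fun s => princ (sclSp s W)) (Icc 0 1) X ∧
      ∀ s ∈ Icc (0 : ℝ) 1, (form (X s)).PosDef := by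
  have hD := SpEll_subset_sclDom hW
  have hm : ∀ s ∈ Icc (0 : ℝ) 1, sclSp s W ∈ SclDom n := fun s hs => sclSp_mem_sclDom hs hD
  have hcs : ContinuousOn (fun s => sclSp s W) (Icc 0 1) := by
    rw [continuousOn_iff_continuous_domRestrict]
    exact continuous_sclSp continuous_subtype_val continuous_const fun s => hD s s.2
  have hc : ContinuousOn (fun s => princ (sclSp s W)) (Icc 0 1) :=
    continuousOn_princ.comp hcs hm
  have hproj : ∀ s ∈ Icc (0 : ℝ) 1, (princ (sclSp s W)).proj = sclSp s W :=
    fun s hs => proj_princ (hm s hs)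
  -- The derivative of numerator times inverse denominator; the two s-derivatives are W - 1 and its
  -- opposite.
  let Z : ℝ → Mat n := fun s => ((W : Mat n) - 1) * (sclDen s (W : Mat n))⁻¹ +
    (sclSp s W : Mat n) * (((W : Mat n) - 1) * (sclDen s (W : Mat n))⁻¹)
  have hden : ∀ t, HasDerivAt (fun s => sclDen s (W : Mat n)) (1 - (W : Mat n)) t := by
    intro t
    unfold sclDen
    refine ((((hasDerivAt_id t).const_sub 1).smul_const (W : Mat n)).add
      (((hasDerivAt_id t).const_add 1).smul_const (1 : Mat n))).congr_deriv ?_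
    module
  have hnum : ∀ t, HasDerivAt (fun s => sclNum s (W : Mat n)) ((W : Mat n) - 1) t := by
    intro t
    unfold sclNum
    refine ((((hasDerivAt_id t).const_add 1).smul_const (W : Mat n)).add
      (((hasDerivAt_id t).const_sub 1).smul_const (1 : Mat n))).congr_deriv ?_
    module
  have hZ : ∀ t ∈ Icc (0 : ℝ) 1,
      HasDerivWithinAt (projCurve fun s => princ (sclSp s W)) (Z t) (Icc 0 1) t := by
    intro t ht
    have h1 := (hnum t).hasDerivWithinAt (s := Icc 0 1) |>.mul
      (hasDerivWithinAt_inv_mat ((hden t).hasDerivWithinAt (s := Icc 0 1)) (hD t ht))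
    have h2 : ∀ s ∈ Icc (0 : ℝ) 1, projCurve (fun s => princ (sclSp s W)) s =
        ((fun s => sclNum s (W : Mat n)) * fun s => (sclDen s (W : Mat n))⁻¹) s := by
      intro s hs
      rw [projCurve, hproj s hs, coe_sclSp (hD s hs), scl]
      rfl
    refine (h1.congr h2 (h2 t ht)).congr_deriv ?_
    simp only [Z, coe_sclSp (hD t ht), scl]
    have h3 : (1 : Mat n) - (W : Mat n) = -((W : Mat n) - 1) := by abel
    rw [h3]
    simp only [Matrix.mul_neg, Matrix.neg_mul, neg_neg, Matrix.mul_assoc]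
  have hdc : ContinuousOn (fun s => (sclDen s (W : Mat n))⁻¹) (Icc 0 1) := fun s hs =>
    (hasDerivWithinAt_inv_mat ((hden s).hasDerivWithinAt (s := Icc 0 1)) (hD s hs)).continuousWithinAt
  have hcm : ContinuousOn (fun s => (sclSp s W : Mat n)) (Icc 0 1) :=
    continuous_subtype_val.comp_continuousOn hcs
  have hci : ContinuousOn (fun s => (((princ (sclSp s W)).proj⁻¹ : Sp n) : Mat n)) (Icc 0 1) :=
    continuous_subtype_val.comp_continuousOn
      (continuous_inv.comp_continuousOn (SpTilde.continuous_proj.comp_continuousOn hc))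
  refine ⟨_, ?_, HasVel.of_hasDerivWithinAt hc hZ, fun s hs => ?_⟩
  · refine ContinuousOn.mul ?_ hci
    exact (continuousOn_const.mul hdc).add (hcm.mul (continuousOn_const.mul hdc))
  -- Congruence by the numerator, written as `sclSp s W * sclDen s W`, reduces the form of the
  -- velocity to twice `omegaForm W`.
  · have hu : IsUnit ((sclSp s W : Mat n) * sclDen s (W : Mat n)) := by
      rw [Matrix.isUnit_iff_isUnit_det, det_mul, Sp.det_eq_one, one_mul]
      exact (hD s hs).isUnit
    rw [← Matrix.IsUnit.posDef_star_left_conjugate_iff hu, hproj s hs]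
    have h1 : (sclSp s W : Mat n) * sclDen s (W : Mat n) = sclNum s (W : Mat n) := by
      rw [coe_sclSp (hD s hs), scl, Matrix.mul_assoc, nonsing_inv_mul _ (hD s hs).isUnit,
        Matrix.mul_one]
    have h2 : Z s * (((sclSp s W)⁻¹ : Sp n) : Mat n) *
        ((sclSp s W : Mat n) * sclDen s (W : Mat n)) =
          ((W : Mat n) - 1) + (sclSp s W : Mat n) * ((W : Mat n) - 1) := by
      rw [Matrix.mul_assoc, ← Matrix.mul_assoc _ (sclSp s W : Mat n), Sp.inv_mul_coe,
        Matrix.one_mul]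
      simp only [Z, Matrix.add_mul, Matrix.mul_assoc, nonsing_inv_mul _ (hD s hs).isUnit,
        Matrix.mul_one]
    have h3 : (sclNum s (W : Mat n))ᵀ * (J₀ n)ᵀ * (sclSp s W : Mat n) =
        (sclDen s (W : Mat n))ᵀ * (J₀ n)ᵀ := by
      rw [← h1, Matrix.transpose_mul, J_transpose', Matrix.mul_neg, Matrix.neg_mul,
        Matrix.mul_assoc, Matrix.mul_assoc, ← Matrix.mul_assoc _ (J₀ n), Sp.transpose_mul,
        Matrix.mul_neg]
    have h4 : (sclNum s (W : Mat n))ᵀ + (sclDen s (W : Mat n))ᵀ =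
        (2 : ℝ) • ((W : Mat n) + 1)ᵀ := by
      simp only [sclNum, sclDen, transpose_add, transpose_smul, transpose_one]
      module
    have h5 : ((W : Mat n) + 1)ᵀ * (J₀ n)ᵀ * ((W : Mat n) - 1) = omegaForm (W : Mat n) := by
      have h6 : (W : Mat n)ᵀ * (J₀ n * W) = J₀ n := by
        rw [← Matrix.mul_assoc]; exact W.transpose_mul
      simp only [omegaForm, transpose_add, transpose_one, Matrix.add_mul, Matrix.mul_sub,
        Matrix.one_mul, Matrix.mul_one, J_transpose', Matrix.mul_neg, Matrix.neg_mul,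
        Matrix.mul_assoc, h6]
      abel
    have h7 : star ((sclSp s W : Mat n) * sclDen s (W : Mat n)) *
        form (Z s * (((sclSp s W)⁻¹ : Sp n) : Mat n)) *
          ((sclSp s W : Mat n) * sclDen s (W : Mat n)) = (2 : ℝ) • omegaForm (W : Mat n) := by
      rw [form, Matrix.mul_assoc, Matrix.mul_assoc _ _ ((sclSp s W : Mat n) * _), h2, h1,
        star_eq_conjTranspose, conjTranspose_eq_transpose_of_trivial, ← Matrix.mul_assoc,
        Matrix.mul_add, ← Matrix.mul_assoc _ (sclSp s W : Mat n), h3, ← Matrix.add_mul,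
        ← Matrix.add_mul, h4, Matrix.smul_mul, Matrix.smul_mul, h5]
    rw [h7]
    exact (mem_SpEll_iff.1 hW).smul (by positivity)

theorem one_le_princ {W : Sp n} (hW : W ∈ SpEll n) : le 1 (princ W) := by
  obtain ⟨X, -, hX, hp⟩ := hasVel_princ_sclSp hW
  have h := hX.le zero_le_one fun t ht => (hp t ht).posSemidef
  rwa [sclSp_one, sclSp_zero (SpEll_subset_sclDom hW), princ_one] at h

/-! ### The Cayley chart -/

/-- The denominator of the Cayley chart. -/
def cayDen (A : Mat n) : Mat n := 1 - J₀ n * A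

/-- The numerator of the Cayley chart. -/
def cayNum (A : Mat n) : Mat n := 1 + J₀ n * A

theorem det_cayDen {A : Mat n} (hA : A.PosDef) : (cayDen A).det ≠ 0 := by
  intro h
  obtain ⟨v, hv, h⟩ := exists_mulVec_eq_zero_iff.2 h
  have h1 : v = J₀ n *ᵥ (A *ᵥ v) := by
    rw [cayDen, sub_mulVec, one_mulVec, ← mulVec_mulVec] at h
    exact sub_eq_zero.1 h
  have h2 := (posDef_iff_real.1 hA).2 v hv
  have h3 := dotProduct_J_self (A *ᵥ v)
  rw [dotProduct_transpose_mulVec, ← h1] at h3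
  exact h2.ne' h3

theorem cayNum_mul_J {A : Mat n} (hA : Aᵀ = A) :
    (cayNum A)ᵀ * J₀ n * cayNum A = (cayDen A)ᵀ * J₀ n * cayDen A := by
  have h : ∀ B : Mat n, J₀ n * (J₀ n * B) = -B := fun B => by
    rw [← Matrix.mul_assoc, J_mul_J, Matrix.neg_mul, Matrix.one_mul]
  simp only [cayNum, cayDen, transpose_add, transpose_sub, transpose_one, Matrix.transpose_mul, hA,
    J_transpose', Matrix.mul_neg, Matrix.neg_mul, Matrix.add_mul, Matrix.sub_mul, Matrix.mul_add,
    Matrix.mul_sub, Matrix.one_mul, Matrix.mul_one, Matrix.mul_assoc, J_mul_J, h]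
  abel

open Classical in
/-- The Cayley chart. -/
def caySp (A : Mat n) : Sp n :=
  if h : cayNum A * (cayDen A)⁻¹ ∈ symplecticGroup (Fin n) ℝ then ⟨_, h⟩ else 1

theorem coe_caySp {A : Mat n} (hA : A.PosDef) :
    (caySp A : Mat n) = cayNum A * (cayDen A)⁻¹ := by
  have : cayNum A * (cayDen A)⁻¹ ∈ symplecticGroup (Fin n) ℝ :=
    mem_sp_of_num_den (det_cayDen hA) (cayNum_mul_J (posDef_iff_real.1 hA).1)
  simp [caySp, this]

theorem caySp_mul_cayDen {A : Mat n} (hA : A.PosDef) : (caySp A : Mat n) * cayDen A = cayNum A := by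
  rw [coe_caySp hA, Matrix.mul_assoc, nonsing_inv_mul _ (det_cayDen hA).isUnit, Matrix.mul_one]

theorem caySp_mem_SpEll {A : Mat n} (hA : A.PosDef) : caySp A ∈ SpEll n := by
  rw [mem_SpEll_iff]
  have hu : IsUnit (cayDen A) := (Matrix.isUnit_iff_isUnit_det _).2 (det_cayDen hA).isUnit
  rw [← Matrix.IsUnit.posDef_star_left_conjugate_iff hu]
  have hs := (posDef_iff_real.1 hA).1
  have h : ∀ B : Mat n, J₀ n * (J₀ n * B) = -B := fun B => by
    rw [← Matrix.mul_assoc, J_mul_J, Matrix.neg_mul, Matrix.one_mul]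
  have h1 : star (cayDen A) * omegaForm (caySp A : Mat n) * cayDen A =
      (cayDen A)ᵀ * (J₀ n)ᵀ * cayNum A + (cayNum A)ᵀ * J₀ n * cayDen A := by
    rw [← caySp_mul_cayDen hA, star_eq_conjTranspose, conjTranspose_eq_transpose_of_trivial,
      omegaForm]
    simp only [Matrix.mul_add, Matrix.add_mul, Matrix.transpose_mul, Matrix.mul_assoc]
  have h2 : star (cayDen A) * omegaForm (caySp A : Mat n) * cayDen A = (4 : ℝ) • A := by
    rw [h1]
    simp only [cayNum, cayDen, transpose_add, transpose_sub, transpose_one, Matrix.transpose_mul,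
      hs, J_transpose', Matrix.mul_neg, Matrix.neg_mul, Matrix.add_mul, Matrix.sub_mul,
      Matrix.mul_add, Matrix.mul_sub, Matrix.one_mul, Matrix.mul_one, Matrix.mul_assoc, J_mul_J, h]
    module
  rw [h2]
  exact hA.smul (by positivity)

theorem caySp_one : caySp (1 : Mat n) = Jsp n := by
  apply Subtype.ext
  have h := caySp_mul_cayDen (n := n) Matrix.PosDef.one
  have h2 : (Jsp n : Mat n) * cayDen 1 = cayNum 1 := by
    simp [cayDen, cayNum, coe_Jsp, Matrix.mul_sub, J_mul_J, add_comm]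
  have hu := (det_cayDen (n := n) Matrix.PosDef.one).isUnit
  calc (caySp (1 : Mat n) : Mat n) = cayNum 1 * (cayDen 1)⁻¹ := coe_caySp Matrix.PosDef.one
    _ = Jsp n := by rw [← h2, Matrix.mul_assoc, mul_nonsing_inv _ hu, Matrix.mul_one]

theorem continuous_caySp {X : Type*} [TopologicalSpace X] {A : X → Mat n} (hA : Continuous A)
    (h : ∀ x, (A x).PosDef) : Continuous fun x => caySp (A x) := by
  refine Topology.IsInducing.subtypeVal.continuous_iff.2 ?_
  have : (Subtype.val ∘ fun x => caySp (A x)) = fun x => cayNum (A x) * (cayDen (A x))⁻¹ := by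
    ext1 x
    exact coe_caySp (h x)
  refine this ▸ ?_
  have h1 : Continuous fun x => cayDen (A x) := by unfold cayDen; fun_prop
  have h2 : Continuous fun x => cayNum (A x) := by unfold cayNum; fun_prop
  refine h2.mul (continuous_iff_continuousAt.2 fun x => ?_)
  exact ContinuousAt.comp (f := fun x => cayDen (A x)) (continuousAt_inv_mat (det_cayDen (h x)))
    h1.continuousAt

theorem add_one_transpose_mul_J_mul_sub_one (W : Sp n) :
    ((W : Mat n) + 1)ᵀ * (J₀ n)ᵀ * ((W : Mat n) - 1) = omegaForm (W : Mat n) := by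
  have h6 : (W : Mat n)ᵀ * (J₀ n * W) = J₀ n := by
    rw [← Matrix.mul_assoc]; exact W.transpose_mul
  simp only [omegaForm, transpose_add, transpose_one, Matrix.add_mul, Matrix.mul_sub,
    Matrix.one_mul, Matrix.mul_one, J_transpose', Matrix.mul_neg, Matrix.neg_mul,
    Matrix.mul_assoc, h6]
  abel

theorem det_add_one_ne_zero {W : Sp n} (hW : W ∈ SpEll n) : ((W : Mat n) + 1).det ≠ 0 := by
  have h := SpEll_subset_sclDom hW 0 (by simp)
  simpa [sclDen] using h

/-- The inverse of the Cayley chart. -/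
def cayForm (W : Mat n) : Mat n := (J₀ n)ᵀ * ((W - 1) * (W + 1)⁻¹)

theorem omegaForm_eq_cayForm {W : Sp n} (h : ((W : Mat n) + 1).det ≠ 0) :
    ((W : Mat n) + 1)ᵀ * cayForm (W : Mat n) * ((W : Mat n) + 1) = omegaForm (W : Mat n) := by
  rw [← add_one_transpose_mul_J_mul_sub_one, cayForm]
  simp only [Matrix.mul_assoc, nonsing_inv_mul _ h.isUnit, Matrix.mul_one]

theorem cayForm_posDef_iff {W : Sp n} (h : ((W : Mat n) + 1).det ≠ 0) :
    (cayForm (W : Mat n)).PosDef ↔ W ∈ SpEll n := by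
  have hu : IsUnit ((W : Mat n) + 1) := (Matrix.isUnit_iff_isUnit_det _).2 h.isUnit
  rw [mem_SpEll_iff, ← omegaForm_eq_cayForm h, ← conjTranspose_eq_transpose_of_trivial,
    ← star_eq_conjTranspose, Matrix.IsUnit.posDef_star_left_conjugate_iff hu]

theorem caySp_cayForm {W : Sp n} (hW : W ∈ SpEll n) : caySp (cayForm (W : Mat n)) = W := by
  have hd := det_add_one_ne_zero hW
  have hA := (cayForm_posDef_iff hd).2 hW
  have hJ : J₀ n * cayForm (W : Mat n) = ((W : Mat n) - 1) * ((W : Mat n) + 1)⁻¹ := by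
    rw [cayForm, ← Matrix.mul_assoc, J_transpose', Matrix.mul_neg, J_mul_J, neg_neg, Matrix.one_mul]
  have hi := mul_nonsing_inv _ hd.isUnit
  have h1 : cayDen (cayForm (W : Mat n)) = (2 : ℝ) • ((W : Mat n) + 1)⁻¹ := by
    have : (W : Mat n) + 1 - ((W : Mat n) - 1) = (2 : ℝ) • (1 : Mat n) := by module
    calc cayDen (cayForm (W : Mat n)) = ((W : Mat n) + 1) * ((W : Mat n) + 1)⁻¹ -
          ((W : Mat n) - 1) * ((W : Mat n) + 1)⁻¹ := by rw [hi, cayDen, hJ]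
      _ = _ := by rw [← Matrix.sub_mul, this, Matrix.smul_mul, Matrix.one_mul]
  have h2 : cayNum (cayForm (W : Mat n)) = (W : Mat n) * cayDen (cayForm (W : Mat n)) := by
    have : (W : Mat n) + 1 + ((W : Mat n) - 1) = (2 : ℝ) • (W : Mat n) := by module
    calc cayNum (cayForm (W : Mat n)) = ((W : Mat n) + 1) * ((W : Mat n) + 1)⁻¹ +
          ((W : Mat n) - 1) * ((W : Mat n) + 1)⁻¹ := by rw [hi, cayNum, hJ]
      _ = _ := by rw [← Matrix.add_mul, this, Matrix.smul_mul, h1, Matrix.mul_smul]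
  apply Subtype.ext
  rw [coe_caySp hA, h2, Matrix.mul_assoc, mul_nonsing_inv _ (det_cayDen hA).isUnit, Matrix.mul_one]

/-! ### Rotations and the upper bound -/

theorem proj_rot_mem_SpEll {t : ℝ} (h : t ∈ Ioo 0 Real.pi) : (rot t : SpTilde n).proj ∈ SpEll n := by
  rw [mem_SpEll_iff, coe_proj_rot]
  have : omegaForm (Real.cos t • (1 : Mat n) + Real.sin t • J₀ n) = (2 * Real.sin t) • (1 : Mat n) := by
    simp only [omegaForm, transpose_add, transpose_smul, transpose_one, Matrix.mul_add,
      Matrix.add_mul, Matrix.smul_mul, Matrix.mul_smul, Matrix.one_mul, Matrix.mul_one,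
      J_transpose', Matrix.neg_mul, J_mul_J]
    module
  rw [this]
  exact Matrix.PosDef.one.smul (mul_pos two_pos (Real.sin_pos_of_mem_Ioo h))

theorem rot_eq_princ {t : ℝ} (h : t ∈ Ico 0 Real.pi) :
    rot t = princ (rot t : SpTilde n).proj := by
  refine eq_princ_of_continuousOn (s := Ico 0 Real.pi) isPreconnected_Ico
    (continuous_rot (n := n)).continuousOn (fun s hs => ?_) (x₀ := 0) (by simp [Real.pi_pos]) ?_ t h
  · rcases hs.1.eq_or_lt with h0 | h0
    · rw [← h0, rot_zero, SpTilde.proj_one]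
      exact one_mem_sclDom
    · exact SpEll_subset_sclDom (proj_rot_mem_SpEll ⟨h0, hs.2⟩)
  · rw [rot_zero, SpTilde.proj_one, princ_one]

theorem rot_pi_mul_inv_mem_SpEll {W : Sp n} (hW : W ∈ SpEll n) :
    (rot Real.pi : SpTilde n).proj * W⁻¹ ∈ SpEll n := by
  rw [mem_SpEll_iff] at hW ⊢
  have hu : IsUnit (W : Mat n) := by
    rw [Matrix.isUnit_iff_isUnit_det, Sp.det_eq_one]; exact isUnit_one
  rw [← Matrix.IsUnit.posDef_star_left_conjugate_iff hu]
  convert hW using 1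
  have h1 : (W : Mat n)ᵀ * ((W⁻¹ : Sp n) : Mat n)ᵀ = 1 := by
    rw [← Matrix.transpose_mul, Sp.inv_mul_coe, transpose_one]
  rw [Sp.coe_mul, coe_proj_rot_pi, Matrix.neg_mul, Matrix.one_mul, omegaForm,
    star_eq_conjTranspose, conjTranspose_eq_transpose_of_trivial]
  calc (W : Mat n)ᵀ * ((J₀ n)ᵀ * -((W⁻¹ : Sp n) : Mat n) + (-((W⁻¹ : Sp n) : Mat n))ᵀ * J₀ n) * W =
      -((W : Mat n)ᵀ * (J₀ n)ᵀ * (((W⁻¹ : Sp n) : Mat n) * W)) -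
        ((W : Mat n)ᵀ * ((W⁻¹ : Sp n) : Mat n)ᵀ) * J₀ n * W := by
        rw [transpose_neg]
        noncomm_ring
    _ = _ := by
        rw [h1, Sp.inv_mul_coe, Matrix.one_mul, Matrix.mul_one, omegaForm, J_transpose',
          Matrix.mul_neg, Matrix.neg_mul]
        abel

/-- The product projects to -1, hence is constant under deformation. The Cayley forms of elliptic
matrices are convex, so W can be joined to J₀, where both factors are the quarter turn. -/
theorem princ_mul_princ_opposite {W : Sp n} (hW : W ∈ SpEll n) :
    princ W * princ ((rot Real.pi : SpTilde n).proj * W⁻¹) = rot Real.pi := by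
  have hA := (cayForm_posDef_iff (det_add_one_ne_zero hW)).2 hW
  set A := cayForm (W : Mat n) with hAdef
  let A' : I → Mat n := fun t => (1 - (t : ℝ)) • A + (t : ℝ) • (1 : Mat n)
  have hA' : ∀ t, (A' t).PosDef := by
    intro t
    rcases t.2.1.eq_or_lt with h | h
    · simpa [A', ← h] using hA
    · exact Matrix.PosDef.posSemidef_add (hA.posSemidef.smul (by linarith [t.2.2]))
        (Matrix.PosDef.one.smul h)
  have hc : Continuous fun t => caySp (A' t) := continuous_caySp (by fun_prop) hA'
  have hE : ∀ t, caySp (A' t) ∈ SpEll n := fun t => caySp_mem_SpEll (hA' t)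
  have hc1 : Continuous fun t => princ (caySp (A' t)) :=
    continuous_princ hc fun t => SpEll_subset_sclDom (hE t)
  have hc2 : Continuous fun t => princ ((rot Real.pi : SpTilde n).proj * (caySp (A' t))⁻¹) :=
    continuous_princ (continuous_const.mul hc.inv)
      fun t => SpEll_subset_sclDom (rot_pi_mul_inv_mem_SpEll (hE t))
  have := eqOn_of_proj_eq (c := fun t => princ (caySp (A' t)) *
      princ ((rot Real.pi : SpTilde n).proj * (caySp (A' t))⁻¹)) (d := fun _ => rot Real.pi)
    isPreconnected_univ (hc1.mul hc2).continuousOn continuousOn_const (fun t _ => ?_)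
    (mem_univ 1) ?_ 0 trivial
  · simpa [A', hAdef, caySp_cayForm hW] using this
  · rw [SpTilde.proj_mul, proj_princ_of_mem_SpEll (hE t),
      proj_princ_of_mem_SpEll (rot_pi_mul_inv_mem_SpEll (hE t))]
    apply Subtype.ext
    rw [Sp.coe_mul, Sp.coe_mul, coe_proj_rot_pi, Matrix.neg_mul, Matrix.one_mul, Matrix.mul_neg,
      Sp.mul_inv_coe]
  · have h1 : A' 1 = 1 := by simp [A']
    have h2 : Jsp n = (rot (Real.pi / 2) : SpTilde n).proj := proj_rot_pi_div_two.symm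
    have h3 : (rot Real.pi : SpTilde n).proj * (Jsp n)⁻¹ = Jsp n := by
      rw [h2, ← SpTilde.proj_inv, ← SpTilde.proj_mul, ← rot_neg, ← rot_add]
      congr 2; ring
    have h4 : princ (Jsp n) = rot (Real.pi / 2) := by
      rw [h2, ← rot_eq_princ]
      constructor <;> linarith [Real.pi_pos]
    simp only [h1, caySp_one, h3, h4, ← rot_add, add_halves]

theorem princ_le_rot_pi_of_mem_SpEll {W : Sp n} (hW : W ∈ SpEll n) :
    le (princ W) (rot Real.pi) := by
  have h := (one_le_princ (rot_pi_mul_inv_mem_SpEll hW)).mul_left (princ W)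
  rwa [mul_one, princ_mul_princ_opposite hW] at h

theorem le_rot_pi_of_mem_closure {w : SpTilde n} (hw : w ∈ closure (SpTildeEll n)) :
    le w (rot Real.pi) := by
  have : closure (SpTildeEll n) ⊆ {u | le u (rot Real.pi)} := by
    refine (isClosed_le _).closure_subset_iff.2 fun u hu => ?_
    obtain ⟨W, hW, rfl⟩ := mem_SpTildeEll_iff.1 hu
    exact princ_le_rot_pi_of_mem_SpEll hW
  exact this hw

/-! ### Conjugation to the unitary group -/

theorem sqrt_posDef {A : Mat n} (hA : A.PosDef) :
    (CFC.sqrt A).PosDef ∧ CFC.sqrt A * CFC.sqrt A = A := by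
  have h1 : CFC.sqrt A * CFC.sqrt A = A := CFC.sqrt_mul_sqrt_self _ hA.posSemidef.nonneg
  refine ⟨(Matrix.nonneg_iff_posSemidef.1 (CFC.sqrt_nonneg A)).posDef_iff_det_ne_zero.2 ?_, h1⟩
  intro h
  have := congrArg Matrix.det h1
  rw [det_mul, h, zero_mul] at this
  exact hA.det_pos.ne this

theorem commute_sqrt {A B : Mat n} (h : A * B = B * A) : CFC.sqrt A * B = B * CFC.sqrt A :=
  (Commute.cfcₙ_nnreal (show Commute A B from h) NNReal.sqrt).eq

theorem mul_conj_mul_of_commute {α : Type*} [Ring α] {S M : α} (c : S * M = M * S)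
    (h : S * S * (M * M) = -1) : M * (S * M * S) * M = -M := by
  have c2 : M * M * S = S * (M * M) := by rw [mul_assoc, ← c, ← mul_assoc, ← c, mul_assoc]
  calc M * (S * M * S) * M = (M * S) * M * (S * M) := by simp only [mul_assoc]
    _ = S * (M * M * S) * M := by rw [← c]; simp only [mul_assoc]
    _ = S * S * (M * M) * M := by rw [c2]; simp only [mul_assoc]
    _ = -M := by rw [h, neg_one_mul]

/-- With Q = `omegaForm W`, the matrix J₀ Q = W - W⁻¹ commutes with W. Polar decomposition of the
antisymmetric matrix √Q J₀ √Q replaces J₀ Q by a complex structure J₀ g that still commutes with W,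
with g symplectic and positive definite. The square root p of g conjugates J₀ g to J₀. -/
theorem exists_conj_commute_J {W : Sp n} (hW : W ∈ SpEll n) : ∃ p : Sp n, (p : Mat n).PosDef ∧
    ((p * W * p⁻¹ : Sp n) : Mat n) * J₀ n = J₀ n * ((p * W * p⁻¹ : Sp n) : Mat n) := by
  have hQ := mem_SpEll_iff.1 hW
  set Q := omegaForm (W : Mat n) with hQdef
  obtain ⟨hR, hRR⟩ := sqrt_posDef hQ
  set R := CFC.sqrt Q with hRdef
  have hRs := (posDef_iff_real.1 hR).1
  have hRu : IsUnit R.det := hR.det_pos.ne'.isUnit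
  have hJdet : (J₀ n).det ≠ 0 := by
    have := (Jsp n).det_eq_one
    rw [coe_Jsp] at this
    rw [this]; exact one_ne_zero
  set M := R * J₀ n * R with hM
  have hMt : Mᵀ = -M := by
    rw [hM, Matrix.transpose_mul, Matrix.transpose_mul, hRs, J_transpose']
    simp only [Matrix.mul_assoc, Matrix.neg_mul, Matrix.mul_neg]
  have hMM : (Mᵀ * M).PosDef := posDef_transpose_mul_self (by
    rw [hM, det_mul, det_mul]
    exact mul_ne_zero (mul_ne_zero hRu.ne_zero hJdet) hRu.ne_zero)
  obtain ⟨hS, hSS⟩ := sqrt_posDef hMM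
  set S := CFC.sqrt (Mᵀ * M) with hSdef
  have hSu : IsUnit S.det := hS.det_pos.ne'.isUnit
  have hSs := (posDef_iff_real.1 hS).1
  have hcomm : ∀ B, B * M = M * B → S⁻¹ * B = B * S⁻¹ := by
    intro B hB
    have h1 : S * B = B * S := by
      refine commute_sqrt ?_
      rw [hMt, Matrix.neg_mul, Matrix.neg_mul, Matrix.mul_neg, Matrix.mul_assoc, ← hB,
        ← Matrix.mul_assoc, ← hB, Matrix.mul_assoc]
    calc S⁻¹ * B = S⁻¹ * (B * S) * S⁻¹ := by
          rw [Matrix.mul_assoc, Matrix.mul_assoc, mul_nonsing_inv _ hSu, Matrix.mul_one]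
      _ = B * S⁻¹ := by rw [← h1, ← Matrix.mul_assoc, nonsing_inv_mul _ hSu, Matrix.one_mul]
  have hSM := hcomm M rfl
  have hS2 : S⁻¹ * S⁻¹ * (M * M) = -1 := by
    have : M * M = -(S * S) := by rw [hSS, hMt, Matrix.neg_mul, neg_neg]
    rw [this, Matrix.mul_neg, Matrix.mul_assoc, ← Matrix.mul_assoc S⁻¹ S S,
      nonsing_inv_mul _ hSu, Matrix.one_mul, nonsing_inv_mul _ hSu]
  -- Here R = √Q and S is the absolute value of M = R J₀ R, so that J₀ g is R-conjugate to the
  -- orthogonal part M S⁻¹ of M.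
  let g : Mat n := R * S⁻¹ * R
  have hgpos : g.PosDef := by
    have hu : IsUnit R := (Matrix.isUnit_iff_isUnit_det _).2 hRu
    have := (Matrix.IsUnit.posDef_star_left_conjugate_iff (x := S⁻¹) hu).2 hS.inv
    rwa [star_eq_conjTranspose, conjTranspose_eq_transpose_of_trivial, hRs] at this
  have hgs := (posDef_iff_real.1 hgpos).1
  have hgJ : g * J₀ n * g = J₀ n := by
    let L := R * (S⁻¹ * M * S⁻¹) * R
    have hL : g * J₀ n * g = L := by simp only [L, g, hM, Matrix.mul_assoc]
    have h1 : M * (S⁻¹ * M * S⁻¹) * M = -M := mul_conj_mul_of_commute hSM hS2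
    have h2 : R * (J₀ n * L * J₀ n) * R = R * (-J₀ n) * R := by
      calc R * (J₀ n * L * J₀ n) * R = M * (S⁻¹ * M * S⁻¹) * M := by
            simp only [L, hM, Matrix.mul_assoc]
        _ = _ := by rw [h1, hM, Matrix.mul_neg, Matrix.neg_mul]
    have h3 : J₀ n * L * J₀ n = -J₀ n := by
      have hu : IsUnit R := (Matrix.isUnit_iff_isUnit_det _).2 hRu
      exact hu.mul_left_cancel (hu.mul_right_cancel h2)
    rw [hL]
    calc L = (J₀ n * J₀ n) * L * (J₀ n * J₀ n) := by rw [J_mul_J]; simp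
      _ = J₀ n * (J₀ n * L * J₀ n) * J₀ n := by simp only [Matrix.mul_assoc]
      _ = J₀ n := by rw [h3, Matrix.mul_neg, J_mul_J]; simp
  have hgmem : g ∈ symplecticGroup (Fin n) ℝ := by rw [mem_sp, hgs]; exact hgJ
  let gs : Sp n := ⟨g, hgmem⟩
  obtain ⟨p, -, hp, hpp⟩ := exists_sqrt (g := gs) hgpos
  have hps := (posDef_iff_real.1 hp).1
  have hJQ : J₀ n * Q = (W : Mat n) - ((W⁻¹ : Sp n) : Mat n) := J_mul_omegaForm W
  have hWJQ : (W : Mat n) * (J₀ n * Q) = J₀ n * Q * W := by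
    rw [hJQ, Matrix.mul_sub, Matrix.sub_mul, Sp.mul_inv_coe, Sp.inv_mul_coe]
  have hWM : (R * W * R⁻¹) * M = M * (R * W * R⁻¹) := by
    calc (R * W * R⁻¹) * M = R * W * (R⁻¹ * R) * J₀ n * R := by
          simp only [hM, Matrix.mul_assoc]
      _ = R * (W * (J₀ n * Q)) * R⁻¹ := by
          rw [nonsing_inv_mul _ hRu, ← hRR, Matrix.mul_one]
          simp only [Matrix.mul_assoc]
          rw [mul_nonsing_inv _ hRu, Matrix.mul_one]
      _ = M * (R * W * R⁻¹) := by
          rw [hWJQ, ← hRR, hM]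
          simp only [Matrix.mul_assoc]
  have hWS := hcomm _ hWM
  have hJg : J₀ n * g * W = W * (J₀ n * g) := by
    have hu : IsUnit R := (Matrix.isUnit_iff_isUnit_det _).2 hRu
    refine hu.mul_left_cancel ?_
    calc R * (J₀ n * g * W) = M * (S⁻¹ * (R * W * R⁻¹)) * R := by
          simp only [hM, g, Matrix.mul_assoc]
          rw [nonsing_inv_mul _ hRu, Matrix.mul_one]
      _ = ((R * W * R⁻¹) * M) * S⁻¹ * R := by
          rw [hWS, hWM]
          simp only [Matrix.mul_assoc]
      _ = R * (W * (J₀ n * g)) := by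
          simp only [hM, g, Matrix.mul_assoc]
          rw [← Matrix.mul_assoc R⁻¹ R, nonsing_inv_mul _ hRu, Matrix.one_mul]
  have hJgs : Jsp n * gs * W = W * (Jsp n * gs) := Subtype.ext hJg
  have hpJ := symm_mul_J hps
  have hgsJ : gs * Jsp n * gs = Jsp n := Subtype.ext hgJ
  refine ⟨p, hp, ?_⟩
  have h1 : p⁻¹ * Jsp n = Jsp n * p := by
    rw [inv_mul_eq_iff_eq_mul, ← mul_assoc]; exact hpJ.symm
  have h2 : Jsp n * p⁻¹ = p * Jsp n := by
    rw [mul_inv_eq_iff_eq_mul]; exact hpJ.symm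
  have h3 : p⁻¹ * (Jsp n * W) * p⁻¹ = p * (W * Jsp n) * p := by
    rw [mul_inv_eq_iff_eq_mul, inv_mul_eq_iff_eq_mul]
    calc Jsp n * W = gs * (Jsp n * gs * W) := by rw [← mul_assoc, ← mul_assoc, hgsJ]
      _ = gs * (W * Jsp n) * gs := by rw [hJgs]; simp only [mul_assoc]
      _ = _ := by rw [← hpp]; simp only [mul_assoc]
  have h4 : p * W * p⁻¹ * Jsp n = Jsp n * (p * W * p⁻¹) := by
    rw [mul_assoc, h1]
    calc p * W * (Jsp n * p) = p * (W * Jsp n) * p := by simp only [mul_assoc]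
      _ = p⁻¹ * (Jsp n * W) * p⁻¹ := h3.symm
      _ = _ := by rw [← mul_assoc p⁻¹, h1]; simp only [mul_assoc]
  exact congrArg Subtype.val h4

theorem conj_mem_SpEll {W : Sp n} (hW : W ∈ SpEll n) (p : Sp n) : p * W * p⁻¹ ∈ SpEll n := by
  rw [mem_SpEll_iff] at hW ⊢
  have hu : IsUnit (p : Mat n) := by
    rw [Matrix.isUnit_iff_isUnit_det, Sp.det_eq_one]; exact isUnit_one
  rw [← Matrix.IsUnit.posDef_star_left_conjugate_iff hu]
  convert hW using 1
  have h1 : (p : Mat n)ᵀ * ((p⁻¹ : Sp n) : Mat n)ᵀ = 1 := by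
    rw [← Matrix.transpose_mul, Sp.inv_mul_coe, transpose_one]
  have h2 : (p : Mat n)ᵀ * (J₀ n)ᵀ * p = (J₀ n)ᵀ := by
    rw [J_transpose', Matrix.mul_neg, Matrix.neg_mul, Sp.transpose_mul]
  have h3 : ((p * W * p⁻¹ : Sp n) : Mat n) * (p : Mat n) = (p : Mat n) * W := by
    rw [← Sp.coe_mul, inv_mul_cancel_right, Sp.coe_mul]
  rw [star_eq_conjTranspose, conjTranspose_eq_transpose_of_trivial, omegaForm, Matrix.mul_add,
    Matrix.add_mul]
  have e1 : (p : Mat n)ᵀ * ((J₀ n)ᵀ * ((p * W * p⁻¹ : Sp n) : Mat n)) * (p : Mat n) =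
      (J₀ n)ᵀ * W := by
    calc _ = (p : Mat n)ᵀ * (J₀ n)ᵀ * (((p * W * p⁻¹ : Sp n) : Mat n) * (p : Mat n)) := by
          simp only [Matrix.mul_assoc]
      _ = ((p : Mat n)ᵀ * (J₀ n)ᵀ * p) * W := by rw [h3]; simp only [Matrix.mul_assoc]
      _ = _ := by rw [h2]
  have e2 : (p : Mat n)ᵀ * (((p * W * p⁻¹ : Sp n) : Mat n)ᵀ * J₀ n) * (p : Mat n) =
      (W : Mat n)ᵀ * J₀ n := by
    have := congrArg Matrix.transpose e1
    simpa only [Matrix.transpose_mul, transpose_transpose, Matrix.mul_assoc] using this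
  rw [e1, e2, omegaForm]

/-- The conjugated scaling curve starts at 1 and remains elliptic afterwards, so it stays a
principal lift. -/
theorem conj_princ {W : Sp n} (hW : W ∈ SpEll n) (v : SpTilde n) :
    v * princ W * v⁻¹ = princ (v.proj * W * v.proj⁻¹) := by
  have hD := SpEll_subset_sclDom hW
  let c : I → SpTilde n := fun s => v * princ (sclSp s W) * v⁻¹
  have hm : ∀ s : I, sclSp (s : ℝ) W ∈ SclDom n := fun s => sclSp_mem_sclDom s.2 hD
  have hcs : Continuous fun s : I => sclSp (s : ℝ) W :=
    continuous_sclSp continuous_subtype_val continuous_const fun s => hD s s.2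
  have hc : Continuous c := (continuous_const.mul (continuous_princ hcs hm)).mul continuous_const
  have hproj : ∀ s, (c s).proj = v.proj * sclSp (s : ℝ) W * v.proj⁻¹ := by
    intro s
    simp only [c, SpTilde.proj_mul, SpTilde.proj_inv, proj_princ (hm s)]
  have h0 : c 0 = 1 := by simp [c, sclSp_zero hD, princ_one]
  have := eq_princ_of_continuousOn isPreconnected_univ hc.continuousOn (fun s _ => ?_) (mem_univ 0)
    ?_ 1 trivial
  · rw [hproj] at this
    simpa [c, sclSp_one] using this
  · rcases s.2.1.eq_or_lt with h | h
    · have : s = 0 := Subtype.ext h.symm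
      rw [this, h0, SpTilde.proj_one]
      exact one_mem_sclDom
    · rw [hproj]
      exact SpEll_subset_sclDom (conj_mem_SpEll (sclSp_mem_SpEll h hW (hD s s.2)) _)
  · rw [h0, SpTilde.proj_one, princ_one]

/-! ### The spectrum of a positively elliptic unitary matrix -/

theorem toC_conjTranspose {A : Mat n} (hA : A * J₀ n = J₀ n * A) : toC Aᵀ = (toC A)ᴴ := by
  ext i j
  have h := commute_J_apply hA j i
  simp only [toC_apply, transpose_apply, conjTranspose_apply, star_add, star_mul',
    Complex.star_def, Complex.conj_ofReal, Complex.conj_I, h.1]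
  push_cast
  ring

theorem toC_posSemidef {A : Mat n} (hA : A.PosDef) (hJ : A * J₀ n = J₀ n * A) :
    (toC A).PosSemidef := by
  obtain ⟨hR, hRR⟩ := sqrt_posDef hA
  have hRJ := commute_sqrt hJ
  have hRs := (posDef_iff_real.1 hR).1
  have : toC A = (toC (CFC.sqrt A))ᴴ * toC (CFC.sqrt A) := by
    rw [← toC_conjTranspose hRJ, hRs, ← toC_mul hRJ, hRR]
  rw [this]
  exact posSemidef_conjTranspose_mul_self _

theorem one_add_mul_I (x : ℝ) : (1 + x * Complex.I : ℂ) =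
    Real.sqrt (1 + x ^ 2) * Complex.exp (Real.arctan x * Complex.I) := by
  have h : (0 : ℝ) < Real.sqrt (1 + x ^ 2) := by positivity
  rw [Complex.exp_mul_I, ← Complex.ofReal_cos, ← Complex.ofReal_sin, Real.cos_arctan,
    Real.sin_arctan]
  have h2 : (Real.sqrt (1 + x ^ 2) : ℂ) ≠ 0 := by exact_mod_cast h.ne'
  push_cast
  field_simp

theorem one_sub_mul_I (x : ℝ) : (1 - x * Complex.I : ℂ) =
    Real.sqrt (1 + x ^ 2) * Complex.exp (-(Real.arctan x * Complex.I)) := by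
  have := one_add_mul_I (-x)
  rw [Real.arctan_neg, Complex.ofReal_neg, Complex.ofReal_neg, neg_sq, neg_mul, neg_mul,
    ← sub_eq_add_neg] at this
  exact this

theorem one_sub_mul_I_ne_zero (x : ℝ) : (1 - x * Complex.I : ℂ) ≠ 0 := by
  rw [one_sub_mul_I]
  have h : (0 : ℝ) < Real.sqrt (1 + x ^ 2) := by positivity
  exact mul_ne_zero (by exact_mod_cast h.ne') (Complex.exp_ne_zero _)

theorem exp_two_arctan_mul (x : ℝ) :
    Complex.exp ((2 * Real.arctan x : ℝ) * Complex.I) * (1 - x * Complex.I) = 1 + x * Complex.I := by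
  rw [one_sub_mul_I, one_add_mul_I, mul_left_comm, ← Complex.exp_add]
  congr 2
  push_cast
  ring

theorem spectral_one_add_smul {H : Matrix (Fin n) (Fin n) ℂ} (hH : H.IsHermitian) (c : ℂ) :
    (1 : Matrix (Fin n) (Fin n) ℂ) + c • H = Unitary.conjStarAlgAut ℂ _ hH.eigenvectorUnitary
      (Matrix.diagonal fun j => 1 + c * (hH.eigenvalues j : ℂ)) := by
  have h : (Matrix.diagonal fun j => 1 + c * (hH.eigenvalues j : ℂ)) =
      1 + c • Matrix.diagonal (RCLike.ofReal ∘ hH.eigenvalues) := by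
    rw [← diagonal_one, ← diagonal_smul, diagonal_add]
    rfl
  rw [h, map_add, map_one, map_smul, ← hH.spectral_theorem]

theorem det_conjStarAlgAut (V : unitary (Matrix (Fin n) (Fin n) ℂ))
    (D : Matrix (Fin n) (Fin n) ℂ) : (Unitary.conjStarAlgAut ℂ _ V D).det = D.det := by
  rw [Unitary.conjStarAlgAut_apply, det_mul_comm, ← mul_assoc, Unitary.coe_star_mul_self, one_mul]

theorem charpoly_conjStarAlgAut (V : unitary (Matrix (Fin n) (Fin n) ℂ))
    (D : Matrix (Fin n) (Fin n) ℂ) : (Unitary.conjStarAlgAut ℂ _ V D).charpoly = D.charpoly := by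
  rw [Unitary.conjStarAlgAut_apply, charpoly_mul_comm, ← mul_assoc, Unitary.coe_star_mul_self,
    one_mul]

theorem det_one_add_smul_hermitian {H : Matrix (Fin n) (Fin n) ℂ} (hH : H.IsHermitian) (c : ℂ) :
    ((1 : Matrix (Fin n) (Fin n) ℂ) + c • H).det = ∏ j, (1 + c * (hH.eigenvalues j : ℂ)) := by
  rw [spectral_one_add_smul hH, det_conjStarAlgAut, det_diagonal]

/-- The Cayley form of a complex linear elliptic matrix becomes a non-negative Hermitian matrix H
with U = (1 + iH)(1 - iH)⁻¹. Diagonalizing H diagonalizes the whole scaling curve at once, which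
gives both the eigenvalues and the variation of the phase. -/
theorem exists_angles_unitary {U : Sp n} (hJ : (U : Mat n) * J₀ n = J₀ n * (U : Mat n))
    (hU : U ∈ SpEll n) : ∃ θ : Fin n → ℝ, (∀ j, θ j ∈ Icc 0 Real.pi) ∧
      (toC (U : Mat n)).charpoly =
        ∏ j, (Polynomial.X - Polynomial.C (Complex.exp (θ j * Complex.I))) ∧
      phase (princ U) = ∑ j, θ j := by
  have hd := det_add_one_ne_zero hU
  have hA := (cayForm_posDef_iff hd).2 hU
  have hD := SpEll_subset_sclDom hU
  have hi : (((U : Mat n) + 1)⁻¹) * J₀ n = J₀ n * ((U : Mat n) + 1)⁻¹ := by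
    have h1 : ((U : Mat n) + 1) * J₀ n = J₀ n * ((U : Mat n) + 1) := by
      rw [Matrix.add_mul, Matrix.mul_add, hJ, Matrix.one_mul, Matrix.mul_one]
    calc ((U : Mat n) + 1)⁻¹ * J₀ n =
        ((U : Mat n) + 1)⁻¹ * (J₀ n * ((U : Mat n) + 1)) * ((U : Mat n) + 1)⁻¹ := by
          rw [Matrix.mul_assoc, Matrix.mul_assoc, mul_nonsing_inv _ hd.isUnit, Matrix.mul_one]
      _ = _ := by rw [← h1, ← Matrix.mul_assoc, nonsing_inv_mul _ hd.isUnit, Matrix.one_mul]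
  set B := ((U : Mat n) - 1) * ((U : Mat n) + 1)⁻¹ with hB
  have hBJ : B * J₀ n = J₀ n * B := by
    rw [hB, Matrix.mul_assoc, hi, ← Matrix.mul_assoc, ← Matrix.mul_assoc, Matrix.sub_mul,
      Matrix.mul_sub, hJ, Matrix.one_mul, Matrix.mul_one]
  have hAB : cayForm (U : Mat n) = (J₀ n)ᵀ * B := rfl
  have hAJ : cayForm (U : Mat n) * J₀ n = J₀ n * cayForm (U : Mat n) := by
    rw [hAB, J_transpose', Matrix.mul_assoc, hBJ, Matrix.neg_mul, Matrix.neg_mul, Matrix.mul_neg]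
  have hBA : B = J₀ n * cayForm (U : Mat n) := by
    rw [hAB, ← Matrix.mul_assoc, J_transpose', Matrix.mul_neg, J_mul_J, neg_neg, Matrix.one_mul]
  have hH := toC_posSemidef hA hAJ
  set H := toC (cayForm (U : Mat n)) with hHdef
  have hHh := hH.isHermitian
  set ev := hHh.eigenvalues with hev
  have hev0 : ∀ j, 0 ≤ ev j := hH.eigenvalues_nonneg
  have hJJ : J₀ n * J₀ n = J₀ n * J₀ n := rfl
  have htB : toC B = Complex.I • H := by
    rw [hBA, toC_mul hJJ, toC_J, Matrix.smul_mul, Matrix.one_mul]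
  have hadd : ∀ s : ℝ, toC (1 + s • B) = 1 + ((s : ℂ) * Complex.I) • H := by
    intro s
    rw [toC_add, toC_one, toC_smul, htB, smul_smul]
  have hcJ : ∀ s : ℝ, (1 + s • B) * J₀ n = J₀ n * (1 + s • B) := by
    intro s
    rw [Matrix.add_mul, Matrix.mul_add, Matrix.smul_mul, Matrix.mul_smul, hBJ, Matrix.one_mul,
      Matrix.mul_one]
  have hnum : ∀ s : ℝ, sclNum s (U : Mat n) = (1 + s • B) * ((U : Mat n) + 1) := by
    intro s
    rw [Matrix.add_mul, Matrix.smul_mul, hB, Matrix.mul_assoc, nonsing_inv_mul _ hd.isUnit, sclNum,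
      Matrix.one_mul, Matrix.mul_one]
    module
  have hden : ∀ s : ℝ, sclDen s (U : Mat n) = (1 + (-s) • B) * ((U : Mat n) + 1) := by
    intro s
    rw [Matrix.add_mul, Matrix.smul_mul, hB, Matrix.mul_assoc, nonsing_inv_mul _ hd.isUnit, sclDen,
      Matrix.one_mul, Matrix.mul_one]
    module
  have hu : IsUnit ((U : Mat n) + 1) := (Matrix.isUnit_iff_isUnit_det _).2 hd.isUnit
  have hscl : ∀ s ∈ Icc (0 : ℝ) 1, (sclSp s U : Mat n) * (1 + (-s) • B) = 1 + s • B := by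
    intro s hs
    refine hu.mul_right_cancel ?_
    rw [Matrix.mul_assoc, ← hden, ← hnum, coe_sclSp (hD s hs), scl, Matrix.mul_assoc,
      nonsing_inv_mul _ (hD s hs).isUnit, Matrix.mul_one]
  have hsclJ : ∀ s ∈ Icc (0 : ℝ) 1,
      toC (sclSp s U : Mat n) * toC (1 + (-s) • B) = toC (1 + s • B) := by
    intro s hs
    have hw : IsUnit (1 + (-s) • B) := by
      have := hD s hs
      rw [hden, det_mul] at this
      exact (Matrix.isUnit_iff_isUnit_det _).2 (left_ne_zero_of_mul this).isUnit
    have hcs : (sclSp s U : Mat n) * J₀ n = J₀ n * (sclSp s U : Mat n) := by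
      refine hw.mul_right_cancel ?_
      rw [Matrix.mul_assoc, ← hcJ, ← Matrix.mul_assoc, hscl s hs, hcJ, Matrix.mul_assoc, hscl s hs]
    rw [← toC_mul hcs, hscl s hs]
  have hpm : ∀ (s : ℝ) j, 1 + ((-s : ℝ) : ℂ) * Complex.I * (ev j : ℂ) =
      1 - ((s * ev j : ℝ) : ℂ) * Complex.I := by
    intro s j; push_cast; ring
  have hpp : ∀ (s : ℝ) j, 1 + (s : ℂ) * Complex.I * (ev j : ℂ) =
      1 + ((s * ev j : ℝ) : ℂ) * Complex.I := by
    intro s j; push_cast; ring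
  -- (1 + ix)/(1 - ix) = exp(2i arctan x), and x ≥ 0 puts the angle in [0, π).
  refine ⟨fun j => 2 * Real.arctan (ev j), fun j => ?_, ?_, ?_⟩
  · have h1 := Real.arctan_nonneg.2 (hev0 j)
    have h2 := Real.arctan_lt_pi_div_two (ev j)
    constructor <;> linarith
  · have h1 := hsclJ 1 (by simp)
    rw [sclSp_one, hadd, hadd, spectral_one_add_smul hHh, spectral_one_add_smul hHh] at h1
    have h2 : toC (U : Mat n) = Unitary.conjStarAlgAut ℂ _ hHh.eigenvectorUnitary
        (Matrix.diagonal fun j => Complex.exp ((2 * Real.arctan (ev j) : ℝ) * Complex.I)) := by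
      have hw : IsUnit (Unitary.conjStarAlgAut ℂ _ hHh.eigenvectorUnitary
          (Matrix.diagonal fun j => 1 + ((-1 : ℝ) : ℂ) * Complex.I * (ev j : ℂ))) := by
        rw [Matrix.isUnit_iff_isUnit_det, det_conjStarAlgAut, det_diagonal, isUnit_iff_ne_zero]
        refine Finset.prod_ne_zero_iff.2 fun j _ => ?_
        rw [hpm]
        exact one_sub_mul_I_ne_zero _
      refine hw.mul_right_cancel ?_
      rw [h1, ← map_mul, diagonal_mul_diagonal]
      congr 2
      funext j
      rw [hpm, hpp, one_mul, exp_two_arctan_mul]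
    rw [h2, charpoly_conjStarAlgAut, charpoly_diagonal]
  · have hm : ∀ s : I, sclSp (s : ℝ) U ∈ SclDom n := fun s => sclSp_mem_sclDom s.2 hD
    have hcs : Continuous fun s : I => sclSp (s : ℝ) U :=
      continuous_sclSp continuous_subtype_val continuous_const fun s => hD s s.2
    have := phase_sub_phase (c := fun s : I => princ (sclSp (s : ℝ) U)) (r := fun _ => 1)
      (θ := fun s : I => ∑ j, 2 * Real.arctan (s * ev j)) isPreconnected_univ
      (continuous_princ hcs hm).continuousOn (Continuous.continuousOn (by fun_prop))
      (fun _ _ => one_pos) (fun s _ => ?_) (mem_univ 0) (mem_univ 1)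
    · simpa [sclSp_one, sclSp_zero hD, princ_one, phase_one] using this
    · rw [proj_princ (hm s), complexDet_eq, Complex.ofReal_one, one_mul]
      have h1 := congrArg Matrix.det (hsclJ s s.2)
      rw [det_mul, hadd, hadd, det_one_add_smul_hermitian hHh, det_one_add_smul_hermitian hHh] at h1
      have h3 : ∏ j, (1 + (((-(s : ℝ)) : ℝ) : ℂ) * Complex.I * (ev j : ℂ)) ≠ 0 := by
        refine Finset.prod_ne_zero_iff.2 fun j _ => ?_
        rw [hpm]
        exact one_sub_mul_I_ne_zero _
      refine mul_right_cancel₀ h3 (h1.trans ?_)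
      rw [Complex.ofReal_sum, Finset.sum_mul, Complex.exp_sum, ← Finset.prod_mul_distrib]
      refine Finset.prod_congr rfl fun j _ => ?_
      rw [hpm, hpp, exp_two_arctan_mul]

theorem complexify_eq_fromBlocks {U : Mat n} (hJ : U * J₀ n = J₀ n * U) : complexify U =
    fromBlocks (U.toBlocks₁₁.map (fun x : ℝ => (x : ℂ))) (-U.toBlocks₂₁.map (fun x : ℝ => (x : ℂ)))
      (U.toBlocks₂₁.map (fun x : ℝ => (x : ℂ))) (U.toBlocks₁₁.map (fun x : ℝ => (x : ℂ))) := by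
  ext (i | i) (j | j)
  · rfl
  · simp [complexify, (commute_J_apply hJ i j).1, toBlocks₂₁]
  · rfl
  · simp [complexify, (commute_J_apply hJ i j).2, toBlocks₁₁]

/-- The complexification of a complex-linear map is the sum of this map and of its conjugate. -/
theorem charpoly_complexify {U : Mat n} (hJ : U * J₀ n = J₀ n * U) :
    (complexify U).charpoly = (toC U).charpoly * (toC U).charpoly.map (starRingEnd ℂ) := by
  set a := U.toBlocks₁₁.map (fun x : ℝ => (x : ℂ)) with ha
  set b := U.toBlocks₂₁.map (fun x : ℝ => (x : ℂ)) with hb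
  have h1 : toC U = a + Complex.I • b := rfl
  have h2 : (toC U).map (starRingEnd ℂ) = a - Complex.I • b := by
    ext i j
    simp [h1, ha, hb, sub_eq_add_neg]
  -- The change of basis to the ±i eigenspaces of J₀, spanned by the vectors (v, -iv) and (v, iv).
  let P : Matrix (Fin n ⊕ Fin n) (Fin n ⊕ Fin n) ℂ :=
    fromBlocks 1 1 (-Complex.I • (1 : Matrix (Fin n) (Fin n) ℂ)) (Complex.I • (1 : Matrix (Fin n) (Fin n) ℂ))
  let P' : Matrix (Fin n ⊕ Fin n) (Fin n ⊕ Fin n) ℂ :=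
    (1 / 2 : ℂ) • fromBlocks 1 (Complex.I • (1 : Matrix (Fin n) (Fin n) ℂ)) 1
      (-Complex.I • (1 : Matrix (Fin n) (Fin n) ℂ))
  have hPP : P * P' = 1 := by
    simp only [P, P', Matrix.mul_smul, fromBlocks_multiply, Matrix.mul_one,
      smul_smul, fromBlocks_smul, neg_mul, mul_neg]
    rw [← fromBlocks_one]
    congr 1
    · module
    · module
    · module
    · match_scalars
      linear_combination -Complex.I_mul_I
  have hPP' : P' * P = 1 := mul_eq_one_comm.1 hPP
  have hconj : complexify U = P * fromBlocks (a + Complex.I • b) 0 0 (a - Complex.I • b) * P' := by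
    have : complexify U * P = P * fromBlocks (a + Complex.I • b) 0 0 (a - Complex.I • b) := by
      rw [complexify_eq_fromBlocks hJ]
      simp only [P, fromBlocks_multiply, Matrix.mul_smul, Matrix.smul_mul, Matrix.mul_one,
        Matrix.one_mul, Matrix.mul_zero, add_zero, zero_add, ← ha, ← hb, smul_add, smul_sub, smul_smul,
        neg_mul, Complex.I_mul_I]
      congr 1 <;> module
    rw [← this, Matrix.mul_assoc, hPP, Matrix.mul_one]
  rw [hconj, charpoly_mul_comm, ← Matrix.mul_assoc, hPP', Matrix.one_mul,
    charpoly_fromBlocks_zero₁₂, ← h1, ← h2, charpoly_map]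

/-- The characteristic polynomial with roots `exp (± i θ j)`. -/
def anglePoly (θ : Fin n → ℝ) : Polynomial ℂ :=
  ∏ j, (Polynomial.X - Polynomial.C (Complex.exp (θ j * Complex.I))) *
    (Polynomial.X - Polynomial.C (Complex.exp (-(θ j * Complex.I))))

theorem charpoly_complexify_conj (p W : Sp n) :
    (complexify ((p * W * p⁻¹ : Sp n) : Mat n)).charpoly = (complexify (W : Mat n)).charpoly := by
  rw [Sp.coe_mul, Sp.coe_mul, complexify_mul, complexify_mul]
  have h1 : complexify (p : Mat n) * complexify ((p⁻¹ : Sp n) : Mat n) = 1 := by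
    rw [← complexify_mul, Sp.mul_inv_coe, complexify_one]
  rw [charpoly_mul_comm, ← Matrix.mul_assoc, mul_eq_one_comm.1 h1, Matrix.one_mul]

theorem mem_UTilde_of_commute_J {u : SpTilde n}
    (h : (u.proj : Mat n) * J₀ n = J₀ n * (u.proj : Mat n)) : u ∈ UTilde n := by
  change (u.proj : Mat n) ∈ orthogonalGroup (Fin n ⊕ Fin n) ℝ
  rw [mem_orthogonalGroup_iff']
  change (u.proj : Mat n)ᵀ * (u.proj : Mat n) = 1
  have h1 := u.proj.transpose_mul
  rw [Matrix.mul_assoc, ← h, ← Matrix.mul_assoc] at h1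
  have h2 := congrArg (· * J₀ n) h1
  simp only [Matrix.mul_assoc, J_mul_J, Matrix.mul_neg, Matrix.mul_one] at h2
  exact neg_injective h2

/-- The characteristic polynomial and `hphase` are invariant under conjugation, so the unitary case
suffices. -/
theorem exists_angles {w : SpTilde n} (hw : w ∈ SpTildeEll n) :
    ∃ θ : Fin n → ℝ, (∀ j, θ j ∈ Icc 0 Real.pi) ∧
      (complexify (w.proj : Mat n)).charpoly = anglePoly θ ∧ hphase w = ∑ j, θ j := by
  obtain ⟨W, hW, rfl⟩ := mem_SpTildeEll_iff.1 hw
  obtain ⟨p, hpos, hp⟩ := exists_conj_commute_J hW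
  have hU := conj_mem_SpEll hW p
  obtain ⟨θ, hθ, hc, hph⟩ := exists_angles_unitary hp hU
  refine ⟨θ, hθ, ?_, ?_⟩
  · rw [proj_princ_of_mem_SpEll hW, ← charpoly_complexify_conj p W, charpoly_complexify hp, hc,
      anglePoly, Finset.prod_mul_distrib, Polynomial.map_prod]
    congr 1
    refine Finset.prod_congr rfl fun j _ => ?_
    rw [Polynomial.map_sub, Polynomial.map_X, Polynomial.map_C, ← Complex.exp_conj]
    simp
  · have h1 := conj_princ hW (princ p)
    rw [proj_princ (mem_sclDom_of_posDef hpos)] at h1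
    rw [← hphase_conj (princ p), h1, hphase_unitary, hph]
    refine mem_UTilde_of_commute_J ?_
    rw [proj_princ_of_mem_SpEll hU]
    exact hp

/-- The relation between an element and its angles is closed, and the angles range over a compact
cube, so the set of elements possessing angles is closed. -/
theorem exists_angles_of_mem_closure {w : SpTilde n} (hw : w ∈ closure (SpTildeEll n)) :
    ∃ θ : Fin n → ℝ, (∀ j, θ j ∈ Icc 0 Real.pi) ∧
      (complexify (w.proj : Mat n)).charpoly = anglePoly θ ∧ hphase w = ∑ j, θ j := by
  let K : Set (Fin n → ℝ) := Set.pi univ fun _ => Icc (0 : ℝ) Real.pi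
  have : CompactSpace K := isCompact_iff_compactSpace.1 (isCompact_univ_pi fun _ => isCompact_Icc)
  let S : Set (SpTilde n × K) :=
    {q | (∀ x, (complexify (q.1.proj : Mat n)).charpoly.eval x = (anglePoly (q.2 : Fin n → ℝ)).eval x) ∧
      hphase q.1 = ∑ j, (q.2 : Fin n → ℝ) j}
  have hθ : ∀ j, Continuous fun q : SpTilde n × K => (q.2 : Fin n → ℝ) j := fun j =>
    (continuous_apply j).comp (continuous_subtype_val.comp continuous_snd)
  have hS : IsClosed S := by
    refine IsClosed.inter ?_ ?_
    · change IsClosed {q : SpTilde n × K | ∀ x,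
        (complexify (q.1.proj : Mat n)).charpoly.eval x = (anglePoly (q.2 : Fin n → ℝ)).eval x}
      rw [ofPred_forall]
      refine isClosed_iInter fun x => isClosed_eq ?_ ?_
      · simp only [eval_charpoly]
        have h1 : Continuous fun q : SpTilde n × K => (q.1.proj : Mat n) :=
          continuous_subtype_val.comp (SpTilde.continuous_proj.comp continuous_fst)
        have h2 : Continuous fun q : SpTilde n × K => complexify (q.1.proj : Mat n) :=
          h1.matrix_map Complex.continuous_ofReal
        exact (continuous_const.sub h2).matrix_det
      · simp only [anglePoly, Polynomial.eval_prod, Polynomial.eval_mul, Polynomial.eval_sub,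
          Polynomial.eval_X, Polynomial.eval_C]
        fun_prop
    · exact isClosed_eq (continuous_hphase.comp continuous_fst) (by fun_prop)
  have hcl : IsClosed (Prod.fst '' S) := isClosedMap_fst_of_compactSpace _ hS
  have hsub : closure (SpTildeEll n) ⊆ Prod.fst '' S := by
    refine hcl.closure_subset_iff.2 fun u hu => ?_
    obtain ⟨θ, h1, h2, h3⟩ := exists_angles hu
    exact ⟨(u, ⟨θ, fun j _ => h1 j⟩), ⟨fun x => by rw [h2], h3⟩, rfl⟩
  obtain ⟨⟨u, θ⟩, ⟨h1, h2⟩, rfl⟩ := hsub hw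
  exact ⟨θ.1, fun j => θ.2 j trivial, Polynomial.funext h1, h2⟩

/-! ### `C¹` curves -/

theorem IsC1Curve.hasVel {c : ℝ → SpTilde n} (hc : IsC1Curve c) :
    HasVel c (Icc 0 1) (velocity c) ∧ ContinuousOn (velocity c) (Icc 0 1) := by
  have hu : UniqueDiffOn ℝ (Icc (0 : ℝ) 1) := uniqueDiffOn_Icc one_pos
  have h1 : ∀ t ∈ Icc (0 : ℝ) 1, HasDerivWithinAt (projCurve c) (projDeriv c t) (Icc 0 1) t := by
    intro t ht
    refine hasDerivWithinAt_pi.2 fun i => hasDerivWithinAt_pi.2 fun j => ?_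
    exact ((hc.2 i j).differentiableOn (by norm_num) t ht).hasDerivWithinAt
  refine ⟨HasVel.of_hasDerivWithinAt hc.1 h1, ?_⟩
  have h2 : ContinuousOn (projDeriv c) (Icc 0 1) := by
    refine continuousOn_pi.2 fun i => continuousOn_pi.2 fun j => ?_
    exact ((contDiffOn_one_iff_derivWithin hu).1 (hc.2 i j)).2
  exact h2.mul (continuous_subtype_val.comp_continuousOn
    (continuous_inv.comp_continuousOn (SpTilde.continuous_proj.comp_continuousOn hc.1)))

theorem HasVel.projDeriv_eq {c : ℝ → SpTilde n} {X : ℝ → Mat n} (hc : HasVel c (Icc 0 1) X) {t : ℝ}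
    (ht : t ∈ Icc (0 : ℝ) 1) : projDeriv c t = X t * projCurve c t := by
  ext i j
  have h := hasDerivWithinAt_pi.1 (hasDerivWithinAt_pi.1 (hc.2 t ht) i) j
  exact h.derivWithin (uniqueDiffOn_Icc one_pos t ht)

theorem HasVel.velocity_eq {c : ℝ → SpTilde n} {X : ℝ → Mat n} (hc : HasVel c (Icc 0 1) X) {t : ℝ}
    (ht : t ∈ Icc (0 : ℝ) 1) : velocity c t = X t := by
  rw [velocity, hc.projDeriv_eq ht, projCurve, Matrix.mul_assoc, Sp.mul_inv_coe, Matrix.mul_one]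

theorem HasVel.isC1Curve {c : ℝ → SpTilde n} {X : ℝ → Mat n} (hc : HasVel c (Icc 0 1) X)
    (hX : ContinuousOn X (Icc 0 1)) : IsC1Curve c := by
  have hu : UniqueDiffOn ℝ (Icc (0 : ℝ) 1) := uniqueDiffOn_Icc one_pos
  refine ⟨hc.1, fun i j => (contDiffOn_one_iff_derivWithin hu).2 ⟨fun t ht => ?_, ?_⟩⟩
  · exact (hasDerivWithinAt_pi.1 (hasDerivWithinAt_pi.1 (hc.2 t ht) i) j).differentiableWithinAt
  · have h1 : ContinuousOn (fun t => X t * projCurve c t) (Icc 0 1) :=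
      hX.mul (continuous_subtype_val.comp_continuousOn
        (SpTilde.continuous_proj.comp_continuousOn hc.1))
    have h2 := continuousOn_pi.1 (continuousOn_pi.1 h1 i) j
    refine h2.congr fun t ht => ?_
    exact congrFun (congrFun (hc.projDeriv_eq ht) i) j

theorem HasVel.continuousOn_proj {c : ℝ → SpTilde n} {s : Set ℝ} {X : ℝ → Mat n}
    (hc : HasVel c s X) : ContinuousOn (fun t => ((c t).proj : Mat n)) s :=
  continuous_subtype_val.comp_continuousOn (SpTilde.continuous_proj.comp_continuousOn hc.1)

/-! ### Shears -/

/-- The symplectic shear `1 + l J ν νᵀ`. -/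
def shearMat (ν : Fin n ⊕ Fin n → ℝ) (l : ℝ) : Mat n := 1 + l • vecMulVec (J₀ n *ᵥ ν) ν

theorem dotProduct_J_mulVec_self (x : Fin n ⊕ Fin n → ℝ) : x ⬝ᵥ (J₀ n *ᵥ x) = 0 := by
  have := dotProduct_J_self x
  rw [J_transpose', neg_mulVec, dotProduct_neg] at this
  linarith

theorem vecMulVec_J_sq (ν : Fin n ⊕ Fin n → ℝ) :
    vecMulVec (J₀ n *ᵥ ν) ν * vecMulVec (J₀ n *ᵥ ν) ν = 0 := by
  rw [vecMulVec_mul_vecMulVec, dotProduct_J_mulVec_self]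
  simp

theorem form_vecMulVec_J (ν : Fin n ⊕ Fin n → ℝ) :
    form (vecMulVec (J₀ n *ᵥ ν) ν) = vecMulVec ν ν := by
  rw [form, mul_vecMulVec, mulVec_mulVec, J_transpose', Matrix.neg_mul, J_mul_J, neg_neg,
    one_mulVec]

theorem shearMat_mem (ν : Fin n ⊕ Fin n → ℝ) (l : ℝ) :
    shearMat ν l ∈ symplecticGroup (Fin n) ℝ := by
  rw [mem_sp]
  have h1 : J₀ n * vecMulVec (J₀ n *ᵥ ν) ν = -vecMulVec ν ν := by
    rw [mul_vecMulVec, mulVec_mulVec, J_mul_J, neg_mulVec, one_mulVec, neg_vecMulVec]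
  have h2 : vecMulVec ν (J₀ n *ᵥ ν) * J₀ n = vecMulVec ν ν := by
    rw [vecMulVec_mul, ← mulVec_transpose, mulVec_mulVec, J_transpose', Matrix.neg_mul, J_mul_J,
      neg_neg, one_mulVec]
  have h3 : vecMulVec ν ν * vecMulVec (J₀ n *ᵥ ν) ν = 0 := by
    rw [vecMulVec_mul_vecMulVec, dotProduct_J_mulVec_self]
    simp
  simp only [shearMat, transpose_add, transpose_one, transpose_smul, transpose_vecMulVec,
    Matrix.add_mul, Matrix.mul_add, Matrix.one_mul, Matrix.mul_one, Matrix.smul_mul,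
    Matrix.mul_smul, h1, h2, h3]
  module

/-- The symplectic shear `1 + l J ν νᵀ`, as an element of the symplectic group. -/
def shearSp (ν : Fin n ⊕ Fin n → ℝ) (l : ℝ) : Sp n := ⟨shearMat ν l, shearMat_mem ν l⟩

theorem continuous_shearSp (ν : Fin n ⊕ Fin n → ℝ) : Continuous (shearSp ν) := by
  refine Continuous.subtype_mk ?_ _
  unfold shearMat
  fun_prop

theorem shearSp_zero (ν : Fin n ⊕ Fin n → ℝ) : shearSp ν 0 = 1 :=
  Subtype.ext (by simp [shearSp, shearMat])

/-- The lift of the symplectic shears. -/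
def shear (ν : Fin n ⊕ Fin n → ℝ) : ℝ → SpTilde n :=
  liftCurve (shearSp ν) (continuous_shearSp ν) (shearSp_zero ν)

theorem continuous_shear (ν : Fin n ⊕ Fin n → ℝ) : Continuous (shear ν) := by
  unfold shear
  exact continuous_liftCurve _ _ _

@[simp] theorem shear_zero (ν : Fin n ⊕ Fin n → ℝ) : shear ν 0 = 1 := by
  unfold shear
  exact liftCurve_zero _ _ _

theorem proj_shear (ν : Fin n ⊕ Fin n → ℝ) (l : ℝ) : (shear ν l).proj = shearSp ν l := by
  rw [shear, proj_liftCurve]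

theorem coe_proj_shear (ν : Fin n ⊕ Fin n → ℝ) (l : ℝ) :
    ((shear ν l).proj : Mat n) = 1 + l • vecMulVec (J₀ n *ᵥ ν) ν := by
  rw [proj_shear]; rfl

theorem hasVel_shear (ν : Fin n ⊕ Fin n → ℝ) (s : Set ℝ) :
    HasVel (shear ν) s fun _ => vecMulVec (J₀ n *ᵥ ν) ν := by
  refine hasVel_liftCurve _ _ fun t _ => ?_
  have h : HasDerivAt (fun t => shearMat ν t) (vecMulVec (J₀ n *ᵥ ν) ν) t := by
    unfold shearMat
    refine (((hasDerivAt_id t).smul_const (vecMulVec (J₀ n *ᵥ ν) ν)).const_add 1).congr_deriv ?_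
    rw [one_smul]
  refine h.hasDerivWithinAt.congr_deriv ?_
  change _ = _ * (1 + t • vecMulVec (J₀ n *ᵥ ν) ν)
  rw [Matrix.mul_add, Matrix.mul_smul, vecMulVec_J_sq, smul_zero, add_zero, Matrix.mul_one]

theorem posSemidef_form_shear (ν : Fin n ⊕ Fin n → ℝ) :
    (form (vecMulVec (J₀ n *ᵥ ν) ν)).PosSemidef := by
  rw [form_vecMulVec_J]
  simpa using posSemidef_vecMulVec_self_star ν

theorem shear_add (ν : Fin n ⊕ Fin n → ℝ) (a b : ℝ) : shear ν (a + b) = shear ν a * shear ν b := by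
  have := eqOn_of_proj_eq (c := fun a => shear ν (a + b)) (d := fun a => shear ν a * shear ν b)
    isPreconnected_univ ((continuous_shear ν).comp (by fun_prop)).continuousOn
    ((continuous_shear ν).mul continuous_const).continuousOn (fun x _ => ?_) (mem_univ 0) (by simp)
  · exact this a trivial
  · apply Subtype.ext
    rw [SpTilde.proj_mul, Sp.coe_mul, coe_proj_shear, coe_proj_shear, coe_proj_shear]
    simp only [Matrix.add_mul, Matrix.mul_add, Matrix.smul_mul, Matrix.mul_smul, vecMulVec_J_sq,
      Matrix.one_mul, Matrix.mul_one]
    module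

theorem shear_neg (ν : Fin n ⊕ Fin n → ℝ) (l : ℝ) : shear ν (-l) = (shear ν l)⁻¹ := by
  rw [eq_inv_iff_mul_eq_one, ← shear_add]
  simp

/-! ### Timelike curves in the Cayley chart -/

theorem cayForm_eq {W : Mat n} (h : (W + 1).det ≠ 0) :
    cayForm W = (J₀ n)ᵀ * (1 - (2 : ℝ) • (W + 1)⁻¹) := by
  have h1 := mul_nonsing_inv _ h.isUnit
  have h2 : W - 1 = (W + 1) - (2 : ℝ) • (1 : Mat n) := by module
  rw [cayForm, h2, Matrix.sub_mul, h1, Matrix.smul_mul, Matrix.one_mul]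

theorem cayForm_transpose {W : Sp n} (h : ((W : Mat n) + 1).det ≠ 0) :
    (cayForm (W : Mat n))ᵀ = cayForm (W : Mat n) := by
  have hu : IsUnit ((W : Mat n) + 1) := (Matrix.isUnit_iff_isUnit_det _).2 h.isUnit
  have hut : IsUnit ((W : Mat n) + 1)ᵀ := by
    rw [Matrix.isUnit_iff_isUnit_det, det_transpose]; exact h.isUnit
  refine hut.mul_left_cancel (hu.mul_right_cancel ?_)
  have h1 := omegaForm_eq_cayForm h
  have h2 := congrArg Matrix.transpose h1
  rw [omegaForm_transpose, Matrix.transpose_mul, Matrix.transpose_mul, transpose_transpose,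
    ← Matrix.mul_assoc] at h2
  rw [h2, h1]

/-- Writing the Cayley form as J₀ᵀ(1 - 2(W + 1)⁻¹), its derivative is congruent, through W + 1, to 2
Wᵀ (form X) W. -/
theorem HasVel.cayForm_strictMono {c : ℝ → SpTilde n} {X : ℝ → Mat n} {b : ℝ}
    (hc : HasVel c (Icc 0 b) X) (hX : ∀ t ∈ Icc 0 b, (form (X t)).PosDef)
    (hd : ∀ t ∈ Icc 0 b, (((c t).proj : Mat n) + 1).det ≠ 0) {s t : ℝ} (hs : s ∈ Icc 0 b)
    (ht : t ∈ Icc 0 b) (hst : s < t) :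
    (cayForm ((c t).proj : Mat n) - cayForm ((c s).proj : Mat n)).PosDef := by
  refine posDef_iff_real.2 ⟨?_, fun v hv => ?_⟩
  · rw [transpose_sub, cayForm_transpose (hd t ht), cayForm_transpose (hd s hs)]
  have hder : ∀ t ∈ Icc 0 b, HasDerivWithinAt
      (fun t => v ⬝ᵥ (((J₀ n)ᵀ * (1 - (2 : ℝ) • (projCurve c t + 1)⁻¹)) *ᵥ v))
      (v ⬝ᵥ (((J₀ n)ᵀ * ((2 : ℝ) • ((projCurve c t + 1)⁻¹ * (X t * projCurve c t) *
        (projCurve c t + 1)⁻¹))) *ᵥ v)) (Icc 0 b) t := by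
    intro t ht
    have h1 := hasDerivWithinAt_inv_mat ((hc.2 t ht).add_const (1 : Mat n)) (hd t ht)
    let L : Mat n →ₗ[ℝ] ℝ :=
      { toFun := fun M => v ⬝ᵥ (((J₀ n)ᵀ * M) *ᵥ v)
        map_add' := fun M N => by rw [Matrix.mul_add, add_mulVec, dotProduct_add]
        map_smul' := fun r M => by
          rw [Matrix.mul_smul, smul_mulVec, dotProduct_smul]; rfl }
    have h2 := ((h1.const_smul (2 : ℝ)).const_sub (1 : Mat n))
    have h3 := (LinearMap.toContinuousLinearMap L).hasFDerivAt.comp_hasDerivWithinAt t h2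
    refine HasDerivWithinAt.congr_deriv h3 ?_
    change v ⬝ᵥ (((J₀ n)ᵀ * _) *ᵥ v) = _
    rw [smul_neg, neg_neg]
  have hmono := strictMonoOn_of_hasDerivWithinAt_pos (convex_Icc 0 b)
    (fun t ht => (hder t ht).continuousWithinAt)
    (fun t ht => (hder t (interior_subset ht)).mono interior_subset) (fun t ht => ?_)
  · have := hmono hs ht hst
    rw [sub_mulVec, dotProduct_sub, cayForm_eq (hd t ht), cayForm_eq (hd s hs)]
    exact sub_pos.2 this
  · have ht' := interior_subset ht
    set W := (c t).proj with hW
    have hdt := hd t ht'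
    change 0 < v ⬝ᵥ (((J₀ n)ᵀ * ((2 : ℝ) • (((W : Mat n) + 1)⁻¹ * (X t * (W : Mat n)) *
        ((W : Mat n) + 1)⁻¹))) *ᵥ v)
    set u := ((W : Mat n) + 1)⁻¹ *ᵥ v with hu
    have hvu : v = ((W : Mat n) + 1) *ᵥ u := by
      rw [hu, mulVec_mulVec, mul_nonsing_inv _ hdt.isUnit, one_mulVec]
    clear_value u
    have hWu : (W : Mat n) *ᵥ u ≠ 0 := by
      intro h
      have h1 := congrArg (fun x => ((W⁻¹ : Sp n) : Mat n) *ᵥ x) h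
      simp only [mulVec_mulVec, Sp.inv_mul_coe, one_mulVec, mulVec_zero] at h1
      rw [h1, mulVec_zero] at hvu
      exact hv hvu
    have hJ : ((W : Mat n) + 1)ᵀ * (J₀ n)ᵀ = (J₀ n)ᵀ * (((W⁻¹ : Sp n) : Mat n) * ((W : Mat n) + 1)) := by
      have h1 := W.J_transpose_mul
      have h2 : (W : Mat n)ᵀ * (J₀ n)ᵀ = (J₀ n)ᵀ * ((W⁻¹ : Sp n) : Mat n) := by
        have h3 := (W⁻¹).J_transpose_mul
        rw [inv_inv] at h3
        exact h3.symm
      rw [transpose_add, transpose_one, Matrix.add_mul, h2, Matrix.mul_add, Matrix.mul_add,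
        Sp.inv_mul_coe, Matrix.one_mul, Matrix.mul_one, Matrix.mul_one, add_comm]
    have hJ2 : (J₀ n)ᵀ * ((W⁻¹ : Sp n) : Mat n) = (W : Mat n)ᵀ * (J₀ n)ᵀ := by
      have h3 := (W⁻¹).J_transpose_mul
      rwa [inv_inv] at h3
    have e : ((W : Mat n) + 1)ᵀ * ((J₀ n)ᵀ * ((2 : ℝ) • (((W : Mat n) + 1)⁻¹ * (X t * (W : Mat n)) *
        ((W : Mat n) + 1)⁻¹))) * ((W : Mat n) + 1) = (2 : ℝ) • ((W : Mat n)ᵀ * form (X t) * (W : Mat n)) := by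
      rw [← Matrix.mul_assoc, hJ, Matrix.mul_smul, Matrix.smul_mul]
      congr 1
      calc _ = (J₀ n)ᵀ * ((W⁻¹ : Sp n) : Mat n) * (((W : Mat n) + 1) * ((W : Mat n) + 1)⁻¹) *
            (X t * (W : Mat n)) * (((W : Mat n) + 1)⁻¹ * ((W : Mat n) + 1)) := by
            simp only [Matrix.mul_assoc]
        _ = _ := by
            rw [mul_nonsing_inv _ hdt.isUnit, nonsing_inv_mul _ hdt.isUnit, hJ2, form]
            simp only [Matrix.mul_assoc, Matrix.mul_one]
    have hpos := (posDef_iff_real.1 (hX t ht')).2 _ hWu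
    have e2 : v ⬝ᵥ (((J₀ n)ᵀ * ((2 : ℝ) • (((W : Mat n) + 1)⁻¹ * (X t * (W : Mat n)) *
        ((W : Mat n) + 1)⁻¹))) *ᵥ v) = 2 * (((W : Mat n) *ᵥ u) ⬝ᵥ (form (X t) *ᵥ ((W : Mat n) *ᵥ u))) := by
      generalize hK : (J₀ n)ᵀ * ((2 : ℝ) • (((W : Mat n) + 1)⁻¹ * (X t * (W : Mat n)) *
        ((W : Mat n) + 1)⁻¹)) = K at e ⊢
      rw [hvu, ← dotProduct_transpose_mulVec, mulVec_mulVec, mulVec_mulVec, e,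
        smul_mulVec, dotProduct_smul, ← dotProduct_transpose_mulVec, mulVec_mulVec, mulVec_mulVec,
        smul_eq_mul, Matrix.mul_assoc]
    rw [e2]
    positivity

/-! ### The dichotomy for timelike curves -/

theorem cayForm_one : cayForm (1 : Mat n) = 0 := by
  simp [cayForm]

theorem det_one_add_one_ne_zero : ((1 : Mat n) + 1).det ≠ 0 := by
  have h : (1 : Mat n) + 1 = (2 : ℝ) • (1 : Mat n) := by module
  rw [h, det_smul, det_one]
  simp

/-- The Cayley form starts at 0 and increases strictly, so it is positive definite afterwards; this
is ellipticity as long as -1 is not an eigenvalue. -/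
theorem HasVel.elliptic_of_det_ne_zero {c : ℝ → SpTilde n} {X : ℝ → Mat n} {b : ℝ}
    (hc : HasVel c (Icc 0 b) X) (hX : ∀ t ∈ Icc 0 b, (form (X t)).PosDef) (h0 : c 0 = 1)
    (hd : ∀ t ∈ Icc 0 b, (((c t).proj : Mat n) + 1).det ≠ 0) {t : ℝ} (ht : t ∈ Ioc 0 b) :
    (c t).proj ∈ SpEll n ∧ c t = princ (c t).proj := by
  have h0' : (c 0).proj = 1 := by rw [h0]; exact (SpTilde.projHom n).map_one
  have hell : ∀ t ∈ Ioc 0 b, (c t).proj ∈ SpEll n := by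
    intro t ht
    have h1 := hc.cayForm_strictMono hX hd (s := 0) (t := t) ⟨le_rfl, ht.1.le.trans ht.2⟩
      ⟨ht.1.le, ht.2⟩ ht.1
    rw [h0', OneMemClass.coe_one, cayForm_one, sub_zero] at h1
    exact (cayForm_posDef_iff (hd t ⟨ht.1.le, ht.2⟩)).1 h1
  refine ⟨hell t ht, ?_⟩
  refine eq_princ_of_continuousOn isPreconnected_Icc hc.1 (fun s hs => ?_)
    (x₀ := 0) ⟨le_rfl, ht.1.le.trans ht.2⟩ ?_ t ⟨ht.1.le, ht.2⟩
  · rcases hs.1.eq_or_lt with h | h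
    · rw [← h, h0']
      exact one_mem_sclDom
    · exact SpEll_subset_sclDom (hell s ⟨h, hs.2⟩)
  · rw [h0', h0, princ_one]

/-- Completing the square: x is the vector representing, in the form of W, the linear term created
by the shear. Only the factor 2 - l β, with β the value of the form on x, can destroy positivity. -/
theorem omegaForm_mul_shear {W : Sp n} {x y v : Fin n ⊕ Fin n → ℝ} {l : ℝ}
    (hx : omegaForm (W : Mat n) *ᵥ x = (J₀ n)ᵀ *ᵥ (((W : Mat n) + 1) *ᵥ y)) :
    v ⬝ᵥ (omegaForm ((W : Mat n) * (1 + (-l) • vecMulVec (J₀ n *ᵥ (J₀ n *ᵥ y)) (J₀ n *ᵥ y))) *ᵥ v) =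
      (v + (l * ((J₀ n *ᵥ y) ⬝ᵥ v)) • x) ⬝ᵥ
        (omegaForm (W : Mat n) *ᵥ (v + (l * ((J₀ n *ᵥ y) ⬝ᵥ v)) • x)) +
      l * ((J₀ n *ᵥ y) ⬝ᵥ v) ^ 2 * (2 - l * (x ⬝ᵥ (omegaForm (W : Mat n) *ᵥ x))) := by
  set ν := J₀ n *ᵥ y with hν
  have hJν : J₀ n *ᵥ ν = -y := by rw [hν, mulVec_mulVec, J_mul_J, neg_mulVec, one_mulVec]
  set a := ν ⬝ᵥ v with ha
  have hT : (1 + (-l) • vecMulVec (J₀ n *ᵥ ν) ν) *ᵥ v = v + (l * a) • y := by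
    rw [hJν, add_mulVec, one_mulVec, smul_mulVec, vecMulVec_mulVec, ← ha]
    simp only [op_smul_eq_smul, smul_neg, smul_smul]
    module
  have hμ : (J₀ n)ᵀ *ᵥ ((W : Mat n) *ᵥ y) = omegaForm (W : Mat n) *ᵥ x + ν := by
    rw [hx, add_mulVec, one_mulVec, mulVec_add, hν, J_transpose', neg_mulVec, neg_mulVec]
    abel
  have hsymm : x ⬝ᵥ (omegaForm (W : Mat n) *ᵥ v) = v ⬝ᵥ (omegaForm (W : Mat n) *ᵥ x) := by
    rw [← omegaForm_transpose, dotProduct_transpose_mulVec, dotProduct_comm]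
    rw [omegaForm_transpose]
  have hva : v ⬝ᵥ ν = a := by rw [ha, dotProduct_comm]
  rw [omegaForm_apply, ← mulVec_mulVec, hT, mulVec_add, mulVec_add, mulVec_smul, mulVec_smul, hμ]
  have h1 := omegaForm_apply (W : Mat n) v
  simp only [mulVec_add, mulVec_smul, add_dotProduct, dotProduct_add, smul_dotProduct,
    dotProduct_smul, smul_eq_mul, hsymm, hva]
  linear_combination (-1 : ℝ) * h1

/-- If l β < 2, every shorter shear also keeps the matrix elliptic, so the curve of shears stays
among the principal lifts. -/
theorem mul_shear_mem_SpTildeEll {w : SpTilde n} (hw : w.proj ∈ SpEll n) (hp : w = princ w.proj)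
    {x y : Fin n ⊕ Fin n → ℝ} {l : ℝ} (hl : 0 ≤ l)
    (hx : omegaForm (w.proj : Mat n) *ᵥ x = (J₀ n)ᵀ *ᵥ (((w.proj : Mat n) + 1) *ᵥ y))
    (hlx : l * (x ⬝ᵥ (omegaForm (w.proj : Mat n) *ᵥ x)) < 2) :
    w * shear (J₀ n *ᵥ y) (-l) ∈ SpTildeEll n := by
  have hQ := posDef_iff_real.1 (mem_SpEll_iff.1 hw)
  have hβ : 0 ≤ x ⬝ᵥ (omegaForm (w.proj : Mat n) *ᵥ x) :=
    (posSemidef_iff_real.1 (mem_SpEll_iff.1 hw).posSemidef).2 x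
  have hell : ∀ s ∈ Icc 0 l, (w * shear (J₀ n *ᵥ y) (-s)).proj ∈ SpEll n := by
    intro s hs
    rw [mem_SpEll_iff, SpTilde.proj_mul, Sp.coe_mul, coe_proj_shear]
    refine posDef_iff_real.2 ⟨omegaForm_transpose _, fun v hv => ?_⟩
    rw [omegaForm_mul_shear hx]
    have hsβ : s * (x ⬝ᵥ (omegaForm (w.proj : Mat n) *ᵥ x)) < 2 :=
      (mul_le_mul_of_nonneg_right hs.2 hβ).trans_lt hlx
    by_cases ha : s * ((J₀ n *ᵥ y) ⬝ᵥ v) = 0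
    · rw [ha, zero_smul, add_zero, sq, ← mul_assoc, ha, zero_mul, zero_mul, add_zero]
      exact hQ.2 v hv
    · have h1 := (posSemidef_iff_real.1 (mem_SpEll_iff.1 hw).posSemidef).2
        (v + (s * ((J₀ n *ᵥ y) ⬝ᵥ v)) • x)
      have hs0 : 0 < s := hs.1.lt_of_ne fun h => ha (by rw [← h, zero_mul])
      have ha0 : 0 < ((J₀ n *ᵥ y) ⬝ᵥ v) ^ 2 := by
        have : (J₀ n *ᵥ y) ⬝ᵥ v ≠ 0 := fun h => ha (by rw [h, mul_zero])
        positivity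
      have : 0 < s * ((J₀ n *ᵥ y) ⬝ᵥ v) ^ 2 *
          (2 - s * (x ⬝ᵥ (omegaForm (w.proj : Mat n) *ᵥ x))) :=
        mul_pos (mul_pos hs0 ha0) (by linarith)
      linarith
  have h := eq_princ_of_continuousOn (isPreconnected_Icc (a := 0) (b := l))
    (c := fun s => w * shear (J₀ n *ᵥ y) (-s))
    (continuous_const.mul ((continuous_shear _).comp continuous_neg)).continuousOn
    (fun s hs => SpEll_subset_sclDom (hell s hs)) (x₀ := 0) ⟨le_rfl, hl⟩
    (by simpa using hp) l ⟨hl, le_rfl⟩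
  rw [mem_SpTildeEll_iff]
  exact ⟨_, hell l ⟨hl, le_rfl⟩, h.symm⟩

/-- If W z = z at time b, then ω₀(z, Wz) = 0. By monotonicity, in the limit t → b, this value
dominates the Cayley form at time b/2 evaluated at (W + 1)z = 2z, which is positive. -/
theorem HasVel.det_sub_one_ne_zero {c : ℝ → SpTilde n} {X : ℝ → Mat n} {b : ℝ}
    (hc : HasVel c (Icc 0 b) X) (hX : ∀ t ∈ Icc 0 b, (form (X t)).PosDef) (h0 : c 0 = 1)
    (hb : 0 < b) (hd : ∀ t ∈ Ico 0 b, (((c t).proj : Mat n) + 1).det ≠ 0) :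
    (((c b).proj : Mat n) - 1).det ≠ 0 := by
  intro hdet
  obtain ⟨z, hz, hz1⟩ := exists_mulVec_eq_zero_iff.2 hdet
  have hz2 : ((c b).proj : Mat n) *ᵥ z = z := by
    rw [sub_mulVec, one_mulVec] at hz1
    exact sub_eq_zero.1 hz1
  have hb2 : b / 2 ∈ Ioc 0 (b / 2) := ⟨by positivity, le_rfl⟩
  have hsub : ∀ {r}, r < b → Icc 0 r ⊆ Icc 0 b := fun h => Icc_subset_Icc_right h.le
  have hhalf : b / 2 < b := by linarith
  have hA : (cayForm ((c (b / 2)).proj : Mat n)).PosDef := by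
    have := ((hc.mono (hsub hhalf)).elliptic_of_det_ne_zero (fun t ht => hX t (hsub hhalf ht)) h0
      (fun t ht => hd t ⟨ht.1, ht.2.trans_lt hhalf⟩) hb2).1
    exact (cayForm_posDef_iff (hd _ ⟨by positivity, hhalf⟩)).2 this
  have hcont : ContinuousWithinAt (fun t => ((c t).proj : Mat n)) (Ioo (b / 2) b) b :=
    (hc.continuousOn_proj b ⟨hb.le, le_rfl⟩).mono fun t ht =>
      ⟨by linarith [ht.1], ht.2.le⟩
  have hne : (𝓝[Ioo (b / 2) b] b).NeBot := by
    rw [nhdsWithin_Ioo_eq_nhdsLT hhalf]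
    infer_instance
  have hlim : z ⬝ᵥ ((((c b).proj : Mat n) + 1)ᵀ * cayForm ((c (b / 2)).proj : Mat n) *
      (((c b).proj : Mat n) + 1)) *ᵥ z ≤ z ⬝ᵥ (omegaForm ((c b).proj : Mat n) *ᵥ z) := by
    refine le_of_tendsto_of_tendsto (f := fun t => z ⬝ᵥ ((((c t).proj : Mat n) + 1)ᵀ *
      cayForm ((c (b / 2)).proj : Mat n) * (((c t).proj : Mat n) + 1)) *ᵥ z)
      (g := fun t => z ⬝ᵥ (omegaForm ((c t).proj : Mat n) *ᵥ z))
      (b := 𝓝[Ioo (b / 2) b] b) ?_ ?_ ?_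
    · have : Continuous fun M : Mat n => z ⬝ᵥ ((M + 1)ᵀ *
          cayForm ((c (b / 2)).proj : Mat n) * (M + 1)) *ᵥ z := by fun_prop
      exact this.continuousAt.comp_continuousWithinAt hcont
    · have : Continuous fun M : Mat n => z ⬝ᵥ (omegaForm M *ᵥ z) := by
        have := continuous_omegaForm (n := n)
        fun_prop
      exact this.continuousAt.comp_continuousWithinAt hcont
    · filter_upwards [self_mem_nhdsWithin] with t ht
      have h1 := (hc.mono (hsub ht.2)).cayForm_strictMono (fun s hs => hX s (hsub ht.2 hs))
        (fun s hs => hd s ⟨hs.1, hs.2.trans_lt ht.2⟩) (s := b / 2) (t := t)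
        ⟨by positivity, ht.1.le⟩ ⟨by linarith [ht.1], le_rfl⟩ ht.1
      have h2 := (posSemidef_iff_real.1 h1.posSemidef).2 ((((c t).proj : Mat n) + 1) *ᵥ z)
      rw [← omegaForm_eq_cayForm (hd t ⟨by linarith [ht.1], ht.2⟩), ← mulVec_mulVec,
        ← mulVec_mulVec, ← mulVec_mulVec, ← mulVec_mulVec, dotProduct_transpose_mulVec,
        dotProduct_transpose_mulVec]
      rw [sub_mulVec, dotProduct_sub] at h2
      linarith
  rw [omegaForm_apply, hz2, dotProduct_J_self, ← mulVec_mulVec, ← mulVec_mulVec,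
    dotProduct_transpose_mulVec, add_mulVec, hz2, one_mulVec] at hlim
  have h1 := (posDef_iff_real.1 hA).2 (z + z) (by
    rw [← two_smul ℝ z]; exact smul_ne_zero two_ne_zero hz)
  linarith

/-- Let y be an eigenvector for -1 at the first time b when this eigenvalue appears, and shear along
ν = J₀ y. The obstruction β of `omegaForm_mul_shear` contains the factor (W + 1) y, which tends to 0
as t → b, so a shear of any given length can be removed shortly before b. -/
theorem HasVel.crossing {c : ℝ → SpTilde n} {X : ℝ → Mat n} {b : ℝ}
    (hc : HasVel c (Icc 0 b) X) (hX : ∀ t ∈ Icc 0 b, (form (X t)).PosDef) (h0 : c 0 = 1)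
    (hb : 0 < b) (hd : ∀ t ∈ Ico 0 b, (((c t).proj : Mat n) + 1).det ≠ 0)
    (hd1 : (((c b).proj : Mat n) + 1).det = 0) :
    ∃ ν : Fin n ⊕ Fin n → ℝ, ν ≠ 0 ∧ ∀ l, 0 ≤ l → ∃ t ∈ Ioo 0 b,
      c t * shear ν (-l) ∈ SpTildeEll n := by
  have hd2 := hc.det_sub_one_ne_zero hX h0 hb hd
  obtain ⟨y, hy, hy1⟩ := exists_mulVec_eq_zero_iff.2 hd1
  refine ⟨J₀ n *ᵥ y, fun h => hy ?_, fun l hl => ?_⟩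
  · have := congrArg (fun z => J₀ n *ᵥ z) h
    simpa [mulVec_mulVec, J_mul_J, neg_mulVec] using this
  have hcont : ContinuousWithinAt (fun t => ((c t).proj : Mat n)) (Ioo 0 b) b :=
    (hc.continuousOn_proj b ⟨hb.le, le_rfl⟩).mono Ioo_subset_Icc_self
  have hne : (𝓝[Ioo 0 b] b).NeBot := by
    rw [nhdsWithin_Ioo_eq_nhdsLT hb]
    infer_instance
  -- The solution of Q x = J₀ᵀ (W + 1) y: since Q = J₀ᵀ (W - W⁻¹), one may take W (W - 1)⁻¹ y, which
  -- remains bounded near b because 1 is not an eigenvalue there.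
  let x : Mat n → Fin n ⊕ Fin n → ℝ := fun M => (M * (M - 1)⁻¹) *ᵥ y
  have hxc : ContinuousAt x ((c b).proj : Mat n) := by
    have h1 : ContinuousAt (fun M : Mat n => (M - 1)⁻¹) ((c b).proj : Mat n) :=
      (continuousAt_inv_mat hd2).comp (f := fun M : Mat n => M - 1) (by fun_prop)
    have h2 : Continuous fun p : Mat n × Mat n => (p.1 * p.2) *ᵥ y := by fun_prop
    exact h2.continuousAt.comp (f := fun M : Mat n => (M, (M - 1)⁻¹)) (continuousAt_id.prodMk h1)
  have hlim : Tendsto (fun t => l * (x ((c t).proj : Mat n) ⬝ᵥ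
      ((J₀ n)ᵀ *ᵥ ((((c t).proj : Mat n) + 1) *ᵥ y)))) (𝓝[Ioo 0 b] b) (𝓝 0) := by
    have h2 : ContinuousAt (fun M : Mat n => l * (x M ⬝ᵥ ((J₀ n)ᵀ *ᵥ ((M + 1) *ᵥ y))))
        ((c b).proj : Mat n) := by
      have h3 : Continuous fun p : (Fin n ⊕ Fin n → ℝ) × Mat n =>
        l * (p.1 ⬝ᵥ ((J₀ n)ᵀ *ᵥ ((p.2 + 1) *ᵥ y))) := by fun_prop
      exact h3.continuousAt.comp (f := fun M : Mat n => (x M, M)) (hxc.prodMk continuousAt_id)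
    have h4 := h2.tendsto.comp hcont
    rw [hy1, mulVec_zero, dotProduct_zero, mul_zero] at h4
    exact h4
  obtain ⟨t, htl, ht⟩ := ((hlim.eventually (gt_mem_nhds two_pos)).and self_mem_nhdsWithin).exists
  have hsub : Icc 0 t ⊆ Icc 0 b := Icc_subset_Icc_right ht.2.le
  obtain ⟨hell, hpr⟩ := (hc.mono hsub).elliptic_of_det_ne_zero (fun s hs => hX s (hsub hs)) h0
    (fun s hs => hd s ⟨hs.1, hs.2.trans_lt ht.2⟩) (t := t) ⟨ht.1, le_rfl⟩
  have hdt : (((c t).proj : Mat n) - 1).det ≠ 0 :=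
    (hc.mono hsub).det_sub_one_ne_zero (fun s hs => hX s (hsub hs)) h0 ht.1
      (fun s hs => hd s ⟨hs.1, hs.2.trans ht.2⟩)
  have hx : omegaForm ((c t).proj : Mat n) *ᵥ x ((c t).proj : Mat n) =
      (J₀ n)ᵀ *ᵥ ((((c t).proj : Mat n) + 1) *ᵥ y) := by
    generalize (c t).proj = W at hdt ⊢
    have h1 : omegaForm (W : Mat n) = (J₀ n)ᵀ * ((W : Mat n) - ((W⁻¹ : Sp n) : Mat n)) := by
      rw [← J_mul_omegaForm, ← Matrix.mul_assoc, J_transpose', Matrix.neg_mul, J_mul_J, neg_neg,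
        Matrix.one_mul]
    have h2 : ((W : Mat n) - ((W⁻¹ : Sp n) : Mat n)) * ((W : Mat n) * ((W : Mat n) - 1)⁻¹) =
        (W : Mat n) + 1 := by
      rw [← Matrix.mul_assoc, Matrix.sub_mul, Sp.inv_mul_coe]
      have : (W : Mat n) * (W : Mat n) - 1 = ((W : Mat n) + 1) * ((W : Mat n) - 1) := by
        noncomm_ring
      rw [this, Matrix.mul_assoc, mul_nonsing_inv _ hdt.isUnit, Matrix.mul_one]
    rw [h1]
    simp only [x]
    rw [mulVec_mulVec, mulVec_mulVec, Matrix.mul_assoc, h2]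
  refine ⟨t, ht, mul_shear_mem_SpTildeEll hell hpr hl hx ?_⟩
  rw [hx]
  exact htl

theorem HasVel.elliptic_or_crossing {c : ℝ → SpTilde n} {X : ℝ → Mat n}
    (hc : HasVel c (Icc 0 1) X) (hX : ∀ t ∈ Icc (0 : ℝ) 1, (form (X t)).PosDef) (h0 : c 0 = 1) :
    (∀ t ∈ Ioc (0 : ℝ) 1, c t ∈ SpTildeEll n) ∨
      ∃ ν : Fin n ⊕ Fin n → ℝ, ν ≠ 0 ∧ ∀ l, 0 ≤ l → ∃ t ∈ Ioo (0 : ℝ) 1,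
        c t * shear ν (-l) ∈ SpTildeEll n := by
  by_cases hd : ∀ t ∈ Icc (0 : ℝ) 1, (((c t).proj : Mat n) + 1).det ≠ 0
  · refine Or.inl fun t ht => mem_SpTildeEll_iff.2 ?_
    obtain ⟨h1, h2⟩ := hc.elliptic_of_det_ne_zero hX h0 hd ht
    exact ⟨_, h1, h2.symm⟩
  right
  push Not at hd
  have hcont : ContinuousOn (fun t => (((c t).proj : Mat n) + 1).det) (Icc 0 1) := by
    have h1 : Continuous fun M : Mat n => (M + 1).det := by fun_prop
    exact h1.comp_continuousOn hc.continuousOn_proj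
  have hcomp : IsCompact (Icc (0 : ℝ) 1 ∩ (fun t => (((c t).proj : Mat n) + 1).det) ⁻¹' {0}) :=
    isCompact_Icc.of_isClosed_subset (hcont.preimage_isClosed_of_isClosed isClosed_Icc
      isClosed_singleton) inter_subset_left
  obtain ⟨t, ht, ht1⟩ := hd
  -- The first time at which -1 is an eigenvalue; it is positive because the curve starts at the
  -- identity.
  obtain ⟨b, ⟨hb, hb1⟩, hmin⟩ := hcomp.exists_isLeast ⟨t, ht, ht1⟩
  have hd' : ∀ t ∈ Ico 0 b, (((c t).proj : Mat n) + 1).det ≠ 0 := fun t ht h =>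
    absurd (hmin ⟨⟨ht.1, ht.2.le.trans hb.2⟩, h⟩) (not_le.2 ht.2)
  have hb0 : 0 < b := by
    refine hb.1.lt_of_ne fun h => ?_
    rw [mem_preimage, mem_singleton_iff, ← h, h0,
      show (1 : SpTilde n).proj = 1 from (SpTilde.projHom n).map_one] at hb1
    exact det_one_add_one_ne_zero hb1
  have hsub : Icc 0 b ⊆ Icc (0 : ℝ) 1 := Icc_subset_Icc_right hb.2
  obtain ⟨ν, hν, h⟩ := (hc.mono hsub).crossing (fun s hs => hX s (hsub hs)) h0 hb0 hd' hb1
  refine ⟨ν, hν, fun l hl => ?_⟩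
  obtain ⟨t, ht, htl⟩ := h l hl
  exact ⟨t, ⟨ht.1, ht.2.trans_le hb.2⟩, htl⟩

/-! ### Shears are not bounded by rotations of angle less than `π` -/

theorem J_eq_fromBlocks : J₀ n = fromBlocks 0 (-1) 1 0 := rfl

/-- The diagonal unitary matrix with entries `exp(i t α_j)`. -/
def diagRotMat (α : Fin n → ℝ) (t : ℝ) : Mat n :=
  fromBlocks (Matrix.diagonal fun j => Real.cos (t * α j))
    (-Matrix.diagonal fun j => Real.sin (t * α j))
    (Matrix.diagonal fun j => Real.sin (t * α j)) (Matrix.diagonal fun j => Real.cos (t * α j))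

theorem diagRotMat_mem (α : Fin n → ℝ) (t : ℝ) :
    diagRotMat α t ∈ symplecticGroup (Fin n) ℝ := by
  rw [mem_sp, diagRotMat, J_eq_fromBlocks, fromBlocks_transpose, fromBlocks_multiply,
    fromBlocks_multiply]
  simp only [diagonal_transpose, Matrix.mul_zero, Matrix.mul_one, Matrix.mul_neg,
    zero_add, add_zero, diagonal_mul_diagonal, neg_neg, diagonal_neg, diagonal_add]
  congr 1
  · rw [← diagonal_zero]; congr 1; ext j; ring
  · rw [← diagonal_one, diagonal_neg]; congr 1; ext j
    have := Real.sin_sq_add_cos_sq (t * α j)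
    linear_combination -this
  · rw [← diagonal_one]; congr 1; ext j
    have := Real.sin_sq_add_cos_sq (t * α j)
    linear_combination this
  · rw [← diagonal_zero]; congr 1; ext j
    ring

/-- The diagonal unitary matrix with entries `exp(i t α_j)`, in the symplectic group. -/
def diagRotSp (α : Fin n → ℝ) (t : ℝ) : Sp n := ⟨diagRotMat α t, diagRotMat_mem α t⟩

theorem continuous_diagRotSp (α : Fin n → ℝ) : Continuous (diagRotSp α) := by
  refine Continuous.subtype_mk ?_ _
  unfold diagRotMat
  fun_prop

theorem diagRotSp_zero (α : Fin n → ℝ) : diagRotSp α 0 = 1 := by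
  refine Subtype.ext ?_
  simp [diagRotSp, diagRotMat]

theorem diagRotMat_commute_J (α : Fin n → ℝ) (t : ℝ) :
    diagRotMat α t * J₀ n = J₀ n * diagRotMat α t := by
  rw [diagRotMat, J_eq_fromBlocks, fromBlocks_multiply, fromBlocks_multiply]
  simp

theorem exists_UTilde_diagRot (α : Fin n → ℝ) :
    ∃ u ∈ UTilde n, (u.proj : Mat n) = diagRotMat α 1 := by
  have h : ((liftCurve (diagRotSp α) (continuous_diagRotSp α) (diagRotSp_zero α) 1).proj : Mat n) =
      diagRotMat α 1 := by
    rw [proj_liftCurve]; rfl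
  refine ⟨_, mem_UTilde_of_commute_J ?_, h⟩
  rw [h, diagRotMat_commute_J]

/-- Each complex coordinate of ν is rotated back by its argument and becomes real. -/
theorem exists_diagRot_mulVec (ν : Fin n ⊕ Fin n → ℝ) :
    ∃ α : Fin n → ℝ, ∀ j, (diagRotMat α 1 *ᵥ ν) (Sum.inr j) = 0 := by
  refine ⟨fun j => -(⟨ν (Sum.inl j), ν (Sum.inr j)⟩ : ℂ).arg, fun j => ?_⟩
  set z : ℂ := ⟨ν (Sum.inl j), ν (Sum.inr j)⟩ with hz
  have h1 : ν (Sum.inl j) = ‖z‖ * Real.cos z.arg := (Complex.norm_mul_cos_arg z).symm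
  have h2 : ν (Sum.inr j) = ‖z‖ * Real.sin z.arg := (Complex.norm_mul_sin_arg z).symm
  rw [diagRotMat, fromBlocks_mulVec, Sum.elim_inr, Pi.add_apply, mulVec_diagonal, mulVec_diagonal,
    Function.comp_apply, Function.comp_apply, ← hz, h1, h2, one_mul, Real.sin_neg, Real.cos_neg]
  ring

theorem unitary_mul_rot {u : SpTilde n} (hu : u ∈ UTilde n) (t : ℝ) : u * rot t * u⁻¹ = rot t := by
  have := eqOn_of_proj_eq (c := fun t => u * rot t * u⁻¹) (d := fun t => rot t)
    isPreconnected_univ ((continuous_const.mul continuous_rot).mul continuous_const).continuousOn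
    continuous_rot.continuousOn (fun t _ => ?_) (mem_univ 0) (by simp [rot_zero])
  · exact this t trivial
  · have h := UTilde.commute_J hu
    have h2 := Sp.mul_inv_coe u.proj
    refine Subtype.ext ?_
    rw [SpTilde.proj_mul, SpTilde.proj_mul, SpTilde.proj_inv, Sp.coe_mul, Sp.coe_mul, coe_proj_rot,
      Matrix.mul_add, Matrix.mul_smul, Matrix.mul_smul, h, Matrix.mul_one, Matrix.add_mul,
      Matrix.smul_mul, Matrix.smul_mul, h2, Matrix.mul_assoc, h2, Matrix.mul_one]

theorem unitary_mul_shear {u : SpTilde n} (hu : u ∈ UTilde n) (ν : Fin n ⊕ Fin n → ℝ) (l : ℝ) :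
    u * shear ν l * u⁻¹ = shear ((u.proj : Mat n) *ᵥ ν) l := by
  have := eqOn_of_proj_eq (c := fun t => u * shear ν t * u⁻¹)
    (d := fun t => shear ((u.proj : Mat n) *ᵥ ν) t)
    isPreconnected_univ
    ((continuous_const.mul (continuous_shear ν)).mul continuous_const).continuousOn
    (continuous_shear _).continuousOn (fun t _ => ?_) (mem_univ 0) (by simp)
  · exact this l trivial
  · have h := UTilde.commute_J hu
    have h2 := Sp.mul_inv_coe u.proj
    have h3 : (u.proj : Mat n)ᵀ * (u.proj : Mat n) = 1 := by
      have h4 : (u.proj : Mat n) ∈ orthogonalGroup (Fin n ⊕ Fin n) ℝ := hu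
      exact (mem_orthogonalGroup_iff' _ _).1 h4
    have h5 : ((u.proj⁻¹ : Sp n) : Mat n) = (u.proj : Mat n)ᵀ := by
      rw [← Matrix.one_mul ((u.proj⁻¹ : Sp n) : Mat n), ← h3, Matrix.mul_assoc, h2, Matrix.mul_one]
    refine Subtype.ext ?_
    rw [SpTilde.proj_mul, SpTilde.proj_mul, SpTilde.proj_inv, Sp.coe_mul, Sp.coe_mul,
      coe_proj_shear, coe_proj_shear, Matrix.mul_add, Matrix.add_mul, Matrix.mul_one, h2,
      Matrix.mul_smul, Matrix.smul_mul, mul_vecMulVec, vecMulVec_mul, mulVec_mulVec, mulVec_mulVec,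
      h, h5, vecMul_transpose]

/-- The symplectic squeezing `(x, y) ↦ (eᵗ x, e⁻ᵗ y)`. -/
def squeezeMat (t : ℝ) : Mat n :=
  fromBlocks (Real.exp t • (1 : Matrix (Fin n) (Fin n) ℝ)) 0 0
    (Real.exp (-t) • (1 : Matrix (Fin n) (Fin n) ℝ))

theorem squeezeMat_mem (t : ℝ) : squeezeMat t ∈ symplecticGroup (Fin n) ℝ := by
  rw [mem_sp, squeezeMat, J_eq_fromBlocks, fromBlocks_transpose, fromBlocks_multiply,
    fromBlocks_multiply]
  simp [← Real.exp_add, smul_smul]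

/-- The symplectic squeezing `(x, y) ↦ (eᵗ x, e⁻ᵗ y)`, in the symplectic group. -/
def squeezeSp (t : ℝ) : Sp n := ⟨squeezeMat t, squeezeMat_mem t⟩

theorem continuous_squeezeSp : Continuous (squeezeSp (n := n)) := by
  refine Continuous.subtype_mk ?_ _
  unfold squeezeMat
  fun_prop

theorem squeezeSp_zero : squeezeSp 0 = (1 : Sp n) := by
  refine Subtype.ext ?_
  simp [squeezeSp, squeezeMat]

theorem exists_squeeze (t : ℝ) : ∃ S : SpTilde n, (S.proj : Mat n) = squeezeMat t := by
  refine ⟨liftCurve squeezeSp continuous_squeezeSp squeezeSp_zero t, ?_⟩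
  rw [proj_liftCurve]; rfl

theorem det_smul_one_add_vecMulVec {α : ℂ} (hα : α ≠ 0) (β : ℂ) (hn : 1 ≤ n) (u v : Fin n → ℂ) :
    (α • (1 : Matrix (Fin n) (Fin n) ℂ) + β • vecMulVec u v).det =
      α ^ (n - 1) * (α + β * (v ⬝ᵥ u)) := by
  have h : α • (1 : Matrix (Fin n) (Fin n) ℂ) + β • vecMulVec u v =
      α • (1 + replicateCol Unit ((β / α) • u) * replicateRow Unit v) := by
    ext i j
    simp [vecMulVec_apply, Matrix.mul_apply]
    field_simp
  obtain ⟨m, rfl⟩ : ∃ m, n = m + 1 := ⟨n - 1, by omega⟩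
  rw [h, det_smul, det_one_add_replicateCol_mul_replicateRow, Fintype.card_fin, dotProduct_smul,
    smul_eq_mul, Nat.add_sub_cancel]
  field_simp
  ring

/-- For ν with real coordinates the complex matrix is a scalar plus a rank one matrix. Its
determinant has n - 1 equal factors and one factor that feels the shear, each with an explicit
arctangent as argument. -/
theorem complexDet_squeeze_shear_rot (hn : 1 ≤ n) {ν : Fin n ⊕ Fin n → ℝ}
    (hν : ∀ j, ν (Sum.inr j) = 0) (t l : ℝ) {a : ℝ} (ha : 0 < Real.cos a) :
    complexDet (squeezeMat t * (1 + l • vecMulVec (J₀ n *ᵥ ν) ν) *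
      (Real.cos a • (1 : Mat n) + Real.sin a • J₀ n)) =
    ((Real.exp t * Real.cos a) ^ n * Real.sqrt (1 + (Real.exp (-(2 * t)) * Real.tan a) ^ 2) ^ (n - 1) *
      Real.sqrt (1 + (Real.exp (-(2 * t)) * (Real.tan a + l * (ν ⬝ᵥ ν))) ^ 2) : ℝ) *
    Complex.exp (((n - 1 : ℕ) * Real.arctan (Real.exp (-(2 * t)) * Real.tan a) +
      Real.arctan (Real.exp (-(2 * t)) * (Real.tan a + l * (ν ⬝ᵥ ν))) : ℝ) * Complex.I) := by
  set ρ : Fin n → ℝ := fun j => ν (Sum.inl j) with hρ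
  have hν' : ν = Sum.elim ρ 0 := by
    ext j; cases j <;> simp [hρ, hν]
  have hT : (1 : Mat n) + l • vecMulVec (J₀ n *ᵥ ν) ν = fromBlocks 1 0 (l • vecMulVec ρ ρ) 1 := by
    rw [← fromBlocks_one, hν', J_eq_fromBlocks, fromBlocks_mulVec]
    ext i j
    cases i <;> cases j <;> simp [vecMulVec_apply, Matrix.one_apply]
  have hR : Real.cos a • (1 : Mat n) + Real.sin a • J₀ n =
      fromBlocks (Real.cos a • 1) (-(Real.sin a • 1)) (Real.sin a • 1) (Real.cos a • 1) := by
    rw [← fromBlocks_one, J_eq_fromBlocks, fromBlocks_smul, fromBlocks_smul, fromBlocks_add]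
    simp
  have hνν : ν ⬝ᵥ ν = ρ ⬝ᵥ ρ := by
    rw [hν']; simp [dotProduct]
  have hca : (Real.cos a : ℂ) ≠ 0 := by exact_mod_cast ha.ne'
  have hexp : Real.exp (-t) = Real.exp t * Real.exp (-(2 * t)) := by
    rw [← Real.exp_add]; congr 1; ring
  have hsin : Real.sin a = Real.cos a * Real.tan a := by
    rw [mul_comm, Real.tan_mul_cos ha.ne']
  set τ := Real.exp (-(2 * t)) * Real.tan a with hτ
  set α : ℂ := (Real.exp t * Real.cos a : ℝ) * (1 + τ * Complex.I) with hα
  have hα0 : α ≠ 0 := by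
    rw [hα]
    refine mul_ne_zero ?_ ?_
    · exact_mod_cast (mul_pos (Real.exp_pos t) ha).ne'
    · have := one_sub_mul_I_ne_zero (-τ)
      simpa using this
  have hM : toC (squeezeMat t * (1 + l • vecMulVec (J₀ n *ᵥ ν) ν) *
      (Real.cos a • (1 : Mat n) + Real.sin a • J₀ n)) =
      α • (1 : Matrix (Fin n) (Fin n) ℂ) +
      ((Real.exp t * Real.cos a * (Real.exp (-(2 * t)) * l) : ℝ) * Complex.I : ℂ) •
        vecMulVec (fun j => (ρ j : ℂ)) (fun j => (ρ j : ℂ)) := by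
    rw [hT, hR, squeezeMat, fromBlocks_multiply, fromBlocks_multiply]
    ext i j
    rw [toC_apply]
    simp only [fromBlocks_apply₁₁, fromBlocks_apply₂₁, Matrix.add_apply, Matrix.smul_apply,
      vecMulVec_apply, hα, hexp, hsin, hτ, Matrix.mul_smul, Matrix.smul_mul, Matrix.mul_one,
      Matrix.one_mul, Matrix.mul_zero, Matrix.zero_mul, add_zero, zero_add, smul_eq_mul,
      Matrix.zero_apply, Matrix.one_apply, Matrix.add_mul]
    split_ifs
    · push_cast; ring
    · push_cast; ring
  rw [complexDet_eq, hM, det_smul_one_add_vecMulVec hα0 _ hn]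
  have hdot : ((fun j => (ρ j : ℂ)) ⬝ᵥ fun j => (ρ j : ℂ)) = ((ν ⬝ᵥ ν : ℝ) : ℂ) := by
    rw [hνν]; simp [dotProduct]
  have hsum : α + ((Real.exp t * Real.cos a * (Real.exp (-(2 * t)) * l) : ℝ) * Complex.I : ℂ) *
      ((ν ⬝ᵥ ν : ℝ) : ℂ) = (Real.exp t * Real.cos a : ℝ) *
        (1 + (Real.exp (-(2 * t)) * (Real.tan a + l * (ν ⬝ᵥ ν)) : ℝ) * Complex.I) := by
    rw [hα, hτ]; push_cast; ring
  rw [hdot, hsum, hα, one_add_mul_I, one_add_mul_I]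
  obtain ⟨m, rfl⟩ : ∃ m, n = m + 1 := ⟨n - 1, by omega⟩
  rw [Nat.add_sub_cancel]
  push_cast
  rw [add_mul, Complex.exp_add, mul_assoc (m : ℂ), Complex.exp_nat_mul]
  ring

/-- The explicit argument is continuous on the connected strip of all shear lengths and all angles
in (-π/2, π/2), and vanishes at the origin of the strip. -/
theorem phase_squeeze_shear_rot (hn : 1 ≤ n) {ν : Fin n ⊕ Fin n → ℝ}
    (hν : ∀ j, ν (Sum.inr j) = 0) {t : ℝ} {S : SpTilde n} (hS : (S.proj : Mat n) = squeezeMat t)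
    (l : ℝ) {a : ℝ} (ha : a ∈ Ioo (-(Real.pi / 2)) (Real.pi / 2)) :
    phase (S * shear ν l * rot a) - phase S =
      (n - 1 : ℕ) * Real.arctan (Real.exp (-(2 * t)) * Real.tan a) +
      Real.arctan (Real.exp (-(2 * t)) * (Real.tan a + l * (ν ⬝ᵥ ν))) := by
  have htan : ContinuousOn (fun p : ℝ × ℝ => Real.tan p.2)
      (univ ×ˢ Ioo (-(Real.pi / 2)) (Real.pi / 2)) :=
    Real.continuousOn_tan_Ioo.comp continuousOn_snd fun p hp => hp.2
  have h0 : (0 : ℝ) ∈ Ioo (-(Real.pi / 2)) (Real.pi / 2) := by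
    constructor <;> linarith [Real.pi_pos]
  have := phase_sub_phase (s := univ ×ˢ Ioo (-(Real.pi / 2)) (Real.pi / 2))
    (c := fun p : ℝ × ℝ => S * shear ν p.1 * rot p.2)
    (θ := fun p : ℝ × ℝ => (n - 1 : ℕ) * Real.arctan (Real.exp (-(2 * t)) * Real.tan p.2) +
      Real.arctan (Real.exp (-(2 * t)) * (Real.tan p.2 + p.1 * (ν ⬝ᵥ ν))))
    (isPreconnected_univ.prod isPreconnected_Ioo)
    (((continuous_const.mul ((continuous_shear ν).comp continuous_fst)).mul
      (continuous_rot.comp continuous_snd)).continuousOn)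
    (by
      refine ContinuousOn.add (continuousOn_const.mul (Real.continuous_arctan.comp_continuousOn
        (continuousOn_const.mul htan))) (Real.continuous_arctan.comp_continuousOn
        (continuousOn_const.mul (htan.add (by fun_prop))))) (r := fun p : ℝ × ℝ =>
      (Real.exp t * Real.cos p.2) ^ n *
        Real.sqrt (1 + (Real.exp (-(2 * t)) * Real.tan p.2) ^ 2) ^ (n - 1) *
      Real.sqrt (1 + (Real.exp (-(2 * t)) * (Real.tan p.2 + p.1 * (ν ⬝ᵥ ν))) ^ 2))
    (fun p hp => ?_) (fun p hp => ?_) (x := (0, 0)) (y := (l, a)) ⟨mem_univ _, h0⟩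
    ⟨mem_univ _, ha⟩
  · simpa [rot_zero] using this
  · have := Real.cos_pos_of_mem_Ioo hp.2
    positivity
  · rw [SpTilde.proj_mul, SpTilde.proj_mul, Sp.coe_mul, Sp.coe_mul, coe_proj_rot, coe_proj_shear,
      hS]
    exact complexDet_squeeze_shear_rot hn hν t p.1 (Real.cos_pos_of_mem_Ioo hp.2)

/-- After a unitary change, ν has real coordinates. A squeezing on the left makes the contributions
of the rotations to the phase small while a long shear still contributes a definite amount, which
contradicts the inequality of phases. -/
theorem not_forall_shear_le_rot {ν : Fin n ⊕ Fin n → ℝ} (hν0 : ν ≠ 0) {η : ℝ}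
    (hη : η ∈ Ioo 0 Real.pi) : ∃ l, 0 ≤ l ∧ ¬ le (shear ν l) (rot (Real.pi - η)) := by
  by_contra! hall
  obtain ⟨α, hα⟩ := exists_diagRot_mulVec ν
  obtain ⟨u, hu, hu1⟩ := exists_UTilde_diagRot α
  set ν' := (u.proj : Mat n) *ᵥ ν with hν'
  have hν'0 : ν' ≠ 0 := by
    intro h
    apply hν0
    have := congrArg (fun z => ((u.proj⁻¹ : Sp n) : Mat n) *ᵥ z) h
    simpa [hν', mulVec_mulVec, Sp.inv_mul_coe] using this
  have hν'r : ∀ j, ν' (Sum.inr j) = 0 := fun j => by rw [hν', hu1]; exact hα j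
  have hle : ∀ l, 0 ≤ l → le (shear ν' l) (rot (Real.pi - η)) := fun l hl => by
    have := ((hall l hl).mul_left u).mul_right u⁻¹
    rwa [unitary_mul_shear hu, unitary_mul_rot hu] at this
  have hn : 1 ≤ n := by
    rcases Nat.eq_zero_or_pos n with h | h
    · subst h
      exact absurd (Subsingleton.elim _ _) hν'0
    · exact h
  have hm : 0 < ν' ⬝ᵥ ν' := by
    have h1 : 0 ≤ ν' ⬝ᵥ ν' := Finset.sum_nonneg fun i _ => mul_self_nonneg _
    exact h1.lt_of_ne fun h => hν'0 (dotProduct_self_eq_zero.1 h.symm)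
  set a := (Real.pi - η) / 2 with ha
  have ha0 : 0 < a := by have := hη.2; rw [ha]; linarith
  have ha1 : a < Real.pi / 2 := by have := hη.1; rw [ha]; linarith
  set k := Real.tan a with hk
  have hk0 : 0 < k := Real.tan_pos_of_pos_of_lt_pi_div_two ha0 ha1
  have hnpos : (0 : ℝ) < n := by exact_mod_cast hn
  have h2nk : 0 < 2 * n * k := by positivity
  -- The squeezing multiplies tangents by exp(-2t) = 1/(2nk), so that each rotation contributes
  -- arctan(1/(2n)) per coordinate.
  set t := Real.log (2 * n * k) / 2 with ht
  have hexp : Real.exp (-(2 * t)) = (2 * n * k)⁻¹ := by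
    rw [ht, mul_div_cancel₀ _ two_ne_zero, Real.exp_neg, Real.exp_log h2nk]
  obtain ⟨S, hS⟩ := exists_squeeze (n := n) t
  -- Chosen so that the squeezed tangent of the sheared coordinate is exactly tan 1.
  set l := (k + 2 * n * k * Real.tan 1) / (ν' ⬝ᵥ ν') with hl
  have htan1 : 0 < Real.tan 1 :=
    Real.tan_pos_of_pos_of_lt_pi_div_two one_pos (by linarith [Real.pi_gt_three])
  have hl0 : 0 ≤ l := by positivity
  -- As π - η = 2a, multiplying by rot (-a) centres the comparison: the sheared side has angle -a
  -- and the other side angle a. The two phase formulas give 1 ≤ (2n - 1) arctan(1/(2n)) ≤ (2n -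
  -- 1)/(2n) < 1.
  have h1 := hle l hl0 S (rot (-a))
  have h2 := phase_squeeze_shear_rot hn hν'r hS l (a := -a) ⟨by linarith, by linarith⟩
  have h3 := phase_squeeze_shear_rot hn hν'r hS 0 (a := a) ⟨by linarith, ha1⟩
  rw [shear_zero, mul_one, zero_mul, add_zero] at h3
  rw [mul_assoc S (rot _), ← rot_add, show Real.pi - η + -a = a by rw [ha]; ring] at h1
  rw [Real.tan_neg, ← hk, hexp, mul_neg, Real.arctan_neg] at h2
  rw [← hk, hexp] at h3
  have h4 : (2 * n * k)⁻¹ * (-k + l * (ν' ⬝ᵥ ν')) = Real.tan 1 := by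
    rw [hl]; field_simp; ring
  rw [h4, Real.arctan_tan (by linarith [Real.pi_gt_three]) (by linarith [Real.pi_gt_three])] at h2
  have h5 : (2 * n * k)⁻¹ * k = 1 / (2 * n) := by field_simp
  rw [h5] at h2 h3
  have h6 : Real.arctan (1 / (2 * n)) ≤ 1 / (2 * n) := by
    have hpos : (0 : ℝ) ≤ 1 / (2 * n) := by positivity
    simpa [Real.tan_arctan] using Real.le_tan (Real.arctan_nonneg.2 hpos)
      (Real.arctan_lt_pi_div_two _)
  have h7 : ((n - 1 : ℕ) : ℝ) = n - 1 := by push_cast [Nat.cast_sub hn]; ring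
  rw [h7] at h2 h3
  have h8 : 1 ≤ (2 * n - 1) * Real.arctan (1 / (2 * n)) := by linarith
  have hn1 : (1 : ℝ) ≤ n := by exact_mod_cast hn
  have h9 : (2 * (n : ℝ) - 1) * Real.arctan (1 / (2 * n)) ≤ (2 * n - 1) * (1 / (2 * n)) :=
    mul_le_mul_of_nonneg_left h6 (by linarith)
  have h10 : (2 * (n : ℝ) - 1) * (1 / (2 * n)) < 1 := by
    rw [mul_one_div, div_lt_one (by positivity)]
    linarith
  linarith

/-- If the curve crossed, then for every l some c t would be an elliptic element times a shear of
length l. Elliptic elements are above 1, so every shear would be below c t, hence below c 1 and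
below a rotation of angle less than π. -/
theorem HasVel.elliptic_of_le_rot {c : ℝ → SpTilde n} {X : ℝ → Mat n}
    (hc : HasVel c (Icc 0 1) X) (hX : ∀ t ∈ Icc (0 : ℝ) 1, (form (X t)).PosDef) (h0 : c 0 = 1)
    {η : ℝ} (hη : η ∈ Ioo 0 Real.pi) (h1 : SympLorentz.le (c 1) (rot (Real.pi - η))) :
    ∀ t ∈ Ioc (0 : ℝ) 1, c t ∈ SpTildeEll n := by
  refine (hc.elliptic_or_crossing hX h0).resolve_right ?_
  rintro ⟨ν, hν, h⟩
  obtain ⟨l, hl, hnot⟩ := not_forall_shear_le_rot hν hη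
  obtain ⟨t, ht, htl⟩ := h l hl
  refine hnot (SympLorentz.le.trans ?_ (SympLorentz.le.trans ((hc.mono (Icc_subset_Icc_left ht.1.le)).le ht.2.le
    fun s hs => (hX s ⟨ht.1.le.trans hs.1, hs.2⟩).posSemidef) h1))
  obtain ⟨W, hW, hWe⟩ := mem_SpTildeEll_iff.1 htl
  have h2 := (one_le_princ hW).mul_right (shear ν l)
  rwa [hWe, one_mul, shear_neg, inv_mul_cancel_right] at h2

/-! ### Determinants of positive matrices -/

theorem det_form (X : Mat n) : (form X).det = X.det := by
  have h : (J₀ n).det = 1 := Sp.det_eq_one (Jsp n)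
  rw [form, det_mul, det_transpose, h, one_mul]

section
variable {m : Type*} [Fintype m] [DecidableEq m]

/-- Every eigenvalue is at most the trace, so the smallest one is at least the determinant divided
by the power of τ bounding the others. -/
theorem _root_.Matrix.PosSemidef.det_mul_le {Q : Matrix m m ℝ} (hQ : Q.PosSemidef) {τ : ℝ}
    (hτ : 0 < τ) (htr : Q.trace ≤ τ) (x : m → ℝ) :
    Q.det / τ ^ (Fintype.card m - 1) * (x ⬝ᵥ x) ≤ x ⬝ᵥ (Q *ᵥ x) := by
  have hle : ∀ i, hQ.isHermitian.eigenvalues i ≤ τ := by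
    intro i
    refine le_trans ?_ htr
    rw [hQ.isHermitian.trace_eq_sum_eigenvalues]
    exact Finset.single_le_sum (f := fun i => hQ.isHermitian.eigenvalues i)
      (fun j _ => hQ.eigenvalues_nonneg j) (Finset.mem_univ i)
  have h : algebraMap ℝ (Matrix m m ℝ) (Q.det / τ ^ (Fintype.card m - 1)) ≤ Q := by
    refine (algebraMap_le_iff_le_spectrum hQ.isHermitian).2 fun r hr => ?_
    rw [hQ.isHermitian.spectrum_real_eq_range_eigenvalues] at hr
    obtain ⟨i, rfl⟩ := hr
    rw [div_le_iff₀ (by positivity), hQ.isHermitian.det_eq_prod_eigenvalues,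
      ← Finset.mul_prod_erase _ _ (Finset.mem_univ i)]
    refine mul_le_mul_of_nonneg_left ?_ (hQ.eigenvalues_nonneg i)
    refine (Finset.prod_le_prod (fun j _ => hQ.eigenvalues_nonneg j) fun j _ => hle j).trans ?_
    rw [Finset.prod_const, Finset.card_erase_of_mem (Finset.mem_univ i), Finset.card_univ]
  have h1 := (posSemidef_iff_real.1 (Matrix.le_iff.1 h)).2 x
  rw [sub_mulVec, dotProduct_sub, Algebra.algebraMap_eq_smul_one, smul_mulVec, one_mulVec,
    dotProduct_smul, smul_eq_mul] at h1
  linarith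

/-- The arithmetic-geometric mean inequality for the eigenvalues. -/
theorem _root_.Matrix.PosSemidef.det_rpow_le_trace_div [Nonempty m] {Q : Matrix m m ℝ}
    (hQ : Q.PosSemidef) :
    Q.det ^ (1 / (Fintype.card m : ℝ)) ≤ Q.trace / Fintype.card m := by
  have hc : (0 : ℝ) < Fintype.card m := by exact_mod_cast Fintype.card_pos
  have h := Real.geom_mean_le_arith_mean_weighted Finset.univ
    (fun _ => 1 / (Fintype.card m : ℝ)) hQ.isHermitian.eigenvalues
    (fun _ _ => by positivity) (by simp [hc.ne']) (fun i _ => hQ.eigenvalues_nonneg i)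
  rw [Real.finsetProd_rpow _ _ (fun i _ => hQ.eigenvalues_nonneg i), ← Finset.mul_sum] at h
  rw [hQ.isHermitian.det_eq_prod_eigenvalues, hQ.isHermitian.trace_eq_sum_eigenvalues]
  refine h.trans (le_of_eq ?_)
  simp only [RCLike.ofReal_real_eq_id, id_eq]
  ring

theorem posDef_of_norm_sub_lt {B : Matrix m m ℝ} (hB : Bᵀ = B) {r : ℝ}
    (h : ‖B - r • (1 : Matrix m m ℝ)‖ < r) : B.PosDef := by
  refine posDef_iff_real.2 ⟨hB, fun x hx => ?_⟩
  set y : EuclideanSpace ℝ m := WithLp.toLp 2 x with hy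
  set D := B - r • (1 : Matrix m m ℝ) with hD
  have hpos : 0 < x ⬝ᵥ x := by
    have h1 : 0 ≤ x ⬝ᵥ x := Finset.sum_nonneg fun i _ => mul_self_nonneg _
    exact h1.lt_of_ne fun h => hx (dotProduct_self_eq_zero.1 h.symm)
  have hyy : ‖y‖ * ‖y‖ = x ⬝ᵥ x := by
    rw [← real_inner_self_eq_norm_mul_norm, hy, EuclideanSpace.inner_toLp_toLp]
    simp
  have h1 : |x ⬝ᵥ (D *ᵥ x)| ≤ ‖D‖ * (x ⬝ᵥ x) := by
    have h2 := Matrix.l2_opNorm_mulVec D y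
    have h3 := abs_real_inner_le_norm y (WithLp.toLp 2 (D *ᵥ x))
    rw [hy, EuclideanSpace.inner_toLp_toLp, star_trivial, dotProduct_comm, ← hy] at h3
    calc _ ≤ _ := h3
      _ ≤ ‖y‖ * (‖D‖ * ‖y‖) := by gcongr; exact h2
      _ = _ := by rw [← hyy]; ring
  have h4 : x ⬝ᵥ (B *ᵥ x) = r * (x ⬝ᵥ x) + x ⬝ᵥ (D *ᵥ x) := by
    rw [hD, sub_mulVec, dotProduct_sub, smul_mulVec, one_mulVec, dotProduct_smul, smul_eq_mul]
    ring
  rw [h4]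
  have h5 := (abs_le.1 h1).1
  have h6 := mul_lt_mul_of_pos_right h hpos
  linarith

end

/-! ### One-parameter subgroups -/

theorem exp_mem {X : Mat n} (hX : (form X)ᵀ = form X) :
    NormedSpace.exp X ∈ symplecticGroup (Fin n) ℝ := by
  have hJ : IsUnit (J₀ n) := by
    rw [Matrix.isUnit_iff_isUnit_det]
    have h : (J₀ n).det = 1 := Sp.det_eq_one (Jsp n)
    rw [h]; exact isUnit_one
  have hJi : (J₀ n)⁻¹ = -J₀ n := Matrix.inv_eq_right_inv (by rw [Matrix.mul_neg, J_mul_J, neg_neg])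
  have h1 : J₀ n * X * (J₀ n)⁻¹ = -Xᵀ := by
    rw [form, Matrix.transpose_mul, transpose_transpose, J_transpose', Matrix.neg_mul] at hX
    have : J₀ n * X = -(Xᵀ * J₀ n) := by rw [hX, neg_neg]
    rw [this, hJi, Matrix.neg_mul, Matrix.mul_assoc, Matrix.mul_neg, J_mul_J, neg_neg,
      Matrix.mul_one]
  have h2 := Matrix.exp_conj (J₀ n) X hJ
  rw [h1, Matrix.exp_neg, Matrix.exp_transpose] at h2
  have h3 : IsUnit (NormedSpace.exp X)ᵀ := by
    rw [← Matrix.exp_transpose]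
    exact Matrix.isUnit_exp _
  rw [mem_sp, Matrix.mul_assoc]
  have h4 : J₀ n * NormedSpace.exp X = ((NormedSpace.exp X)ᵀ)⁻¹ * J₀ n := by
    rw [h2, Matrix.mul_assoc, Matrix.nonsing_inv_mul _ ((Matrix.isUnit_iff_isUnit_det _).1 hJ),
      Matrix.mul_one]
  rw [h4, ← Matrix.mul_assoc, Matrix.mul_nonsing_inv _ ((Matrix.isUnit_iff_isUnit_det _).1 h3),
    Matrix.one_mul]

theorem exists_one_parameter {X : Mat n} (hX : (form X)ᵀ = form X) :
    ∃ h : ℝ → SpTilde n, h 0 = 1 ∧ Continuous h ∧ HasVel h univ (fun _ => X) ∧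
      ∀ t, ((h t).proj : Mat n) = NormedSpace.exp (t • X) := by
  have hm : ∀ t : ℝ, NormedSpace.exp (t • X) ∈ symplecticGroup (Fin n) ℝ := fun t =>
    exp_mem (by rw [form_smul, transpose_smul, hX])
  have hd : ∀ t : ℝ, HasDerivAt (fun u : ℝ => NormedSpace.exp (u • X))
      (X * NormedSpace.exp (t • X)) t := fun t => hasDerivAt_exp_smul_const' X t
  let g : ℝ → Sp n := fun t => ⟨NormedSpace.exp (t • X), hm t⟩
  have hg : Continuous g :=
    Continuous.subtype_mk (continuous_iff_continuousAt.2 fun t => (hd t).continuousAt) _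
  have h0 : g 0 = 1 := Subtype.ext (by simp [g])
  refine ⟨liftCurve g hg h0, liftCurve_zero _ _ _, continuous_liftCurve _ _ _,
    hasVel_liftCurve _ _ fun t _ => (hd t).hasDerivWithinAt, fun t => ?_⟩
  rw [proj_liftCurve]

/-! ### Antilinear infinitesimal symplectic matrices -/

/-- The symmetric matrices which anticommute with `J`. -/
def antilin (n : ℕ) : Submodule ℝ (Mat n) where
  carrier := {Y | Y * J₀ n = -(J₀ n * Y) ∧ Yᵀ = Y}
  add_mem' := by
    rintro A B ⟨h1, h2⟩ ⟨h3, h4⟩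
    refine ⟨?_, by rw [transpose_add, h2, h4]⟩
    rw [Matrix.add_mul, h1, h3, Matrix.mul_add, neg_add]
  zero_mem' := by simp
  smul_mem' := by
    rintro r A ⟨h1, h2⟩
    refine ⟨?_, by rw [transpose_smul, h2]⟩
    rw [Matrix.smul_mul, h1, Matrix.mul_smul, smul_neg]

theorem form_transpose_of_mem_antilin {Y : Mat n} (hY : Y ∈ antilin n) :
    (form Y)ᵀ = form Y := by
  rw [form, Matrix.transpose_mul, transpose_transpose, hY.2, hY.1, J_transpose', Matrix.neg_mul]

theorem transpose_eq_inv_of_commute_J {U : Sp n} (hJ : (U : Mat n) * J₀ n = J₀ n * (U : Mat n)) :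
    (U : Mat n)ᵀ = ((U⁻¹ : Sp n) : Mat n) := by
  rw [coe_inv_eq, Matrix.mul_assoc]
  have h := congrArg Matrix.transpose hJ
  rw [Matrix.transpose_mul, Matrix.transpose_mul, J_transpose', Matrix.neg_mul, Matrix.mul_neg,
    neg_inj] at h
  rw [← h, Matrix.neg_mul, ← Matrix.mul_assoc, J_mul_J, Matrix.neg_mul, neg_neg, Matrix.one_mul]

/-- If Y commutes with U and anticommutes with J₀, it anticommutes with the positive definite form Q
of U. Then tr(Yᵀ Q Y) equals its own opposite, and positivity of Q makes every column of Y vanish.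
-/
theorem eq_zero_of_mem_antilin_of_commute {U : Sp n} (hU : U ∈ SpEll n) {Y : Mat n} (hY : Y ∈ antilin n)
    (h : (U : Mat n) * Y = Y * (U : Mat n)) : Y = 0 := by
  have hQ := posDef_iff_real.1 (mem_SpEll_iff.1 hU)
  have hi : ((U⁻¹ : Sp n) : Mat n) * Y = Y * ((U⁻¹ : Sp n) : Mat n) := by
    calc _ = ((U⁻¹ : Sp n) : Mat n) * Y * ((U : Mat n) * ((U⁻¹ : Sp n) : Mat n)) := by
          rw [Sp.mul_inv_coe, Matrix.mul_one]
      _ = ((U⁻¹ : Sp n) : Mat n) * ((U : Mat n) * Y) * ((U⁻¹ : Sp n) : Mat n) := by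
          rw [h]; simp only [Matrix.mul_assoc]
      _ = _ := by rw [← Matrix.mul_assoc, Sp.inv_mul_coe, Matrix.one_mul]
  have hQeq : omegaForm (U : Mat n) = -(J₀ n * ((U : Mat n) - ((U⁻¹ : Sp n) : Mat n))) := by
    rw [← J_mul_omegaForm, ← Matrix.mul_assoc, J_mul_J, Matrix.neg_mul, neg_neg, Matrix.one_mul]
  have hanti : omegaForm (U : Mat n) * Y = -(Y * omegaForm (U : Mat n)) := by
    rw [hQeq, Matrix.neg_mul, Matrix.mul_assoc, Matrix.sub_mul, h, hi, ← Matrix.mul_sub,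
      Matrix.mul_neg, ← Matrix.mul_assoc, ← Matrix.mul_assoc, hY.1, Matrix.neg_mul, neg_neg]
  have htr : (Yᵀ * omegaForm (U : Mat n) * Y).trace = 0 := by
    have h1 : (Yᵀ * omegaForm (U : Mat n) * Y).trace =
        -(Yᵀ * omegaForm (U : Mat n) * Y).trace := by
      conv_lhs => rw [Matrix.mul_assoc, hanti, Matrix.mul_neg, trace_neg, Matrix.trace_mul_comm,
        hY.2, Matrix.mul_assoc, hanti, Matrix.mul_neg, trace_neg]
      conv_rhs => rw [Matrix.mul_assoc, hanti, Matrix.mul_neg, trace_neg, hY.2]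
    linarith
  have hcol : ∀ j, Y *ᵥ (Pi.single j 1) = 0 := by
    have h1 : (Yᵀ * omegaForm (U : Mat n) * Y).trace =
        ∑ j, (Y *ᵥ (Pi.single j 1)) ⬝ᵥ (omegaForm (U : Mat n) *ᵥ (Y *ᵥ (Pi.single j 1))) := by
      refine Finset.sum_congr rfl fun j _ => ?_
      rw [← dotProduct_transpose_mulVec, mulVec_mulVec, mulVec_mulVec, single_one_dotProduct,
        mulVec_single_one]
      rfl
    rw [h1] at htr
    have hnn : ∀ v : Fin n ⊕ Fin n → ℝ, 0 ≤ v ⬝ᵥ (omegaForm (U : Mat n) *ᵥ v) :=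
      (posSemidef_iff_real.1 (mem_SpEll_iff.1 hU).posSemidef).2
    intro j
    by_contra hj
    exact (hQ.2 _ hj).ne' ((Finset.sum_eq_zero_iff_of_nonneg fun j _ => hnn _).1 htr j
      (Finset.mem_univ j))
  ext i j
  have := congrFun (hcol j) i
  rwa [mulVec_single_one] at this

/-- Y ↦ Y - Ad U Y preserves the finite-dimensional space `antilin n` and is injective there, hence
surjective. So an antilinear velocity at U can be produced by conjugation. -/
theorem exists_sub_Ad_eq {U : Sp n} (hU : U ∈ SpEll n)
    (hJ : (U : Mat n) * J₀ n = J₀ n * (U : Mat n)) {Z : Mat n} (hZ : Z ∈ antilin n) :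
    ∃ Y ∈ antilin n, Y - Ad U Y = Z := by
  have hT := transpose_eq_inv_of_commute_J hJ
  have hTi : ((U⁻¹ : Sp n) : Mat n)ᵀ = (U : Mat n) := by rw [← hT, transpose_transpose]
  have hJi : ((U⁻¹ : Sp n) : Mat n) * J₀ n = J₀ n * ((U⁻¹ : Sp n) : Mat n) := by
    have h := congrArg Matrix.transpose hJ
    rw [Matrix.transpose_mul, Matrix.transpose_mul, J_transpose', Matrix.neg_mul, Matrix.mul_neg,
      neg_inj, hT] at h
    exact h.symm
  let L : antilin n →ₗ[ℝ] antilin n :=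
    { toFun := fun Y => ⟨Y.1 - Ad U Y.1, by
        refine (antilin n).sub_mem Y.2 ⟨?_, ?_⟩
        · rw [Ad, Matrix.mul_assoc, hJi, Matrix.mul_assoc, ← Matrix.mul_assoc Y.1, Y.2.1,
            Matrix.neg_mul, Matrix.mul_neg, ← Matrix.mul_assoc, ← Matrix.mul_assoc, hJ]
          simp only [Matrix.mul_assoc]
        · rw [Ad, Matrix.transpose_mul, Matrix.transpose_mul, hTi, hT, Y.2.2, Matrix.mul_assoc]⟩
      map_add' := fun A B => Subtype.ext (by
        change A.1 + B.1 - Ad U (A.1 + B.1) = A.1 - Ad U A.1 + (B.1 - Ad U B.1)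
        rw [Ad, Ad, Ad, Matrix.mul_add, Matrix.add_mul]; abel)
      map_smul' := fun r A => Subtype.ext (by
        change r • A.1 - Ad U (r • A.1) = r • (A.1 - Ad U A.1)
        rw [Ad, Ad, Matrix.mul_smul, Matrix.smul_mul, smul_sub]) }
  have hinj : Function.Injective L := by
    refine (injective_iff_map_eq_zero L).2 fun Y hY => ?_
    have h1 : Y.1 - Ad U Y.1 = 0 := congrArg Subtype.val hY
    refine Subtype.ext (eq_zero_of_mem_antilin_of_commute hU Y.2 ?_)
    have h2 : Y.1 = Ad U Y.1 := sub_eq_zero.1 h1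
    conv_rhs => rw [h2, Ad]
    rw [Matrix.mul_assoc, Sp.inv_mul_coe, Matrix.mul_one]
  obtain ⟨Y, hY⟩ := LinearMap.injective_iff_surjective.1 hinj ⟨Z, hZ⟩
  exact ⟨Y.1, Y.2, congrArg Subtype.val hY⟩

/-! ### Growth of the homogenized phase along timelike curves in the elliptic region -/

theorem Ad_add (g : Sp n) (A B : Mat n) : Ad g (A + B) = Ad g A + Ad g B := by
  rw [Ad, Ad, Ad, Matrix.mul_add, Matrix.add_mul]

theorem Ad_smul (g : Sp n) (r : ℝ) (A : Mat n) : Ad g (r • A) = r • Ad g A := by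
  rw [Ad, Ad, Matrix.mul_smul, Matrix.smul_mul]

theorem Ad_neg (g : Sp n) (A : Mat n) : Ad g (-A) = -Ad g A := by
  rw [Ad, Ad, Matrix.mul_neg, Matrix.neg_mul]

theorem omegaForm_add (A B : Mat n) : omegaForm (A + B) = omegaForm A + omegaForm B := by
  simp only [omegaForm, Matrix.mul_add, transpose_add, Matrix.add_mul]
  abel

theorem omegaForm_smul (r : ℝ) (A : Mat n) : omegaForm (r • A) = r • omegaForm A := by
  simp only [omegaForm, Matrix.mul_smul, transpose_smul, Matrix.smul_mul, smul_add]

theorem omegaForm_one : omegaForm (1 : Mat n) = 0 := by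
  rw [omegaForm, transpose_one, Matrix.mul_one, Matrix.one_mul, J_transpose', neg_add_cancel]

theorem omegaForm_J : omegaForm (J₀ n) = (2 : ℝ) • (1 : Mat n) := by
  rw [omegaForm, J_transpose', Matrix.neg_mul, J_mul_J, neg_neg, two_smul]

/-- The form `omegaForm` vanishes at 1 and its derivative along the curve is 2η times the identity,
so the curve is elliptic just after a; being close to its start at 1, it is the principal lift. -/
theorem eventually_mem_SpTildeEll {e : ℝ → SpTilde n} {a b : ℝ} (hab : a < b)
    (he : ContinuousOn e (Icc a b)) (ha : e a = 1) {η : ℝ} (hη : 0 < η)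
    (hd : HasDerivWithinAt (projCurve e) (η • J₀ n) (Icc a b) a) :
    ∀ᶠ t in 𝓝[>] a, e t ∈ SpTildeEll n := by
  have hpa : (e a).proj = 1 := by rw [ha]; exact (SpTilde.projHom n).map_one
  have h1 : Tendsto (slope (projCurve e) a) (𝓝[>] a) (𝓝 (η • J₀ n)) := by
    rw [← nhdsWithin_Ioo_eq_nhdsGT hab]
    exact (hasDerivWithinAt_iff_tendsto_slope' (by simp)).1 (hd.mono Ioo_subset_Icc_self)
  have h2 := (continuous_omegaForm.tendsto _).comp h1
  rw [omegaForm_smul, omegaForm_J, smul_smul] at h2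
  have h3 : ∀ᶠ t in 𝓝[>] a, (e t).proj ∈ SpEll n := by
    have h4 : ∀ᶠ t in 𝓝[>] a,
        ‖omegaForm (slope (projCurve e) a t) - (η * 2) • (1 : Mat n)‖ < η * 2 := by
      have h5 := h2.sub_const ((η * 2) • (1 : Mat n))
      rw [sub_self] at h5
      have h6 := h5.norm
      rw [norm_zero] at h6
      exact h6.eventually (gt_mem_nhds (by positivity))
    filter_upwards [h4, self_mem_nhdsWithin] with t ht hta
    have h7 := posDef_of_norm_sub_lt (omegaForm_transpose _) ht
    have hta' : 0 < t - a := sub_pos.2 hta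
    have h8 : omegaForm ((e t).proj : Mat n) =
        (t - a) • omegaForm (slope (projCurve e) a t) := by
      rw [slope_def_module, omegaForm_smul, smul_smul, mul_inv_cancel₀ hta'.ne', one_smul,
        sub_eq_add_neg, omegaForm_add, projCurve, projCurve, hpa, OneMemClass.coe_one,
        ← neg_one_smul ℝ (1 : Mat n), omegaForm_smul, omegaForm_one, smul_zero, add_zero]
    rw [mem_SpEll_iff, h8]
    exact h7.smul hta'
  obtain ⟨d, hd1, hd2⟩ := (mem_nhdsGT_iff_exists_Ioo_subset' hab).1 h3
  have h9 : Ioo a (min d b) ∈ 𝓝[>] a := Ioo_mem_nhdsGT (lt_min hd1 hab)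
  filter_upwards [h9] with t ht
  have hsub : ∀ s ∈ Ioc a t, (e s).proj ∈ SpEll n := fun s hs =>
    hd2 ⟨hs.1, hs.2.trans_lt (ht.2.trans_le (min_le_left _ _))⟩
  have h10 := eq_princ_of_continuousOn (isPreconnected_Icc (a := a) (b := t))
    (he.mono (Icc_subset_Icc_right (ht.2.le.trans (min_le_right _ _)))) (fun s hs => ?_)
    (x₀ := a) ⟨le_rfl, ht.1.le⟩ (by rw [hpa, ha, princ_one]) t ⟨ht.1.le, le_rfl⟩
  · exact mem_SpTildeEll_iff.2 ⟨_, hsub t ⟨ht.1, le_rfl⟩, h10.symm⟩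
  · rcases hs.1.eq_or_lt with h | h
    · rw [← h, hpa]
      exact one_mem_sclDom
    · exact SpEll_subset_sclDom (hsub s ⟨h, hs.2⟩)

theorem trace_toBlocks₁₁_of_commute {K : Mat n} (hK : K * J₀ n = J₀ n * K) :
    K.toBlocks₁₁.trace = 1 / 2 * K.trace := by
  have h : K.trace = ∑ i, K (Sum.inl i) (Sum.inl i) + ∑ i, K (Sum.inr i) (Sum.inr i) :=
    Fintype.sum_sum_type _
  have h2 : ∑ i, K (Sum.inr i) (Sum.inr i) = ∑ i, K (Sum.inl i) (Sum.inl i) :=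
    Finset.sum_congr rfl fun i _ => (commute_J_apply hK i i).2
  rw [h, h2]
  change ∑ i, K (Sum.inl i) (Sum.inl i) = _
  ring

/-- At a unitary point the Gram matrix is 1, and a complex linear form has equal diagonal blocks, so
the block trace is half the full one. -/
theorem phaseDeriv_of_commute {U : Sp n} (hJ : (U : Mat n) * J₀ n = J₀ n * (U : Mat n)) {Z : Mat n}
    (hZ : Z * J₀ n = J₀ n * Z) : phaseDeriv U Z = 1 / 2 * (form Z).trace := by
  have hT := transpose_eq_inv_of_commute_J hJ
  have hTJ : (U : Mat n)ᵀ * J₀ n = J₀ n * (U : Mat n)ᵀ := by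
    have h := congrArg Matrix.transpose hJ
    rw [Matrix.transpose_mul, Matrix.transpose_mul, J_transpose', Matrix.neg_mul, Matrix.mul_neg,
      neg_inj] at h
    exact h.symm
  have hg : gram (U : Mat n) = 1 := by
    rw [gram, hT, Sp.inv_mul_coe, ← fromBlocks_one, toBlocks_fromBlocks₁₁]
  have hf : form Z * J₀ n = J₀ n * form Z := by
    rw [form, J_transpose', Matrix.neg_mul, Matrix.neg_mul, Matrix.mul_neg, Matrix.mul_assoc, hZ]
  rw [phaseDeriv, hg, inv_one, Matrix.one_mul, trace_toBlocks₁₁_of_commute]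
  · rw [Matrix.trace_mul_comm, ← Matrix.mul_assoc, hT, Sp.mul_inv_coe, Matrix.one_mul]
  · rw [Matrix.mul_assoc, hJ, ← Matrix.mul_assoc, Matrix.mul_assoc _ (form Z), hf,
      ← Matrix.mul_assoc, hTJ]
    simp only [Matrix.mul_assoc]

/-- To first order, c is compared from below with a unitary curve conjugated by exp((t - a) Y).
Conjugation does not affect `hphase`, which on unitary elements is the phase and can be
differentiated. A small multiple η of J₀ is kept in reserve to turn agreement of derivatives into an
inequality for `le`. -/
theorem HasVel.eventually_hphase_of_commute {c : ℝ → SpTilde n} {X : ℝ → Mat n} {a b : ℝ}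
    (hab : a < b) (hc : HasVel c (Icc a b) X) (hU : (c a).proj ∈ SpEll n)
    (hJ : ((c a).proj : Mat n) * J₀ n = J₀ n * ((c a).proj : Mat n))
    (hX : (form (X a))ᵀ = form (X a)) {r : ℝ} (hr : r < 1 / 2 * (form (X a)).trace) :
    ∀ᶠ t in 𝓝[>] a, r * (t - a) ≤ hphase (c t) - hphase (c a) := by
  set U := (c a).proj with hUdef
  -- The slack in hr divided by n + 1: the reserve ηJ₀ costs nη in the rate of the phase, which must
  -- stay above r.
  set η := (1 / 2 * (form (X a)).trace - r) / (n + 1) with hη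
  have hη0 : 0 < η := div_pos (by linarith) (by positivity)
  have hηn : r < 1 / 2 * (form (X a)).trace - n * η := by
    have h1 : (n + 1) * η = 1 / 2 * (form (X a)).trace - r := by rw [hη]; field_simp
    linarith
  have hXt : (X a)ᵀ = J₀ n * X a * J₀ n := by
    have h1 : (X a)ᵀ * J₀ n = -(J₀ n * X a) := by
      rw [form, Matrix.transpose_mul, transpose_transpose, J_transpose', Matrix.neg_mul] at hX
      exact hX
    calc (X a)ᵀ = -((X a)ᵀ * (J₀ n * J₀ n)) := by rw [J_mul_J, Matrix.mul_neg, Matrix.mul_one, neg_neg]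
      _ = _ := by rw [← Matrix.mul_assoc, h1, Matrix.neg_mul, neg_neg]
  have hA : (1 / 2 : ℝ) • (X a + J₀ n * X a * J₀ n) ∈ antilin n := by
    refine (antilin n).smul_mem _ ⟨?_, ?_⟩
    · rw [Matrix.add_mul, Matrix.mul_add, Matrix.mul_assoc (J₀ n * X a), J_mul_J, ← Matrix.mul_assoc,
        ← Matrix.mul_assoc, J_mul_J, Matrix.neg_mul, Matrix.mul_neg, Matrix.mul_one, Matrix.one_mul,
        Matrix.neg_mul]
      abel
    · rw [transpose_add, Matrix.transpose_mul, Matrix.transpose_mul, J_transpose', hXt]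
      simp only [Matrix.neg_mul, Matrix.mul_neg, neg_neg, ← Matrix.mul_assoc, J_mul_J]
      rw [Matrix.one_mul, Matrix.mul_assoc (X a), J_mul_J, Matrix.mul_neg, Matrix.mul_one, neg_neg]
      abel
  obtain ⟨Y, hY, hYA⟩ := exists_sub_Ad_eq hU hJ hA
  -- Removing Y - Ad U Y deletes the antilinear part of X a, so Z commutes with J₀ and V is unitary.
  -- The antilinear part has trace zero in `form`, so no growth is lost.
  set Z := X a - η • J₀ n - (Y - Ad U Y) with hZ
  have hZeq : Z = (1 / 2 : ℝ) • (X a - J₀ n * X a * J₀ n) - η • J₀ n := by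
    rw [hZ, hYA]; module
  have hZJ : Z * J₀ n = J₀ n * Z := by
    rw [hZeq]
    simp only [Matrix.sub_mul, Matrix.mul_sub, Matrix.smul_mul, Matrix.mul_smul]
    rw [Matrix.mul_assoc (J₀ n * X a), J_mul_J, ← Matrix.mul_assoc, ← Matrix.mul_assoc, J_mul_J,
      Matrix.neg_mul, Matrix.mul_neg, Matrix.mul_one, Matrix.one_mul, Matrix.neg_mul]
    module
  have hformA : (form ((1 / 2 : ℝ) • (X a + J₀ n * X a * J₀ n)))ᵀ =
      form ((1 / 2 : ℝ) • (X a + J₀ n * X a * J₀ n)) := form_transpose_of_mem_antilin hA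
  have hformZ : form Z = form (X a) - η • (1 : Mat n) -
      form ((1 / 2 : ℝ) • (X a + J₀ n * X a * J₀ n)) := by
    rw [hZ, hYA, sub_eq_add_neg, sub_eq_add_neg, form_add, form_add, form_neg, form_neg, form_smul,
      form_J]
    abel
  have hZs : (form Z)ᵀ = form Z := by
    rw [hformZ, transpose_sub, transpose_sub, hX, hformA, transpose_smul, transpose_one]
  have htrA : (form ((1 / 2 : ℝ) • (X a + J₀ n * X a * J₀ n))).trace = 0 := by
    have h1 : ((J₀ n)ᵀ * (J₀ n * X a * J₀ n)).trace = -((J₀ n)ᵀ * X a).trace := by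
      rw [J_transpose', Matrix.mul_assoc, ← Matrix.mul_assoc, Matrix.neg_mul, J_mul_J, neg_neg,
        Matrix.one_mul, Matrix.trace_mul_comm, Matrix.neg_mul, trace_neg, neg_neg]
    rw [form_smul, trace_smul, form_add, trace_add, form, form, h1, add_neg_cancel, smul_zero]
  have htrZ : (form Z).trace = (form (X a)).trace - 2 * n * η := by
    rw [hformZ, trace_sub, trace_sub, htrA, sub_zero, trace_smul, trace_one, Fintype.card_sum,
      Fintype.card_fin, smul_eq_mul]
    push_cast
    ring
  obtain ⟨h, hh0, hhc, hhv, -⟩ := exists_one_parameter (form_transpose_of_mem_antilin hY)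
  obtain ⟨V, hV0, hVc, hVv, hVe⟩ := exists_one_parameter hZs
  have hshift : ∀ t ∈ Icc a b, HasDerivWithinAt (fun t => t - a) ((fun _ => (1 : ℝ)) t) (Icc a b) t :=
    fun t _ => ((hasDerivAt_id t).sub_const a).hasDerivWithinAt
  have hh : HasVel (fun t => h (t - a)) (Icc a b) fun _ => Y :=
    (hhv.comp hshift (mapsTo_univ _ _)).congr fun t _ => one_smul _ _
  have hv : HasVel (fun t => V (t - a) * c a) (Icc a b) fun _ => Z :=
    ((hVv.comp hshift (mapsTo_univ _ _)).congr fun t _ => one_smul _ _).mul_const (c a)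
  have hvU : ∀ t, V (t - a) * c a ∈ UTilde n := by
    intro t
    refine UTilde_mul (mem_UTilde_of_commute_J ?_) (mem_UTilde_of_commute_J hJ)
    rw [hVe]
    have h1 : Commute (J₀ n) ((t - a) • Z) := by
      refine Commute.smul_right ?_ _
      exact hZJ.symm
    exact (h1.exp_right).symm
  -- The quotient of c by the conjugated comparison curve. It equals 1 at time a and has derivative
  -- exactly ηJ₀ there, so it becomes elliptic and hence larger than 1.
  have he := hc.mul ((hh.mul hv.inv).mul hh.inv)
  have hev := eventually_mem_SpTildeEll (η := η) hab he.1
    (by simp [hh0, hV0]) hη0 (by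
      refine (he.2 a ⟨le_rfl, hab.le⟩).congr_deriv ?_
      have hp1 : (1 : SpTilde n).proj = 1 := (SpTilde.projHom n).map_one
      simp only [projCurve, sub_self, hh0, hV0, one_mul, mul_one, inv_one, mul_inv_cancel,
        hp1, Ad_one, OneMemClass.coe_one]
      rw [SpTilde.proj_inv, ← hUdef]
      simp only [Ad_add, Ad_neg, ← Ad_mul, mul_inv_cancel, Ad_one]
      rw [hZ]
      abel)
  have hph : ∀ᶠ t in 𝓝[>] a, r * (t - a) ≤ phase (V (t - a) * c a) - phase (c a) := by
    have h1 := hv.hasDerivWithinAt_phase (t := a) ⟨le_rfl, hab.le⟩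
    rw [sub_self, hV0, one_mul, phaseDeriv_of_commute hJ hZJ, htrZ] at h1
    have h2 : Tendsto (slope (fun t => phase (V (t - a) * c a)) a) (𝓝[>] a)
        (𝓝 (1 / 2 * ((form (X a)).trace - 2 * n * η))) := by
      rw [← nhdsWithin_Ioo_eq_nhdsGT hab]
      exact (hasDerivWithinAt_iff_tendsto_slope' (by simp)).1 (h1.mono Ioo_subset_Icc_self)
    filter_upwards [h2.eventually (lt_mem_nhds (a := r) (by linarith)), self_mem_nhdsWithin]
      with t ht hta
    have hta' : 0 < t - a := sub_pos.2 hta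
    rw [slope_def_field, lt_div_iff₀ hta', sub_self, hV0, one_mul] at ht
    exact ht.le
  filter_upwards [hev, hph] with t ht1 ht2
  obtain ⟨W, hW, hWe⟩ := mem_SpTildeEll_iff.1 ht1
  have h1 := one_le_princ hW
  rw [hWe] at h1
  have h2 := (h1.mul_right (h (t - a) * (V (t - a) * c a) * (h (t - a))⁻¹)).hphase
  have h3 : c t * (h (t - a) * (V (t - a) * c a)⁻¹ * (h (t - a))⁻¹) *
      (h (t - a) * (V (t - a) * c a) * (h (t - a))⁻¹) = c t := by group
  rw [h3, one_mul, hphase_conj, hphase_unitary (hvU t)] at h2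
  have h4 : hphase (c a) = phase (c a) := hphase_unitary (mem_UTilde_of_commute_J hJ)
  linarith

theorem mul_G_le_half_trace_form (hn : 1 ≤ n) {X : Mat n} (hX : (form X).PosSemidef) :
    n * G n X ≤ 1 / 2 * (form X).trace := by
  have : Nonempty (Fin n ⊕ Fin n) := ⟨Sum.inl ⟨0, hn⟩⟩
  have h := hX.det_rpow_le_trace_div
  have hn' : (0 : ℝ) < n := by exact_mod_cast hn
  have hcard : (Fintype.card (Fin n ⊕ Fin n) : ℝ) = 2 * n := by
    rw [Fintype.card_sum, Fintype.card_fin]; push_cast; ring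
  rw [hcard, det_form, le_div_iff₀ (by positivity)] at h
  rw [G]
  linarith

/-- Conjugation moves c a to a unitary point without changing `hphase` or the determinant of the
velocity; there half the trace of the form is at least n times `G`. -/
theorem HasVel.eventually_hphase (hn : 1 ≤ n) {c : ℝ → SpTilde n} {X : ℝ → Mat n} {a b : ℝ}
    (hab : a < b) (hc : HasVel c (Icc a b) X) (ha : c a ∈ SpTildeEll n)
    (hX : (form (X a)).PosDef) {r : ℝ} (hr : r < n * G n (X a)) :
    ∀ᶠ t in 𝓝[>] a, r * (t - a) ≤ hphase (c t) - hphase (c a) := by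
  obtain ⟨W, hW, hWe⟩ := mem_SpTildeEll_iff.1 ha
  obtain ⟨p, hp, hJ⟩ := exists_conj_commute_J hW
  have hpv : (princ p).proj = p := proj_princ (mem_sclDom_of_posDef hp)
  have hproj : (princ p * c a * (princ p)⁻¹).proj = p * W * p⁻¹ := by
    rw [SpTilde.proj_mul, SpTilde.proj_mul, SpTilde.proj_inv, hpv, ← hWe,
      proj_princ_of_mem_SpEll hW]
  have hX' := posDef_form_Ad p hX
  have h := ((hc.const_mul (princ p)).mul_const (princ p)⁻¹).eventually_hphase_of_commute hab
    (by rw [hproj]; exact conj_mem_SpEll hW p) (by rw [hproj]; exact hJ)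
    (by rw [hpv]; exact (posDef_iff_real.1 hX').1) (r := r) (by
      rw [hpv]
      refine hr.trans_le (le_trans (le_of_eq ?_) (mul_G_le_half_trace_form hn hX'.posSemidef))
      rw [G, G, det_Ad])
  filter_upwards [h] with t ht
  rwa [hphase_conj, hphase_conj] at ht

/-! ### Upper bound for the Lorentz distance -/

theorem continuous_G : Continuous (G n) := by
  unfold G
  exact Continuous.rpow_const (by fun_prop) fun _ => Or.inr (by positivity)

theorem continuous_comp_projIcc {α : Type*} [TopologicalSpace α] {f : ℝ → α}
    (hf : ContinuousOn f (Icc 0 1)) :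
    Continuous fun t => f (projIcc (0 : ℝ) 1 zero_le_one t) :=
  hf.comp_continuous (continuous_subtype_val.comp continuous_projIcc) fun t => (projIcc _ _ _ t).2

theorem coe_projIcc_of_mem {t : ℝ} (ht : t ∈ Icc (0 : ℝ) 1) :
    (projIcc (0 : ℝ) 1 zero_le_one t : ℝ) = t := by
  rw [projIcc_of_mem _ ht]

/-- Only lower bounds on right difference quotients of `hphase` are available, so the integrated
inequality comes from a comparison principle for one-sided slopes. -/
theorem HasVel.integral_le_hphase (hn : 1 ≤ n) {c : ℝ → SpTilde n} {X : ℝ → Mat n}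
    (hc : HasVel c (Icc 0 1) X) (hXc : Continuous X)
    (hX : ∀ t ∈ Icc (0 : ℝ) 1, (form (X t)).PosDef) (h0 : c 0 = 1)
    (hell : ∀ t ∈ Ioc (0 : ℝ) 1, c t ∈ SpTildeEll n) :
    n * ∫ t in (0 : ℝ)..1, G n (X t) ≤ hphase (c 1) := by
  have hg : Continuous fun t => n * G n (X t) := continuous_const.mul (continuous_G.comp hXc)
  have hpc : ContinuousOn (fun t => hphase (c t)) (Icc 0 1) :=
    continuous_hphase.comp_continuousOn hc.1
  have key : ∀ a ∈ Ioc (0 : ℝ) 1, (∫ t in a..1, n * G n (X t)) ≤ hphase (c 1) - hphase (c a) := by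
    intro a ha
    have hB : ∀ x, HasDerivAt (fun x => -hphase (c a) - ∫ t in a..x, n * G n (X t))
        (-(n * G n (X x))) x := fun x =>
      (intervalIntegral.integral_hasDerivAt_right (hg.intervalIntegrable _ _)
        (hg.stronglyMeasurableAtFilter _ _) hg.continuousAt).const_sub _
    have h := image_le_of_liminf_slope_right_le_deriv_boundary (f := fun t => -hphase (c t))
      (a := a) (b := 1)
      (B := fun x => -hphase (c a) - ∫ t in a..x, n * G n (X t))
      (B' := fun t => -(n * G n (X t)))
      ((hpc.mono (Icc_subset_Icc_left ha.1.le)).neg) (by simp)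
      (fun x _ => (hB x).continuousAt.continuousWithinAt) (fun x _ => (hB x).hasDerivWithinAt)
      (fun x hx r hr => ?_) (x := 1) ⟨ha.2, le_rfl⟩
    · linarith
    · have hx0 : 0 < x := ha.1.trans_le hx.1
      refine Eventually.frequently ?_
      -- The midpoint of -r and the guaranteed rate n G lies strictly between them.
      have h1 := (hc.mono (Icc_subset_Icc_left hx0.le)).eventually_hphase hn hx.2
        (hell x ⟨hx0, hx.2.le⟩) (hX x ⟨hx0.le, hx.2.le⟩) (r := (-r + n * G n (X x)) / 2)
        (by linarith)
      filter_upwards [h1, self_mem_nhdsWithin] with z hz hzx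
      have hzx' : 0 < z - x := sub_pos.2 hzx
      rw [slope_def_field, div_lt_iff₀ hzx']
      have h2 : 0 < ((-r + n * G n (X x)) / 2 + r) * (z - x) := mul_pos (by linarith) hzx'
      linarith
  -- The starting point 1 is not elliptic itself, so the estimate is proved on [a, 1] and a tends to
  -- 0.
  have hlim : Tendsto (fun a => (∫ t in a..1, n * G n (X t)) + hphase (c a)) (𝓝[>] 0)
      (𝓝 ((∫ t in (0 : ℝ)..1, n * G n (X t)) + hphase (c 0))) := by
    have h1 : ContinuousWithinAt (fun a => ∫ t in a..1, n * G n (X t)) (Ioc 0 1) 0 := by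
      have : Continuous fun a => ∫ t in a..1, n * G n (X t) := by
        simp_rw [intervalIntegral.integral_symm 1]
        exact (intervalIntegral.continuous_primitive (fun _ _ => hg.intervalIntegrable _ _) 1).neg
      exact this.continuousWithinAt
    have h2 : ContinuousWithinAt (fun a => hphase (c a)) (Ioc 0 1) 0 :=
      (hpc 0 ⟨le_rfl, zero_le_one⟩).mono Ioc_subset_Icc_self
    rw [← nhdsWithin_Ioc_eq_nhdsGT (zero_lt_one' ℝ)]
    exact h1.add h2
  rw [h0, hphase_one, add_zero, intervalIntegral.integral_const_mul] at hlim
  refine le_of_tendsto hlim ?_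
  rw [← nhdsWithin_Ioc_eq_nhdsGT (zero_lt_one' ℝ)]
  filter_upwards [self_mem_nhdsWithin] with a ha
  linarith [key a ha]

theorem hphase_nonneg_of_mem_closure {w : SpTilde n} (hw : w ∈ closure (SpTildeEll n)) :
    0 ≤ hphase w := by
  obtain ⟨θ, h1, -, h2⟩ := exists_angles_of_mem_closure hw
  rw [h2]
  exact Finset.sum_nonneg fun j _ => (h1 j).1

/-- Since w is below the rotation of angle π, the rotated end-point is below the rotation of angle π
- k 1 < π. This confines the timelike curve c · rot(-k) to the elliptic region. -/
theorem HasVel.integral_le_hphase_mul_rot (hn : 1 ≤ n) {w : SpTilde n}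
    (hw : w ∈ closure (SpTildeEll n)) {c : ℝ → SpTilde n} {X : ℝ → Mat n}
    (hc : HasVel c (Icc 0 1) X) (h0 : c 0 = 1) (h1 : c 1 = w) {k k' : ℝ → ℝ}
    (hk : ∀ t, HasDerivAt k (k' t) t) (hk0 : k 0 = 0) (hk1 : k 1 ∈ Ioo 0 Real.pi) {Y : ℝ → Mat n}
    (hYc : Continuous Y)
    (hY : ∀ t ∈ Icc (0 : ℝ) 1, Y t = X t + Ad (c t).proj ((-k' t) • J₀ n))
    (hpos : ∀ t ∈ Icc (0 : ℝ) 1, (form (Y t)).PosDef) :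
    n * ∫ t in (0 : ℝ)..1, G n (Y t) ≤ hphase (w * rot (-k 1)) := by
  have hrot : HasVel (fun t => rot (-k t) : ℝ → SpTilde n) (Icc 0 1) fun t => (-k' t) • J₀ n :=
    (hasVel_rot univ).comp (g := fun t => -k t) (g' := fun t => -k' t)
      (fun t _ => (hk t).neg.hasDerivWithinAt) (mapsTo_univ _ _)
  have hvel : HasVel (fun t => c t * rot (-k t)) (Icc 0 1) Y :=
    (hc.mul hrot).congr fun t ht => (hY t ht).symm
  have hc0 : c 0 * rot (-k 0) = 1 := by
    rw [h0, hk0, neg_zero, rot_zero, mul_one]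
  have hle : SympLorentz.le (c 1 * rot (-k 1)) (rot (Real.pi - k 1)) := by
    rw [h1, sub_eq_add_neg, rot_add]
    exact (le_rot_pi_of_mem_closure hw).mul_right _
  have hell := hvel.elliptic_of_le_rot hpos hc0 hk1 hle
  have := hvel.integral_le_hphase hn hYc hpos hc0 hell
  rwa [h1] at this

/-- Pulled back by W, the form becomes Q - ε(det X - δ). By `PosSemidef.det_mul_le` and the bound on
ε, Q is at least ε det X, so εδ of positivity remains even where X is degenerate. -/
theorem posDef_form_perturb {W : Sp n} {X : Mat n} (hX : (form X).PosSemidef) {τ : ℝ} (hτ0 : 0 < τ)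
    (hτ : ((W : Mat n)ᵀ * form X * (W : Mat n)).trace ≤ τ) {ε δ : ℝ} (hε : 0 < ε)
    (hετ : ε ≤ 1 / τ ^ (Fintype.card (Fin n ⊕ Fin n) - 1)) (hδ : 0 < δ) :
    (form (X + Ad W ((-(ε * (X.det - δ))) • J₀ n))).PosDef := by
  have h1 : X + Ad W ((-(ε * (X.det - δ))) • J₀ n) =
      Ad W (Ad W⁻¹ X + (-(ε * (X.det - δ))) • J₀ n) := by
    rw [Ad_add, ← Ad_mul, mul_inv_cancel, Ad_one]
  rw [h1]
  refine posDef_form_Ad _ ?_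
  rw [form_add, form_Ad, inv_inv, form_smul, form_J]
  have hQp : ((W : Mat n)ᵀ * form X * (W : Mat n)).PosSemidef := by
    have := hX.conjTranspose_mul_mul_same (W : Mat n)
    rwa [conjTranspose_eq_transpose_of_trivial] at this
  have hQd : ((W : Mat n)ᵀ * form X * (W : Mat n)).det = X.det := by
    rw [det_mul, det_mul, det_transpose, Sp.det_eq_one, det_form, one_mul, mul_one]
  have hd0 : 0 ≤ X.det := by rw [← det_form]; exact hX.det_nonneg
  refine posDef_iff_real.2 ⟨?_, fun x hx => ?_⟩
  · rw [transpose_add, transpose_smul, transpose_one, (posSemidef_iff_real.1 hQp).1]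
  · have h3 := hQp.det_mul_le hτ0 hτ x
    rw [hQd] at h3
    have hxx : 0 < x ⬝ᵥ x := by
      have h1 : 0 ≤ x ⬝ᵥ x := Finset.sum_nonneg fun i _ => mul_self_nonneg _
      exact h1.lt_of_ne fun h => hx (dotProduct_self_eq_zero.1 h.symm)
    rw [add_mulVec, dotProduct_add, smul_mulVec, one_mulVec, dotProduct_smul, smul_eq_mul]
    have h4 := mul_le_mul_of_nonneg_right hετ hd0
    rw [one_div_mul_eq_div] at h4
    have h5 : 0 < (X.det / τ ^ (Fintype.card (Fin n ⊕ Fin n) - 1) - ε * (X.det - δ)) *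
        (x ⬝ᵥ x) := by
      refine mul_pos ?_ hxx
      have := mul_pos hε hδ
      linarith
    linarith

/-- The causal curve is multiplied by rot(-ε k) with k' = det X - δ: where X degenerates this adds
positive rotation, and where det X is large there is room to remove some. The net removed angle εδ
is positive, so the timelike estimate applies to the perturbed curve, and ε tends to 0. -/
theorem lengthG_le (hn : 1 ≤ n) {w : SpTilde n} (hw : w ∈ closure (SpTildeEll n))
    {c : ℝ → SpTilde n} (hc : IsCausalCurve c 1 w) : lengthG c ≤ hphase w / n := by
  have hn0 : (0 : ℝ) < n := by exact_mod_cast hn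
  obtain ⟨hC1, h0, h1, hcaus⟩ := hc
  obtain ⟨hv, hvc⟩ := hC1.hasVel
  set p : ℝ → ℝ := fun t => projIcc (0 : ℝ) 1 zero_le_one t with hp
  have hpmem : ∀ t, p t ∈ Icc (0 : ℝ) 1 := fun t => (projIcc _ _ _ t).2
  have hpeq : ∀ t ∈ Icc (0 : ℝ) 1, p t = t := fun t ht => coe_projIcc_of_mem ht
  set X : ℝ → Mat n := fun t => velocity c (p t) with hX
  set W : ℝ → Sp n := fun t => (c (p t)).proj with hW
  have hXc : Continuous X := continuous_comp_projIcc hvc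
  have hWc : Continuous W :=
    continuous_comp_projIcc (SpTilde.continuous_proj.comp_continuousOn hv.1)
  have hXpos : ∀ t, (form (X t)).PosSemidef := fun t => (hcaus _ (hpmem t)).1
  have hvX : HasVel c (Icc 0 1) X := hv.congr fun t ht => by rw [hX]; simp only [hpeq t ht]
  have hlen : lengthG c = ∫ t in (0 : ℝ)..1, G n (X t) := by
    refine intervalIntegral.integral_congr fun t ht => ?_
    rw [uIcc_of_le zero_le_one] at ht
    simp only [hX, hpeq t ht]
  have hDc : Continuous fun t => (X t).det := hXc.matrix_det
  have hD0 : ∀ t, 0 ≤ (X t).det := fun t => by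
    rw [← det_form]; exact (hXpos t).det_nonneg
  -- If det X vanishes identically, the length is 0 and non-negativity of `hphase` suffices.
  -- Otherwise its integral is positive and δ can be half of it, which gives k 1 = δ.
  by_cases hD : ∃ t ∈ Icc (0 : ℝ) 1, 0 < (X t).det
  swap
  · push Not at hD
    have : lengthG c = 0 := by
      rw [hlen]
      refine (intervalIntegral.integral_congr (g := fun _ => 0) fun t ht => ?_).trans (by simp)
      rw [uIcc_of_le zero_le_one] at ht
      simp only [G]
      rw [le_antisymm (hD t ht) (hD0 t), Real.zero_rpow (by positivity)]
    rw [this]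
    exact div_nonneg (hphase_nonneg_of_mem_closure hw) hn0.le
  have hI : 0 < ∫ t in (0 : ℝ)..1, (X t).det :=
    intervalIntegral.integral_pos one_pos hDc.continuousOn (fun t _ => hD0 t) hD
  set δ := (∫ t in (0 : ℝ)..1, (X t).det) / 2 with hδ
  have hδ0 : 0 < δ := by positivity
  set k : ℝ → ℝ := fun t => ∫ s in (0 : ℝ)..t, ((X s).det - δ) with hk
  have hkd : ∀ t, HasDerivAt k ((X t).det - δ) t := fun t =>
    have hc : Continuous fun t => (X t).det - δ := hDc.sub continuous_const
    intervalIntegral.integral_hasDerivAt_right (hc.intervalIntegrable _ _)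
      (hc.stronglyMeasurableAtFilter _ _) hc.continuousAt
  have hk0 : k 0 = 0 := intervalIntegral.integral_same
  have hk1 : k 1 = δ := by
    rw [hk]
    simp only
    rw [intervalIntegral.integral_sub (hDc.intervalIntegrable _ _) (by simp)]
    simp only [intervalIntegral.integral_const, sub_zero, one_smul]
    rw [hδ]; ring
  obtain ⟨τ, hτ0, hτ⟩ : ∃ τ : ℝ, 0 < τ ∧
      ∀ t, (((W t) : Mat n)ᵀ * form (X t) * (W t : Mat n)).trace ≤ τ := by
    have hcont : Continuous fun t => (((W t) : Mat n)ᵀ * form (X t) * (W t : Mat n)).trace := by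
      have h1 : Continuous fun t => (W t : Mat n) := continuous_subtype_val.comp hWc
      have h2 : Continuous fun t => form (X t) := continuous_form.comp hXc
      fun_prop
    obtain ⟨C, hC⟩ := isCompact_Icc.exists_bound_of_continuousOn (s := Icc (0 : ℝ) 1)
      hcont.continuousOn
    refine ⟨max C 1, lt_max_of_lt_right one_pos, fun t => ?_⟩
    have h1 := hC (p t) (hpmem t)
    have h2 : p (p t) = p t := hpeq _ (hpmem t)
    have h3 : W (p t) = W t := by simp only [hW, h2]
    have h4 : X (p t) = X t := by simp only [hX, h2]
    rw [h3, h4] at h1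
    exact (le_abs_self _).trans (h1.trans (le_max_left _ _))
  set κ := τ ^ (Fintype.card (Fin n ⊕ Fin n) - 1) with hκ
  have hκ0 : 0 < κ := by positivity
  set Xp : ℝ → ℝ → Mat n := fun ε t => X t + Ad (W t) ((-(ε * ((X t).det - δ))) • J₀ n) with hXp
  have hXpc : Continuous (Function.uncurry Xp) := by
    have h1 : Continuous fun q : ℝ × ℝ => Ad (W q.2) ((-(q.1 * ((X q.2).det - δ))) • J₀ n) := by
      refine continuous_Ad.comp ((hWc.comp continuous_snd).prodMk ?_)
      have := hDc.comp (continuous_snd (X := ℝ) (Y := ℝ))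
      have h2 : Continuous fun q : ℝ × ℝ => (X q.2).det := this
      fun_prop
    exact (hXc.comp continuous_snd).add h1
  have hpos : ∀ ε, 0 < ε → ε ≤ 1 / κ → ∀ t, (form (Xp ε t)).PosDef := fun ε hε hεκ t =>
    posDef_form_perturb (hXpos t) hτ0 (hτ t) hε hεκ hδ0
  have key : ∀ ε, 0 < ε → ε ≤ 1 / κ → ε * δ < Real.pi →
      n * ∫ t in (0 : ℝ)..1, G n (Xp ε t) ≤ hphase (w * rot (-(ε * δ))) := by
    intro ε hε hεκ hεπ
    have := hvX.integral_le_hphase_mul_rot hn hw h0 h1 (k := fun t => ε * k t)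
      (k' := fun t => ε * ((X t).det - δ)) (fun t => (hkd t).const_mul ε) (by rw [hk0, mul_zero])
      (by rw [hk1]; exact ⟨by positivity, hεπ⟩) (Y := Xp ε)
      (hXpc.uncurry_left ε)
      (fun t ht => by simp only [hXp, hW, hpeq t ht]) fun t _ => hpos ε hε hεκ t
    rwa [hk1] at this
  have hlimL : Tendsto (fun ε => n * ∫ t in (0 : ℝ)..1, G n (Xp ε t)) (𝓝[>] 0)
      (𝓝 (n * ∫ t in (0 : ℝ)..1, G n (Xp 0 t))) := by
    have : Continuous fun ε => n * ∫ t in (0 : ℝ)..1, G n (Xp ε t) := by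
      refine continuous_const.mul ?_
      exact intervalIntegral.continuous_parametric_intervalIntegral_of_continuous'
        (f := fun ε t => G n (Xp ε t)) (continuous_G.comp hXpc) 0 1
    exact this.continuousWithinAt
  have hlimR : Tendsto (fun ε => hphase (w * rot (-(ε * δ)))) (𝓝[>] 0)
      (𝓝 (hphase (w * rot (-(0 * δ))))) := by
    have : Continuous fun ε : ℝ => hphase (w * rot (-(ε * δ))) :=
      continuous_hphase.comp (continuous_const.mul (continuous_rot.comp (by fun_prop)))
    exact this.continuousWithinAt
  have hle := le_of_tendsto_of_tendsto hlimL hlimR (by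
    have hsmall : ∀ᶠ ε in 𝓝[>] (0 : ℝ), ε ≤ 1 / κ :=
      (eventually_le_nhds (by positivity)).filter_mono nhdsWithin_le_nhds
    have hsmall' : ∀ᶠ ε in 𝓝[>] (0 : ℝ), ε < Real.pi / δ :=
      (eventually_lt_nhds (by positivity)).filter_mono nhdsWithin_le_nhds
    filter_upwards [hsmall, hsmall', self_mem_nhdsWithin] with ε h1 h2 h3
    exact key ε h3 h1 ((lt_div_iff₀ hδ0).1 h2))
  have hX0 : ∀ t, Xp 0 t = X t := fun t => by
    simp [hXp, Ad]
  simp only [hX0, zero_mul, neg_zero, rot_zero, mul_one] at hle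
  rw [hlen, le_div_iff₀ hn0, mul_comm]
  exact hle

theorem distG_le (hn : 1 ≤ n) {w : SpTilde n} (hw : w ∈ closure (SpTildeEll n)) :
    distG 1 w ≤ ENNReal.ofReal (hphase w / n) :=
  iSup₂_le fun _ hc => ENNReal.ofReal_le_ofReal (lengthG_le hn hw hc)

/-! ### Infinite Lorentz distance -/

theorem one_add_sum_le_prod {ι : Type*} (s : Finset ι) (f : ι → ℝ) (hf : ∀ i, 0 ≤ f i) :
    1 + ∑ i ∈ s, f i ≤ ∏ i ∈ s, (1 + f i) := by
  classical
  induction s using Finset.induction_on with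
  | empty => simp
  | insert i s hi ih =>
    rw [Finset.sum_insert hi, Finset.prod_insert hi]
    have h1 : 0 ≤ ∑ j ∈ s, f j := Finset.sum_nonneg fun j _ => hf j
    have h2 := mul_le_mul_of_nonneg_left ih (by linarith [hf i] : 0 ≤ 1 + f i)
    have h3 := mul_nonneg (hf i) h1
    linarith

/-- Expanding ∏(1 + λᵢ) over the non-negative eigenvalues and keeping only the terms of degree at
most one. -/
theorem _root_.Matrix.PosSemidef.one_add_trace_le_det {m : Type*} [Fintype m] [DecidableEq m]
    {M : Matrix m m ℝ} (hM : M.PosSemidef) : 1 + M.trace ≤ (1 + M).det := by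
  have h1 : (1 + M).det = ∏ i, (1 + hM.isHermitian.eigenvalues i) := by
    have h2 := Matrix.eval_charpoly M (-1)
    rw [hM.isHermitian.charpoly_eq, Polynomial.eval_prod] at h2
    have h3 : scalar m (-1 : ℝ) - M = -(1 + M) := by
      rw [map_neg, map_one]; abel
    have h4 : ∀ i, Polynomial.eval (-1) (Polynomial.X -
        Polynomial.C ((hM.isHermitian.eigenvalues i : ℝ))) =
          -1 * (1 + hM.isHermitian.eigenvalues i) := fun i => by simp; ring
    simp only [RCLike.ofReal_real_eq_id, id_eq, h4, Finset.prod_mul_distrib, Finset.prod_const,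
      Finset.card_univ] at h2
    rw [h3, det_neg] at h2
    exact (mul_left_cancel₀ (pow_ne_zero _ (by norm_num)) h2).symm
  rw [h1, hM.isHermitian.trace_eq_sum_eigenvalues]
  exact one_add_sum_le_prod _ _ fun i => hM.eigenvalues_nonneg i

/-- Positivity needs testing only for (t, x) in the compact product of K and the unit sphere;
homogeneity gives the other vectors. -/
theorem eventually_posDef {m : Type*} [Fintype m] [DecidableEq m] {F : ℝ → ℝ → Matrix m m ℝ}
    (hF : Continuous (Function.uncurry F)) (hsymm : ∀ ε t, (F ε t)ᵀ = F ε t) {K : Set ℝ}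
    (hK : IsCompact K) (hpos : ∀ t ∈ K, (F 0 t).PosDef) :
    ∀ᶠ ε in 𝓝 0, ∀ t ∈ K, (F ε t).PosDef := by
  have hcont : Continuous fun q : ℝ × (ℝ × (m → ℝ)) => q.2.2 ⬝ᵥ (F q.1 q.2.1 *ᵥ q.2.2) := by
    have h1 : Continuous fun q : ℝ × (ℝ × (m → ℝ)) => F q.1 q.2.1 :=
      hF.comp (by fun_prop : Continuous fun q : ℝ × (ℝ × (m → ℝ)) => (q.1, q.2.1))
    fun_prop
  have h := (hK.prod (isCompact_sphere (0 : m → ℝ) 1)).eventually_forall_of_forall_eventually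
    (x₀ := (0 : ℝ)) (P := fun ε q => 0 < q.2 ⬝ᵥ (F ε q.1 *ᵥ q.2)) (fun q hq => by
      have hq2 : q.2 ≠ 0 := by
        intro h
        have := hq.2
        rw [h] at this
        simp at this
      have h2 := (posDef_iff_real.1 (hpos q.1 hq.1)).2 q.2 hq2
      have h3 := hcont.tendsto (0, q)
      exact h3.eventually (lt_mem_nhds h2))
  filter_upwards [h] with ε hε t ht
  refine posDef_iff_real.2 ⟨hsymm _ _, fun x hx => ?_⟩
  have hx' : ‖x‖ ≠ 0 := norm_ne_zero_iff.2 hx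
  have h1 := hε (t, ‖x‖⁻¹ • x) ⟨ht, by
    rw [mem_sphere_zero_iff_norm, norm_smul, norm_inv, norm_norm, inv_mul_cancel₀ hx']⟩
  simp only [mulVec_smul, dotProduct_smul, smul_dotProduct, smul_eq_mul] at h1
  have h2 : 0 < ‖x‖⁻¹ := by positivity
  exact (pos_iff_pos_of_mul_pos (by
    rwa [← mul_assoc] at h1)).1 (by positivity)

/-! ### Curves used to lengthen a timelike curve -/

theorem continuousOn_Ad {s : Set ℝ} {W : ℝ → Sp n} {X : ℝ → Mat n} (hW : ContinuousOn W s)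
    (hX : ContinuousOn X s) : ContinuousOn (fun t => Ad (W t) (X t)) s :=
  ((continuous_subtype_val.comp_continuousOn hW).mul hX).mul
    (continuous_subtype_val.comp_continuousOn hW.inv)

theorem HasVel.continuousOn_projSp {c : ℝ → SpTilde n} {s : Set ℝ} {X : ℝ → Mat n}
    (hc : HasVel c s X) : ContinuousOn (fun t => (c t).proj) s :=
  SpTilde.continuous_proj.comp_continuousOn hc.1

theorem HasVel.conj {ρ : ℝ → SpTilde n} {Y : ℝ → Mat n} {s : Set ℝ} (hρ : HasVel ρ s Y)
    (g : SpTilde n) : HasVel (fun t => g * ρ t * g⁻¹) s fun t => Ad g.proj (Y t) :=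
  (hρ.const_mul g).mul_const g⁻¹

theorem hasVel_rot_mul (ε : ℝ) (s : Set ℝ) :
    HasVel (fun t => rot (ε * t) : ℝ → SpTilde n) s fun _ => ε • J₀ n :=
  (hasVel_rot univ).comp (g := fun t => ε * t) (g' := fun _ => ε)
    (fun t _ => by simpa using ((hasDerivAt_id t).const_mul ε).hasDerivWithinAt)
    (mapsTo_univ _ _)

theorem Ad_rot_J (t : ℝ) : Ad (rot t : SpTilde n).proj (J₀ n) = J₀ n := by
  have h := UTilde.commute_J (rot_mem_UTilde (n := n) t)
  rw [Ad, h, Matrix.mul_assoc, Sp.mul_inv_coe, Matrix.mul_one]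

/-- A timelike curve ending outside of the closure of the elliptic region can be perturbed
together with its endpoint. -/
theorem exists_shifted_crossing {c : ℝ → SpTilde n} {X : ℝ → Mat n} {w : SpTilde n}
    (hc : HasVel c (Icc 0 1) X) (hXc : ContinuousOn X (Icc 0 1))
    (hX : ∀ t ∈ Icc (0 : ℝ) 1, (form (X t)).PosDef) (h0 : c 0 = 1) (h1 : c 1 = w)
    (hw : w ∉ closure (SpTildeEll n)) :
    ∃ ε : ℝ, 0 < ε ∧ ∃ (c' : ℝ → SpTilde n) (X' : ℝ → Mat n), HasVel c' (Icc 0 1) X' ∧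
      ContinuousOn X' (Icc 0 1) ∧ (∀ t ∈ Icc (0 : ℝ) 1, (form (X' t)).PosDef) ∧
      c' 1 = rot (-ε) * w * rot (-ε) ∧
      ∃ ν : Fin n ⊕ Fin n → ℝ, ν ≠ 0 ∧ ∀ l, 0 ≤ l → ∃ t ∈ Ioo (0 : ℝ) 1,
        c' t * shear ν (-l) ∈ SpTildeEll n := by
  set p : ℝ → ℝ := fun t => projIcc (0 : ℝ) 1 zero_le_one t with hp
  have hpmem : ∀ t, p t ∈ Icc (0 : ℝ) 1 := fun t => (projIcc _ _ _ t).2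
  have hpeq : ∀ t ∈ Icc (0 : ℝ) 1, p t = t := fun t ht => coe_projIcc_of_mem ht
  have hXpc : Continuous fun t => X (p t) := continuous_comp_projIcc hXc
  have hWpc : Continuous fun t => (c (p t)).proj :=
    continuous_comp_projIcc (SpTilde.continuous_proj.comp_continuousOn hc.1)
  -- Up to conjugation by a rotation, the form of the velocity of rot(-εt) c(t) rot(-εt). It is
  -- positive definite at ε = 0, hence for small ε.
  set F : ℝ → ℝ → Mat n := fun ε t =>
    form (X (p t) + (-ε) • J₀ n + Ad (c (p t)).proj ((-ε) • J₀ n)) with hF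
  have hFc : Continuous (Function.uncurry F) := by
    refine continuous_form.comp (((hXpc.comp continuous_snd).add (by fun_prop)).add ?_)
    exact continuous_Ad.comp ((hWpc.comp continuous_snd).prodMk
      (by fun_prop : Continuous fun q : ℝ × ℝ => (-q.1) • J₀ n))
  have hFs : ∀ ε t, (F ε t)ᵀ = F ε t := by
    intro ε t
    have h2 := (posDef_iff_real.1 (hX _ (hpmem t))).1
    simp only [hF]
    rw [form_add, form_add, form_smul, form_J, form_Ad, form_smul, form_J, transpose_add,
      transpose_add, h2, transpose_smul, transpose_one, Matrix.transpose_mul, Matrix.transpose_mul,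
      transpose_transpose, transpose_smul, transpose_one, Matrix.mul_assoc]
  have hev := eventually_posDef hFc hFs isCompact_Icc (K := Icc (0 : ℝ) 1) (fun t ht => by
    have : F 0 t = form (X (p t)) := by simp [hF, Ad]
    rw [this]
    exact hX _ (hpmem t))
  have hcl : ∀ᶠ ε in 𝓝 (0 : ℝ), rot (-ε) * w * rot (-ε) ∉ closure (SpTildeEll n) := by
    have hcont : Continuous fun ε : ℝ => rot (-ε) * w * rot (-ε) :=
      ((continuous_rot.comp continuous_neg).mul continuous_const).mul
        (continuous_rot.comp continuous_neg)
    exact hcont.continuousAt.eventually (isClosed_closure.isOpen_compl.mem_nhds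
      (by simpa [rot_zero] using hw))
  obtain ⟨ε, ⟨hε1, hε2⟩, hε0⟩ := (((hev.and hcl).filter_mono nhdsWithin_le_nhds).and
    (self_mem_nhdsWithin (a := (0 : ℝ)) (s := Ioi 0))).exists
  have hr := hasVel_rot_mul (n := n) (-ε) (Icc 0 1)
  have hvel := (hr.mul hc).mul hr
  set Y : ℝ → Mat n := fun t =>
    Ad (rot (-ε * t) : SpTilde n).proj (X t + (-ε) • J₀ n + Ad (c t).proj ((-ε) • J₀ n)) with hY
  have hvel' : HasVel (fun t => rot (-ε * t) * c t * rot (-ε * t)) (Icc 0 1) Y := by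
    refine hvel.congr fun t _ => ?_
    simp only [hY]
    rw [SpTilde.proj_mul, Ad_mul, Ad_add, Ad_add, Ad_smul (rot (-ε * t)).proj (-ε) (J₀ n), Ad_rot_J]
    abel
  have hYc : ContinuousOn Y (Icc 0 1) := by
    exact continuousOn_Ad hr.continuousOn_projSp ((hXc.add continuousOn_const).add
      (continuousOn_Ad hc.continuousOn_projSp continuousOn_const))
  have hYp : ∀ t ∈ Icc (0 : ℝ) 1, (form (Y t)).PosDef := by
    intro t ht
    have := hε1 t ht
    simp only [hF, hpeq t ht] at this
    exact posDef_form_Ad _ this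
  refine ⟨ε, hε0, _, Y, hvel', hYc, hYp, by simp only [mul_one, h1], ?_⟩
  -- The perturbed end-point is still outside the closure, which rules out the alternative of
  -- staying elliptic.
  refine (hvel'.elliptic_or_crossing hYp (by simp [h0, rot_zero])).resolve_left fun hall => hε2 ?_
  have := subset_closure (hall 1 ⟨one_pos, le_rfl⟩)
  simpa only [mul_one, h1] using this

/-- The Cayley scaling curve leads from 1 to the elliptic element c t · g, and multiplication by the
translated remaining arc of c, from t to 1, leads on to c 1 · g. Both factors move non-negatively.
-/
theorem exists_nonneg_curve {c : ℝ → SpTilde n} {X : ℝ → Mat n} (hc : HasVel c (Icc 0 1) X)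
    (hXc : ContinuousOn X (Icc 0 1)) (hX : ∀ t ∈ Icc (0 : ℝ) 1, (form (X t)).PosDef) {t : ℝ}
    (ht : t ∈ Ioo (0 : ℝ) 1) {g : SpTilde n} (hg : c t * g ∈ SpTildeEll n) :
    ∃ (ρ : ℝ → SpTilde n) (Y : ℝ → Mat n), HasVel ρ (Icc 0 1) Y ∧ ContinuousOn Y (Icc 0 1) ∧
      (∀ s ∈ Icc (0 : ℝ) 1, (form (Y s)).PosSemidef) ∧ ρ 0 = 1 ∧ ρ 1 = c 1 * g := by
  obtain ⟨O, hO, hOe⟩ := mem_SpTildeEll_iff.1 hg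
  obtain ⟨Z, hZc, hZ, hZp⟩ := hasVel_princ_sclSp hO
  have hm : MapsTo (fun s : ℝ => t + s * (1 - t)) (Icc 0 1) (Icc 0 1) := by
    intro s hs
    have h1 := mul_nonneg hs.1 (by linarith [ht.2] : 0 ≤ 1 - t)
    have h2 := mul_le_mul_of_nonneg_right hs.2 (by linarith [ht.2] : 0 ≤ 1 - t)
    constructor <;> simp only <;> linarith [ht.1]
  have hd := ((hc.comp (s' := Icc 0 1) (g := fun s => t + s * (1 - t)) (g' := fun _ => 1 - t)
    (fun s _ => by
      simpa using (((hasDerivAt_id s).mul_const (1 - t)).const_add t).hasDerivWithinAt)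
    hm).mul_const g).const_mul (c t * g)⁻¹
  have hρ := hZ.mul hd
  have hD := SpEll_subset_sclDom hO
  refine ⟨_, _, hρ, ?_, fun s hs => ?_, ?_, ?_⟩
  · exact hZc.add (continuousOn_Ad hZ.continuousOn_projSp (continuousOn_Ad continuousOn_const
      ((hXc.comp (by fun_prop) hm).const_smul (1 - t))))
  · rw [form_add]
    refine (hZp s hs).posSemidef.add (posSemidef_form_Ad _ (posSemidef_form_Ad _ ?_))
    rw [form_smul]
    exact (hX _ (hm hs)).posSemidef.smul (by linarith [ht.2])
  · simp [sclSp_zero hD, princ_one]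
  · simp only [sclSp_one, hOe, one_mul]
    rw [mul_inv_cancel_left]
    congr 2
    ring

/-- Conjugating the rotation field by a long shear makes its trace grow quadratically in the shear
parameter, although its determinant stays 1. This growth produces arbitrarily large length. -/
theorem trace_form_Ad_shear (ν : Fin n ⊕ Fin n → ℝ) (a : ℝ) :
    (form (Ad (shear ν a).proj (J₀ n))).trace = 2 * n + a ^ 2 * (ν ⬝ᵥ ν) ^ 2 := by
  have hJ : (J₀ n *ᵥ ν) ⬝ᵥ (J₀ n *ᵥ ν) = ν ⬝ᵥ ν := by
    rw [← dotProduct_transpose_mulVec, mulVec_mulVec, J_transpose', Matrix.neg_mul, J_mul_J,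
      neg_neg, one_mulVec]
  have h0 : (J₀ n *ᵥ ν) ⬝ᵥ ν = 0 := by
    rw [dotProduct_comm, dotProduct_J_mulVec_self]
  have hN : (vecMulVec (J₀ n *ᵥ ν) ν)ᵀ * vecMulVec (J₀ n *ᵥ ν) ν =
      (ν ⬝ᵥ ν) • vecMulVec ν ν := by
    rw [transpose_vecMulVec, vecMulVec_mul_vecMulVec, hJ]
    ext i j
    simp only [vecMulVec_apply, Matrix.smul_apply, smul_eq_mul, Pi.smul_apply]
    ring
  rw [form_Ad, form_J, Matrix.mul_one, ← SpTilde.proj_inv, ← shear_neg, coe_proj_shear]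
  simp only [transpose_add, transpose_one, transpose_smul, Matrix.add_mul, Matrix.mul_add,
    Matrix.one_mul, Matrix.mul_one, Matrix.smul_mul, Matrix.mul_smul, hN, trace_add, trace_smul,
    trace_transpose, trace_vecMulVec, h0, trace_one, Fintype.card_sum, Fintype.card_fin,
    smul_eq_mul]
  push_cast
  ring

/-- In ρ · rot · shear · rot, the first rotation contributes a definite term εJ₀. The last one, seen
through the shear, has trace at least ε (lt)² |ν|⁴. Then det(ε + M) ≥ ε²ⁿ (1 + tr M / ε) bounds G
from below by C t. -/
theorem exists_causal_curve_of_shear (hn : 1 ≤ n) {ρ : ℝ → SpTilde n} {Y : ℝ → Mat n}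
    (hρ : HasVel ρ (Icc 0 1) Y) (hYc : ContinuousOn Y (Icc 0 1))
    (hY : ∀ t ∈ Icc (0 : ℝ) 1, (form (Y t)).PosSemidef) (h0 : ρ 0 = 1)
    (ν : Fin n ⊕ Fin n → ℝ) {ε l C : ℝ} (hε : 0 < ε) (hl : 0 ≤ l) (hC : 0 ≤ C)
    (hCl : C ^ n = ε ^ n * (l * (ν ⬝ᵥ ν))) :
    ∃ d : ℝ → SpTilde n, IsCausalCurve d 1 (ρ 1 * (rot ε * (shear ν l * rot ε))) ∧
      C / 2 ≤ lengthG d := by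
  have hr := hasVel_rot_mul (n := n) ε (Icc 0 1)
  have hs : HasVel (fun t => shear ν (l * t)) (Icc 0 1)
      fun _ => l • vecMulVec (J₀ n *ᵥ ν) ν :=
    (hasVel_shear ν univ).comp (g := fun t => l * t) (g' := fun _ => l)
      (fun t _ => by simpa using ((hasDerivAt_id t).const_mul l).hasDerivWithinAt)
      (mapsTo_univ _ _)
  -- The velocity is factored as `Ad` of ρ · rot, which does not change determinants; rotations fix
  -- J₀ under `Ad`, so the first rotation contributes exactly εJ₀ inside.
  set Z : ℝ → Mat n := fun t => Ad ((ρ t).proj * (rot (ε * t) : SpTilde n).proj)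
    (ε • J₀ n + (Ad ((ρ t).proj * (rot (ε * t) : SpTilde n).proj)⁻¹ (Y t) +
      (l • vecMulVec (J₀ n *ᵥ ν) ν + Ad (shear ν (l * t)).proj (ε • J₀ n)))) with hZ
  have hd : HasVel (fun t => ρ t * (rot (ε * t) * (shear ν (l * t) * rot (ε * t)))) (Icc 0 1) Z := by
    refine (hρ.mul (hr.mul (hs.mul hr))).congr fun t _ => ?_
    simp only [hZ]
    have hJ : Ad ((ρ t).proj * (rot (ε * t) : SpTilde n).proj) (ε • J₀ n) =
        Ad (ρ t).proj (ε • J₀ n) := by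
      rw [Ad_mul, Ad_smul (rot (ε * t)).proj, Ad_rot_J]
    rw [Ad_add ((ρ t).proj * (rot (ε * t)).proj) (ε • J₀ n), Ad_add _ (Ad ((ρ t).proj * (rot (ε * t)).proj)⁻¹ (Y t)), ← Ad_mul _ _ (Y t), mul_inv_cancel, Ad_one, hJ,
      Ad_mul, Ad_add (ρ t).proj (ε • J₀ n)]
    abel
  have hZc : ContinuousOn Z (Icc 0 1) := by
    have hg : ContinuousOn (fun t => (ρ t).proj * (rot (ε * t) : SpTilde n).proj) (Icc 0 1) :=
      hρ.continuousOn_projSp.mul hr.continuousOn_projSp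
    exact continuousOn_Ad hg (continuousOn_const.add ((continuousOn_Ad hg.inv hYc).add
      (continuousOn_const.add (continuousOn_Ad hs.continuousOn_projSp continuousOn_const))))
  have hM : ∀ t ∈ Icc (0 : ℝ) 1,
      (form (Ad ((ρ t).proj * (rot (ε * t) : SpTilde n).proj)⁻¹ (Y t) +
      (l • vecMulVec (J₀ n *ᵥ ν) ν + Ad (shear ν (l * t)).proj (ε • J₀ n)))).PosSemidef ∧
      ε * ((l * t) ^ 2 * (ν ⬝ᵥ ν) ^ 2) ≤
      (form (Ad ((ρ t).proj * (rot (ε * t) : SpTilde n).proj)⁻¹ (Y t) +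
      (l • vecMulVec (J₀ n *ᵥ ν) ν + Ad (shear ν (l * t)).proj (ε • J₀ n)))).trace := by
    intro t ht
    have hA := posSemidef_form_Ad ((ρ t).proj * (rot (ε * t) : SpTilde n).proj)⁻¹ (hY t ht)
    have hB : (form (l • vecMulVec (J₀ n *ᵥ ν) ν)).PosSemidef := by
      rw [form_smul]; exact (posSemidef_form_shear ν).smul hl
    have hE : (form (Ad (shear ν (l * t)).proj (ε • J₀ n))).PosSemidef := by
      refine posSemidef_form_Ad _ ?_
      rw [form_smul, form_J]
      exact PosSemidef.one.smul hε.le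
    have htr : (form (Ad (shear ν (l * t)).proj (ε • J₀ n))).trace =
        ε * (2 * n + (l * t) ^ 2 * (ν ⬝ᵥ ν) ^ 2) := by
      rw [Ad_smul, form_smul, trace_smul, trace_form_Ad_shear, smul_eq_mul]
    rw [form_add, form_add]
    refine ⟨hA.add (hB.add hE), ?_⟩
    rw [trace_add, trace_add, htr]
    have h1 := hA.trace_nonneg
    have h2 := hB.trace_nonneg
    have h3 : 0 ≤ ε * (2 * n) := by positivity
    linarith
  have hn0 : (0 : ℝ) < n := by exact_mod_cast hn
  have hne : Nonempty (Fin n ⊕ Fin n) := ⟨Sum.inl ⟨0, hn⟩⟩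
  have hpd : ∀ t ∈ Icc (0 : ℝ) 1, (form (Z t)).PosDef := by
    intro t ht
    refine posDef_form_Ad _ ?_
    rw [form_add, form_smul, form_J]
    exact (PosDef.one.smul hε).add_posSemidef (hM t ht).1
  have hG : ∀ t ∈ Icc (0 : ℝ) 1, C * t ≤ G n (Z t) := by
    intro t ht
    obtain ⟨hM1, hM2⟩ := hM t ht
    set M := Ad ((ρ t).proj * (rot (ε * t) : SpTilde n).proj)⁻¹ (Y t) +
      (l • vecMulVec (J₀ n *ᵥ ν) ν + Ad (shear ν (l * t)).proj (ε • J₀ n)) with hMdef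
    have hdet : (Z t).det = ε ^ (2 * n) * (1 + ε⁻¹ • form M).det := by
      simp only [hZ]
      rw [det_Ad, ← hMdef, ← det_form, form_add, form_smul, form_J]
      have : ε • (1 : Mat n) + form M = ε • (1 + ε⁻¹ • form M) := by
        rw [smul_add, smul_smul, mul_inv_cancel₀ hε.ne', one_smul]
      rw [this, det_smul, Fintype.card_sum, Fintype.card_fin, two_mul]
    have h1 := (hM1.smul (inv_pos.2 hε).le).one_add_trace_le_det
    rw [trace_smul, smul_eq_mul] at h1
    have h2 : (l * t) ^ 2 * (ν ⬝ᵥ ν) ^ 2 ≤ ε⁻¹ * (form M).trace := by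
      rw [inv_mul_eq_div, le_div_iff₀ hε, mul_comm]
      exact hM2
    have hCt : 0 ≤ C * t := mul_nonneg hC ht.1
    have h3 : (C * t) ^ (2 * n) ≤ (Z t).det := by
      -- The trace only gives t², while a linear lower bound for G asks for t²ⁿ, which is smaller on
      -- [0, 1].
      have h4 : t ^ (2 * n) ≤ t ^ 2 := pow_le_pow_of_le_one ht.1 ht.2 (by omega)
      have h5 : C ^ (2 * n) = ε ^ (2 * n) * (l * (ν ⬝ᵥ ν)) ^ 2 := by
        rw [mul_comm 2 n, pow_mul, hCl, mul_pow, ← pow_mul]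
      have h6 : (0 : ℝ) ≤ ε ^ (2 * n) * (l * (ν ⬝ᵥ ν)) ^ 2 := by positivity
      calc (C * t) ^ (2 * n) = ε ^ (2 * n) * (l * (ν ⬝ᵥ ν)) ^ 2 * t ^ (2 * n) := by
            rw [mul_pow, h5]
        _ ≤ ε ^ (2 * n) * (l * (ν ⬝ᵥ ν)) ^ 2 * t ^ 2 := mul_le_mul_of_nonneg_left h4 h6
        _ = ε ^ (2 * n) * ((l * t) ^ 2 * (ν ⬝ᵥ ν) ^ 2) := by ring
        _ ≤ _ := by
            rw [hdet]
            exact mul_le_mul_of_nonneg_left (by linarith) (by positivity)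
    have h7 := Real.rpow_le_rpow (by positivity) h3 (z := 1 / (2 * (n : ℝ))) (by positivity)
    have h8 : ((C * t) ^ (2 * n)) ^ (1 / (2 * (n : ℝ))) = C * t := by
      have := Real.pow_rpow_inv_natCast hCt (n := 2 * n) (by omega)
      rwa [Nat.cast_mul, Nat.cast_ofNat, ← one_div] at this
    rw [h8] at h7
    exact h7
  refine ⟨_, ⟨hd.isC1Curve hZc, by simp [h0, rot_zero], by simp only [mul_one], fun t ht => ?_⟩, ?_⟩
  · rw [hd.velocity_eq ht]
    refine ⟨(hpd t ht).posSemidef, fun h => ?_⟩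
    have h1 := (hpd t ht).det_pos
    rw [h, form_zero, det_zero] at h1
    exact lt_irrefl _ h1
  · have h1 : lengthG (fun t => ρ t * (rot (ε * t) * (shear ν (l * t) * rot (ε * t)))) =
        ∫ t in (0 : ℝ)..1, G n (Z t) := by
      refine intervalIntegral.integral_congr fun t ht => ?_
      rw [uIcc_of_le zero_le_one] at ht
      simp only [hd.velocity_eq ht]
    rw [h1]
    have h2 : C / 2 = ∫ t in (0 : ℝ)..1, C * t := by
      rw [intervalIntegral.integral_const_mul, integral_id]; ring
    rw [h2]
    refine intervalIntegral.integral_mono_on zero_le_one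
      (by exact (continuous_const.mul continuous_id).intervalIntegrable _ _) ?_ hG
    refine ContinuousOn.intervalIntegrable ?_
    rw [uIcc_of_le zero_le_one]
    exact continuous_G.comp_continuousOn hZc

/-- The crossing of the slightly unrotated curve allows a shear of any length l to be removed; the
curve is then restored to w by inserting the shear between the two reserved rotations, with length
growing like the n-th root of l. -/
theorem distG_eq_top (hn : 1 ≤ n) {w : SpTilde n} {c : ℝ → SpTilde n}
    (hc : IsTimelikeCurve c 1 w) (hw : w ∉ closure (SpTildeEll n)) : distG 1 w = ⊤ := by
  obtain ⟨hC1, h0, h1, hpos⟩ := hc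
  obtain ⟨hv, hvc⟩ := hC1.hasVel
  obtain ⟨ε, hε, c', X', hv', hX'c, hX'p, hc'1, ν, hν, hcross⟩ :=
    exists_shifted_crossing hv hvc hpos h0 h1 hw
  have hm : 0 < ν ⬝ᵥ ν := by
    have h1 : 0 ≤ ν ⬝ᵥ ν := Finset.sum_nonneg fun i _ => mul_self_nonneg _
    exact h1.lt_of_ne fun h => hν (dotProduct_self_eq_zero.1 h.symm)
  refine ENNReal.eq_top_of_forall_nnreal_le fun K => ?_
  -- Solves Cⁿ = εⁿ l |ν|² for C = 2K, so that the resulting curve has length at least K.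
  set l := (2 * (K : ℝ)) ^ n / (ε ^ n * (ν ⬝ᵥ ν)) with hl
  have hl0 : 0 ≤ l := by positivity
  obtain ⟨t, ht, htl⟩ := hcross l hl0
  obtain ⟨ρ, Y, hρ, hYc, hY, hρ0, hρ1⟩ := exists_nonneg_curve hv' hX'c hX'p ht htl
  obtain ⟨d, hd, hlen⟩ := exists_causal_curve_of_shear hn (hρ.conj (rot ε))
    (continuousOn_Ad continuousOn_const hYc)
    (fun t ht => posSemidef_form_Ad _ (hY t ht)) (by simp [hρ0]) ν hε hl0 (C := 2 * K)
    (by positivity) (by rw [hl]; field_simp)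
  -- Conjugating ρ by rot ε moves the reserved rotation to the left end; the inserted shear cancels
  -- the removed one, and the two rotations undo the perturbation of w.
  have hend : rot ε * ρ 1 * (rot ε)⁻¹ * (rot ε * (shear ν l * rot ε)) = w := by
    rw [hρ1, hc'1, shear_neg, rot_neg]
    group
  rw [hend] at hd
  refine le_trans ?_ (le_iSup₂ (f := fun d (_ : IsCausalCurve d 1 w) =>
    ENNReal.ofReal (lengthG d)) d hd)
  rw [← ENNReal.ofReal_coe_nnreal]
  refine ENNReal.ofReal_le_ofReal ?_
  linarith

end SympLorentz

end

/-! ### The main theorem -/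

open SympLorentz in
theorem mainTheorem1 (n : ℕ) (hn : 1 ≤ n) :
    -- the homogeneous Maslov quasimorphism is well defined
    (IsHomogeneousMaslov n (maslov n) ∧ ∀ f, IsHomogeneousMaslov n f → f = maslov n) ∧
    ∀ w : SpTilde n,
      (w ∈ closure (SpTildeEll n) →
        ∃ θ : Fin n → ℝ, (∀ j, θ j ∈ Set.Icc 0 Real.pi) ∧
          (complexify (w.proj : Mat n)).charpoly =
            ∏ j, (Polynomial.X - Polynomial.C (Complex.exp (θ j * Complex.I))) *
              (Polynomial.X - Polynomial.C (Complex.exp (-(θ j * Complex.I)))) ∧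
          distG 1 w ≤ ENNReal.ofReal (2 * Real.pi / n * maslov n w) ∧
          2 * Real.pi / n * maslov n w = 1 / n * ∑ j, θ j) ∧
      ((∃ c, IsTimelikeCurve c 1 w) → w ∉ closure (SpTildeEll n) → distG 1 w = ⊤) := by
  refine ⟨⟨maslov_spec, fun f hf => hf.eq.trans maslov_eq.symm⟩, fun w => ⟨fun hw => ?_, ?_⟩⟩
  · obtain ⟨θ, h1, h2, h3⟩ := exists_angles_of_mem_closure hw
    have h4 : 2 * Real.pi / n * maslov n w = hphase w / n := by
      rw [maslov_eq]
      field_simp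
    refine ⟨θ, h1, h2, ?_, ?_⟩
    · rw [h4]
      exact distG_le hn hw
    · rw [h4, h3, one_div_mul_eq_div]
  · rintro ⟨c, hc⟩ hw
    exact distG_eq_top hn hc hw
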